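/- Let $V$ be a real vector space of finite dimension $s\ge 1$, let $X_1,w_1,\dots,w_s\in V$ and let $(l_k)_{1\le k\le s}$ be a basis of linear forms on $V$ such that: (i) $X_1\ne 0$ and $l_k(X_1)\ge 0$ for all $k$; (ii) $\sum_{j=1}^s l_j(w_k)=1$ for all $k$; (iii) for all $k\neq k'$, $l_k(w_{k'})\ge 0$, and for all $k$, $l_k(w_k)\ge 0$ or $l_k(X_1)\mathbb Z+\sum_{j}l_k(w_j)\mathbb Z=l_k(w_k)\mathbb Z$. Put $\tau_1=\sum_k l_k(X_1)>0$. The associated Pólya process is the random walk $(X_n)_{n\ge 1}$ in $V$ that starts at $X_1$ and for which, conditionally on $X_1,\dots,X_n$, $X_{n+1}=X_n+w_k$ with probability $l_k(X_n)/(n+\tau_1-1)$, $1\le k\le s$ (the probabilities being added when some $w_k$ coincide). Let $A(v)=\sum_k l_k(v)w_k$, also regarded as an endomorphism of $V_{\mathbb C}=V\otimes_{\mathbb R}\mathbb C$. Let $\sigma_2=1$ if $1$ is a multiple eigenvalue of $A$, and $\sigma_2=\max\{\Re\lambda:\lambda\in\mathrm{Sp}(A),\ \lambda\ne 1\}$ otherwise;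 the process is large when $\sigma_2>1/2$ (it is called small, not large, when $s=1$). A Jordan basis is a basis $(u_k)_{1\le k\le s}$ of linear forms on $V_{\mathbb C}$ with $u_1=\sum_k l_k$ and, for $k\ge 2$, $u_k\circ A=\lambda_ku_k+\varepsilon_ku_{k-1}$, where $\lambda_k\in\mathbb C$, $\varepsilon_k\in\{0,1\}$, and $\varepsilon_k=0$ if $\lambda_k\ne\lambda_{k-1}$; put $\lambda_1=1$, $\varepsilon_1=0$, and let $(v_k)$ be the basis of $V_{\mathbb C}$ dual to $(u_k)$. The form $u_k$ is an eigenform when $u_k\circ A=\lambda_ku_k$. A monogenic block is a maximal set of indices $J=\{m,\dots,m+q\}$ with $\varepsilon_m=0$ and $\varepsilon_k=1$ for the other $k\in J$; all $\lambda_k$, $k\in J$, are then equal to one root $\lambda(J)$. It is principal when $\Re\lambda(J)=\sigma_2$ and $J$ has maximal size among the monogenic blocks $J'$ with $\Re\lambda(J')=\sigma_2$. The process is principally semisimple when, for every Jordan basis, all principal blocks have size one. For $f:V\to\mathbb C$ let $\Phi(f)(v)=\sum_k l_k(v)\,[f(v+w_k)-f(v)]$. For $\alpha\in(\mathbb Z_{\ge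 0})^s$ put $\langle\alpha,\lambda\rangle=\sum_k\alpha_k\lambda_k$ and ${\bf u}^\alpha=\prod_k u_k^{\alpha_k}$. The space $S(V)$ of complex polynomial functions on $V$ is the direct sum of the characteristic spaces $\ker(\Phi-z)^\infty=\bigcup_p\ker(\Phi-z)^p$, $z\in\mathbb C$, of $\Phi$ on $S(V)$. The reduced polynomial $Q_\alpha$ is the projection of ${\bf u}^\alpha$ on $\ker(\Phi-\langle\alpha,\lambda\rangle)^\infty$ parallel to $\bigoplus_{z\ne\langle\alpha,\lambda\rangle}\ker(\Phi-z)^\infty$. Theorem. Suppose that the Pólya process $(X_n)_n$ is large and principally semisimple. Fix a Jordan basis $(u_k)_{1\le k\le s}$ such that $u_1,\dots,u_r$ ($2\le r\le s$) are all the eigenforms of the basis that are associated with roots having real part $\ge\sigma_2$. Then there exist complex-valued random variables $W_2,\dots,W_r$, unique up to almost sure equality, such that $$X_n=nv_1+\sum_{2\le k\le r}n^{\lambda_k}W_kv_k+o(n^{\sigma_2})\qquad(n\to\infty),$$ the small $o$ being almost sure and in $L^p$ for every (finite) $p\ge 1$. Furthermore all joint moments of $W_2,\dots,W_r$ exist and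 are given by: for all $\alpha_2,\dots,\alpha_r\in\mathbb Z_{\ge 0}$, $$E\Big(\prod_{2\le k\le r}W_k^{\alpha_k}\Big)=\frac{\Gamma(\tau_1)}{\Gamma(\tau_1+\langle\alpha,\lambda\rangle)}\,Q_\alpha(X_1),\qquad \alpha=(0,\alpha_2,\dots,\alpha_r,0,\dots,0).$$ -/

import Mathlib

open MeasureTheory Filter Topology Asymptotics
open scoped ENNReal TensorProduct

namespace Polya

section Data

/-- The data of a Pólya process of dimension `s` on the real vector space `V`: the initial vector
`x₁`, the increments `w k`, and a basis `l k` of linear forms, subject to the initialization,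
balance and tenability hypotheses. Colours are indexed by `Fin s`. -/
structure PolyaData (V : Type*) [AddCommGroup V] [Module ℝ V] (s : ℕ) where
  /-- initial vector -/
  x₁ : V
  /-- increment vectors -/
  w : Fin s → V
  /-- basis of linear forms -/
  l : Module.Basis (Fin s) ℝ (Module.Dual ℝ V)
  init_ne_zero : x₁ ≠ 0
  init_nonneg : ∀ k, 0 ≤ l k x₁
  balance : ∀ k, ∑ j, l j (w k) = 1
  tenable_off_diag : ∀ k k', k ≠ k' → 0 ≤ l k (w k')
  tenable_diag : ∀ k, 0 ≤ l k (w k) ∨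
    AddSubgroup.zmultiples (l k x₁) ⊔ (⨆ j, AddSubgroup.zmultiples (l k (w j)))
      = AddSubgroup.zmultiples (l k (w k))

variable {V : Type*} [AddCommGroup V] [Module ℝ V] {s : ℕ}

/-- `τ₁ = ∑ₖ lₖ(X₁)`. -/
noncomputable def PolyaData.tau1 (D : PolyaData V s) : ℝ := ∑ k, D.l k D.x₁

/-- The replacement endomorphism `A(v) = ∑ₖ lₖ(v) wₖ`. -/
noncomputable def PolyaData.replacement (D : PolyaData V s) : V →ₗ[ℝ] V :=
  ∑ k, (D.l k).smulRight (D.w k)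

/-- The replacement endomorphism on the complexified space `V_ℂ = ℂ ⊗ V`. -/
noncomputable def PolyaData.replacementC (D : PolyaData V s) : Module.End ℂ (ℂ ⊗[ℝ] V) :=
  D.replacement.baseChange ℂ

/-- `σ₂` is `1` when `1` is a multiple eigenvalue of `A`, and otherwise the maximum of the real
parts of the complex eigenvalues of `A` different from `1`. (If `1` is the only eigenvalue and it is
simple, that is if `s = 1`, the value is the conventional `0`.) -/
noncomputable def PolyaData.sigma2 [FiniteDimensional ℝ V] (D : PolyaData V s) : ℝ :=
  if 2 ≤ D.replacementC.charpoly.rootMultiplicity 1 then 1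
  else sSup {x : ℝ | ∃ z : ℂ, D.replacementC.HasEigenvalue z ∧ z ≠ 1 ∧ x = z.re}

/-- The process is large when `σ₂ > 1/2`. -/
def PolyaData.IsLarge [FiniteDimensional ℝ V] (D : PolyaData V s) : Prop := 1 / 2 < D.sigma2

/-- A Jordan basis of linear forms of the process, with its roots `lam k` and the numbers
`eps k ∈ {0, 1}`; the first index is `0 : Fin s`. -/
structure JordanBasis [NeZero s] (D : PolyaData V s) where
  /-- the linear forms on the complexified space -/
  u : Module.Basis (Fin s) ℂ (Module.Dual ℂ (ℂ ⊗[ℝ] V))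
  /-- the roots -/
  lam : Fin s → ℂ
  /-- the entries next to the diagonal -/
  eps : Fin s → ℂ
  u_zero : u 0 = ∑ k, (D.l k).baseChange ℂ
  lam_zero : lam 0 = 1
  eps_zero : eps 0 = 0
  eps_mem : ∀ k, eps k = 0 ∨ eps k = 1
  comp_eq : ∀ j k : Fin s, (j : ℕ) + 1 = k →
    u k ∘ₗ D.replacementC = lam k • u k + eps k • u j
  eps_eq_zero : ∀ j k : Fin s, (j : ℕ) + 1 = k → lam k ≠ lam j → eps k = 0

end Data

section Jordan

variable {V : Type*} [AddCommGroup V] [Module ℝ V] {s : ℕ} [NeZero s] {D : PolyaData V s}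

/-- The dual basis `(vₖ)` of a Jordan basis `(uₖ)`. -/
noncomputable def JordanBasis.v [FiniteDimensional ℝ V] (B : JordanBasis D) :
    Module.Basis (Fin s) ℂ (ℂ ⊗[ℝ] V) :=
  B.u.dualBasis.map (Module.evalEquiv ℂ (ℂ ⊗[ℝ] V)).symm

theorem JordanBasis.u_v [FiniteDimensional ℝ V] (B : JordanBasis D) (k j : Fin s) :
    B.u k (B.v j) = if k = j then 1 else 0 := by
  have h : Module.evalEquiv ℂ (ℂ ⊗[ℝ] V) (B.v j) = B.u.dualBasis j := by
    simp [JordanBasis.v]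
  have h2 := LinearMap.congr_fun h (B.u k)
  rw [Module.Basis.dualBasis_apply_self] at h2
  exact h2

/-- `u k` is an eigenform. -/
def JordanBasis.IsEigenform (B : JordanBasis D) (k : Fin s) : Prop :=
  B.u k ∘ₗ D.replacementC = B.lam k • B.u k

/-- `J = {m, …, M}` with `eps m = 0` and `eps k = 1` for the other indices `k` of `J`. -/
def JordanBasis.IsChainOfIndices (B : JordanBasis D) (J : Finset (Fin s)) : Prop :=
  ∃ m M : Fin s, m ≤ M ∧ J = Finset.Icc m M ∧ B.eps m = 0 ∧ ∀ k, m < k → k ≤ M → B.eps k = 1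

/-- Monogenic blocks of indices. -/
def JordanBasis.IsMonogenicBlock (B : JordanBasis D) (J : Finset (Fin s)) : Prop :=
  Maximal B.IsChainOfIndices J

/-- Principal blocks: monogenic blocks whose root has real part `σ₂`, of maximal size among
these. -/
def JordanBasis.IsPrincipalBlock [FiniteDimensional ℝ V] (B : JordanBasis D)
    (J : Finset (Fin s)) : Prop :=
  B.IsMonogenicBlock J ∧ (∀ k ∈ J, (B.lam k).re = D.sigma2) ∧
    ∀ J' : Finset (Fin s), B.IsMonogenicBlock J' → (∀ k ∈ J', (B.lam k).re = D.sigma2) →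
      J'.card ≤ J.card

/-- The process is principally semisimple when all principal blocks have size one, for any choice
of a Jordan basis. -/
def PolyaData.IsPrincipallySemisimple [FiniteDimensional ℝ V] (D : PolyaData V s) : Prop :=
  ∀ (B : JordanBasis D) (J : Finset (Fin s)), B.IsPrincipalBlock J → J.card = 1

end Jordan

section Operator

variable {V : Type*} [AddCommGroup V] [Module ℝ V] {s : ℕ}

/-- The transition operator `Φ(f)(v) = ∑ₖ lₖ(v) (f(v + wₖ) - f(v))` on functions `V → ℂ`. -/
noncomputable def PolyaData.transition (D : PolyaData V s) : Module.End ℂ (V → ℂ) where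
  toFun f := fun v => ∑ k, ((D.l k v : ℝ) : ℂ) * (f (v + D.w k) - f v)
  map_add' f g := by
    funext v
    simp only [Pi.add_apply, ← Finset.sum_add_distrib]
    exact Finset.sum_congr rfl fun k _ => by ring
  map_smul' c f := by
    funext v
    simp only [Pi.smul_apply, smul_eq_mul, RingHom.id_apply, Finset.mul_sum]
    exact Finset.sum_congr rfl fun k _ => by ring

/-- The restriction to `V` of a linear form on the complexified space. -/
noncomputable def restrictForm (V : Type*) [AddCommGroup V] [Module ℝ V] :
    Module.Dual ℂ (ℂ ⊗[ℝ] V) →ₗ[ℂ] (V → ℂ) where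
  toFun φ := fun v => φ (1 ⊗ₜ[ℝ] v)
  map_add' _ _ := rfl
  map_smul' _ _ := rfl

/-- The space `S(V)` of (complex-valued) polynomial functions on `V`. -/
noncomputable def polyFunctions (V : Type*) [AddCommGroup V] [Module ℝ V] :
    Submodule ℂ (V → ℂ) :=
  Subalgebra.toSubmodule (Algebra.adjoin ℂ (Set.range (restrictForm V)))

/-- The characteristic space `ker (Φ - z)^∞` of `Φ` on `S(V)`. -/
noncomputable def PolyaData.charSpace (D : PolyaData V s) (z : ℂ) : Submodule ℂ (V → ℂ) :=
  polyFunctions V ⊓ D.transition.maxGenEigenspace z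

/-- `f` is the projection of `g` on `ker (Φ - z)^∞` parallel to the sum of the other
characteristic spaces. -/
def PolyaData.IsCharProjection (D : PolyaData V s) (z : ℂ) (g f : V → ℂ) : Prop :=
  f ∈ D.charSpace z ∧ g - f ∈ ⨆ z' ≠ z, D.charSpace z'

/-- Affine functions on `V`. -/
noncomputable def affineFunctions (V : Type*) [AddCommGroup V] [Module ℝ V] :
    Submodule ℂ (V → ℂ) := 1 ⊔ LinearMap.range (restrictForm V)

theorem affineFunctions_pow_le (d : ℕ) : affineFunctions V ^ d ≤ polyFunctions V := by
  have h1 : affineFunctions V ≤ polyFunctions V := by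
    refine sup_le ?_ ?_
    · rw [Submodule.one_le]
      exact Subalgebra.one_mem _
    · rintro _ ⟨φ, rfl⟩
      exact Algebra.subset_adjoin ⟨φ, rfl⟩
  induction d with
  | zero =>
    rw [pow_zero, Submodule.one_le]
    exact Subalgebra.one_mem _
  | succ d ih =>
    rw [pow_succ, Submodule.mul_le]
    intro f hf g hg
    exact Subalgebra.mul_mem _ (ih hf) (h1 hg)

theorem exists_mem_affineFunctions_pow {f : V → ℂ} (hf : f ∈ polyFunctions V) :
    ∃ d, f ∈ affineFunctions V ^ d := by
  have hmono : ∀ {a b : ℕ}, a ≤ b → affineFunctions V ^ a ≤ affineFunctions V ^ b :=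
    fun h => pow_le_pow_right₀ (show (1 : Submodule ℂ (V → ℂ)) ≤ affineFunctions V from le_sup_left) h
  change f ∈ Algebra.adjoin ℂ (Set.range (restrictForm V)) at hf
  induction hf using Algebra.adjoin_induction with
  | mem x hx =>
    refine ⟨1, ?_⟩
    rw [pow_one]
    exact (le_sup_right : _ ≤ affineFunctions V) hx
  | algebraMap c =>
    refine ⟨0, ?_⟩
    rw [pow_zero]
    exact Submodule.algebraMap_mem c
  | add x y _ _ hx hy =>
    obtain ⟨a, ha⟩ := hx
    obtain ⟨b, hb⟩ := hy
    exact ⟨max a b, add_mem (hmono (le_max_left _ _) ha) (hmono (le_max_right _ _) hb)⟩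
  | mul x y _ _ hx hy =>
    obtain ⟨a, ha⟩ := hx
    obtain ⟨b, hb⟩ := hy
    refine ⟨a + b, ?_⟩
    rw [pow_add]
    exact Submodule.mul_mem_mul ha hb

theorem diff_affine {f : V → ℂ} (hf : f ∈ affineFunctions V) (w : V) :
    (fun v => f (v + w) - f v) ∈ (1 : Submodule ℂ (V → ℂ)) := by
  obtain ⟨g, hg, h, hh, rfl⟩ := Submodule.mem_sup.1 hf
  obtain ⟨c, rfl⟩ := Submodule.mem_one.1 hg
  obtain ⟨φ, rfl⟩ := hh
  refine Submodule.mem_one.2 ⟨φ (1 ⊗ₜ[ℝ] w), ?_⟩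
  funext v
  simp [restrictForm, TensorProduct.tmul_add]

theorem diff_mem (w : V) (d : ℕ) : ∀ f ∈ affineFunctions V ^ (d + 1),
    (fun v => f (v + w) - f v) ∈ affineFunctions V ^ d := by
  have hone : (1 : Submodule ℂ (V → ℂ)) ≤ affineFunctions V := le_sup_left
  induction d with
  | zero =>
    intro f hf
    rw [zero_add, pow_one] at hf
    rw [pow_zero]
    exact diff_affine hf w
  | succ d ih =>
    intro f hf
    rw [pow_succ] at hf
    induction hf using Submodule.mul_induction_on' with
    | mem_mul_mem g hg h hh =>
      have e : (fun v => (g * h) (v + w) - (g * h) v)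
          = (fun v => g (v + w) - g v) * h + g * (fun v => h (v + w) - h v)
            + (fun v => g (v + w) - g v) * (fun v => h (v + w) - h v) := by
        funext v
        simp only [Pi.mul_apply, Pi.add_apply]
        ring
      have hd := diff_affine hh w
      rw [e]
      refine add_mem (add_mem ?_ ?_) ?_
      · rw [pow_succ]
        exact Submodule.mul_mem_mul (ih g hg) hh
      · rw [← mul_one (affineFunctions V ^ (d + 1))]
        exact Submodule.mul_mem_mul hg hd
      · rw [pow_succ]
        exact Submodule.mul_mem_mul (ih g hg) (hone hd)
    | add x _ y _ hx hy =>
      have e : (fun v => (x + y) (v + w) - (x + y) v)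
          = (fun v => x (v + w) - x v) + (fun v => y (v + w) - y v) := by
        funext v
        simp only [Pi.add_apply]
        ring
      rw [e]
      exact add_mem hx hy

theorem PolyaData.transition_mem (D : PolyaData V s) (d : ℕ) :
    ∀ f ∈ affineFunctions V ^ d, D.transition f ∈ affineFunctions V ^ d := by
  intro f hf
  cases d with
  | zero =>
    rw [pow_zero] at hf
    obtain ⟨c, rfl⟩ := Submodule.mem_one.1 hf
    have : D.transition (algebraMap ℂ (V → ℂ) c) = 0 := by
      funext v
      simp [PolyaData.transition]
    rw [this]
    exact zero_mem _
  | succ d =>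
    have e : D.transition f = ∑ k, (restrictForm V ((D.l k).baseChange ℂ))
        * (fun v => f (v + D.w k) - f v) := by
      funext v
      simp [PolyaData.transition, restrictForm]
    rw [e, pow_succ']
    refine sum_mem fun k _ => Submodule.mul_mem_mul ?_ (diff_mem _ d f hf)
    exact (le_sup_right : _ ≤ affineFunctions V) ⟨_, rfl⟩

theorem affineFunctions_fg [FiniteDimensional ℝ V] : (affineFunctions V).FG :=
  Submodule.FG.sup
    (by rw [Submodule.one_eq_span]; exact Submodule.fg_span_singleton _)
    (by rw [← Submodule.map_top]; exact Module.Finite.fg_top.map _)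

theorem PolyaData.existsUnique_charProjection [FiniteDimensional ℝ V] (D : PolyaData V s) (z : ℂ)
    {g : V → ℂ} (hg : g ∈ polyFunctions V) : ∃! f, D.IsCharProjection z g f := by
  refine existsUnique_of_exists_of_unique ?_ ?_
  · obtain ⟨d, hd⟩ := exists_mem_affineFunctions_pow hg
    set P := affineFunctions V ^ d
    have hP : ∀ x ∈ P, D.transition x ∈ P := D.transition_mem d
    have : Module.Finite ℂ P := Module.Finite.iff_fg.2 (affineFunctions_fg.pow d)
    have htop := Module.End.iSup_maxGenEigenspace_eq_top (D.transition.restrict hP)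
    have hle : P ≤ ⨆ z', D.charSpace z' := by
      have h1 := congrArg (Submodule.map P.subtype) htop
      rw [Submodule.map_iSup, Submodule.map_top, Submodule.range_subtype] at h1
      rw [← h1]
      refine iSup_mono fun z' => ?_
      have h2 := P.inf_genEigenspace D.transition (k := ⊤) (μ := z') hP
      change P ⊓ D.transition.maxGenEigenspace z'
        = (Module.End.maxGenEigenspace (D.transition.restrict hP) z').map P.subtype at h2
      rw [← h2]
      exact inf_le_inf_right _ (affineFunctions_pow_le d)
    have h3 : g ∈ D.charSpace z ⊔ ⨆ z' ≠ z, D.charSpace z' := by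
      refine (iSup_le fun z' => ?_ : ⨆ z', D.charSpace z' ≤ _) (hle hd)
      by_cases h : z' = z
      · subst h
        exact le_sup_left
      · exact le_trans (le_iSup₂ (f := fun z' (_ : z' ≠ z) => D.charSpace z') z' h) le_sup_right
    obtain ⟨a, ha, b, hb, hab⟩ := Submodule.mem_sup.1 h3
    refine ⟨a, ha, ?_⟩
    rw [← hab, add_sub_cancel_left]
    exact hb
  · rintro a b ⟨ha, ha'⟩ ⟨hb, hb'⟩
    have hind : iSupIndep D.charSpace :=
      (D.transition.independent_maxGenEigenspace).mono fun _ => inf_le_right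
    have hdis := hind z
    have h1 : a - b ∈ D.charSpace z := sub_mem ha hb
    have h2 : a - b ∈ ⨆ z' ≠ z, D.charSpace z' := by
      have := sub_mem hb' ha'
      rwa [sub_sub_sub_cancel_left] at this
    exact sub_eq_zero.1 (Submodule.disjoint_def.1 hdis _ h1 h2)

variable [NeZero s] {D : PolyaData V s}

/-- The monomial `u^α`, as a function on `V`. -/
noncomputable def JordanBasis.monomial (B : JordanBasis D) (α : Fin s → ℕ) : V → ℂ :=
  ∏ k, restrictForm V (B.u k) ^ α k

/-- `⟨α, λ⟩`. -/
def JordanBasis.pairing (B : JordanBasis D) (α : Fin s → ℕ) : ℂ := ∑ k, (α k : ℂ) * B.lam k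

theorem JordanBasis.monomial_mem (B : JordanBasis D) (α : Fin s → ℕ) :
    B.monomial α ∈ polyFunctions V :=
  Subalgebra.prod_mem _ fun k _ => Subalgebra.pow_mem _ (Algebra.subset_adjoin (Set.mem_range_self (B.u k))) _

/-- The reduced polynomial `Q_α`: the projection of `u^α` on `ker (Φ - ⟨α, λ⟩)^∞` parallel to the
sum of the other characteristic spaces of `Φ` on `S(V)`. -/
noncomputable def JordanBasis.reduced [FiniteDimensional ℝ V] (B : JordanBasis D)
    (α : Fin s → ℕ) : V → ℂ :=
  (D.existsUnique_charProjection (B.pairing α) (B.monomial_mem α)).choose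

theorem JordanBasis.reduced_spec [FiniteDimensional ℝ V] (B : JordanBasis D) (α : Fin s → ℕ) :
    D.IsCharProjection (B.pairing α) (B.monomial α) (B.reduced α) :=
  (D.existsUnique_charProjection (B.pairing α) (B.monomial_mem α)).choose_spec.1

end Operator

section Chain

variable {V : Type*} [AddCommGroup V] [Module ℝ V] {s : ℕ}

/-- The σ-field generated by `X₁, …, Xₙ`. -/
@[reducible]
def pastSigma {Ω : Type*} [MeasurableSpace V] (X : ℕ → Ω → V) (n : ℕ) : MeasurableSpace Ω :=
  ⨆ m ∈ Finset.Icc 1 n, MeasurableSpace.comap (X m) inferInstance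

/-- `(Xₙ)_{n ≥ 1}` is a Pólya process with data `D`: it starts at `x₁`, and conditionally on
`X₁, …, Xₙ` the variable `Xₙ₊₁` has the law `∑ₖ lₖ(Xₙ) / (n + τ₁ - 1) δ_{Xₙ + wₖ}`.
(The value `X 0` plays no role.) -/
structure IsPolyaProcess {Ω : Type*} [MeasurableSpace Ω] [MeasurableSpace V]
    (D : PolyaData V s) (μ : Measure Ω) (X : ℕ → Ω → V) : Prop where
  measurable : ∀ n, 1 ≤ n → Measurable (X n)
  init : ∀ᵐ ω ∂μ, X 1 ω = D.x₁
  step : ∀ n, 1 ≤ n → ∀ S : Set V, MeasurableSet S →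
    μ[(X (n + 1) ⁻¹' S).indicator (fun _ => (1 : ℝ)) | pastSigma X n] =ᵐ[μ]
      fun ω => ∑ k, D.l k (X n ω) / ((n : ℝ) + D.tau1 - 1) *
        S.indicator (fun _ => (1 : ℝ)) (X n ω + D.w k)

variable [NeZero s] {D : PolyaData V s}

/-- The indices `2, …, r` (which are `1, …, r - 1` in `Fin s`). -/
def secondIndices (s r : ℕ) : Finset (Fin s) :=
  Finset.univ.filter fun k => 1 ≤ (k : ℕ) ∧ (k : ℕ) < r

/-- `Xₙ - n v₁ - ∑_{2 ≤ k ≤ r} n^{λₖ} Wₖ vₖ`, a vector of the complexified space. -/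
noncomputable def JordanBasis.remainder [FiniteDimensional ℝ V] (B : JordanBasis D) (r : ℕ)
    {Ω : Type*} (X : ℕ → Ω → V) (W : Fin s → Ω → ℂ) (n : ℕ) (ω : Ω) : ℂ ⊗[ℝ] V :=
  (1 : ℂ) ⊗ₜ[ℝ] X n ω - (n : ℂ) • B.v 0
    - ∑ k ∈ secondIndices s r, ((n : ℂ) ^ B.lam k * W k ω) • B.v k

/-- `Xₙ = n v₁ + ∑_{2 ≤ k ≤ r} n^{λₖ} Wₖ vₖ + o(n^{σ₂})`, almost surely and in `L^p` for every
finite `p ≥ 1`. Smallness in the finite-dimensional complexified space is measured by all of its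
seminorms (which is the same as by one norm). -/
def JordanBasis.HasExpansion [FiniteDimensional ℝ V] (B : JordanBasis D) (r : ℕ)
    {Ω : Type*} [MeasurableSpace Ω] (μ : Measure Ω) (X : ℕ → Ω → V) (W : Fin s → Ω → ℂ) : Prop :=
  (∀ᵐ ω ∂μ, ∀ N : Seminorm ℂ (ℂ ⊗[ℝ] V),
    (fun n : ℕ => N (B.remainder r X W n ω)) =o[atTop] fun n : ℕ => (n : ℝ) ^ D.sigma2) ∧
  (∀ p : ℝ≥0∞, 1 ≤ p → p ≠ ∞ → ∀ N : Seminorm ℂ (ℂ ⊗[ℝ] V),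
    Tendsto (fun n : ℕ => eLpNorm (fun ω => N (B.remainder r X W n ω)) p μ
      / ENNReal.ofReal ((n : ℝ) ^ D.sigma2)) atTop (𝓝 0))

end Chain

end Polya

/-! By balance the coordinates of the state after `n` steps, which is `X (n + 1)`, add up to `n +
τ₁`. One step therefore acts in mean on functions as `1 + Φ / (n + τ₁)`, and on linear forms as `φ ↦
φ ∘ (1 + A / (n + τ₁))`.

Martingale part. For an eigenform `u k` with root `λ`, dividing `u k (X (n + 1))` by `growth τ₁ λ n
= ∏ (1 + λ / (j + τ₁))` gives a martingale whose increments are `O(n ^ (-Re λ))`. A Hoeffding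
estimate (`integral_exp_le`) bounds exponential moments, hence all `L^p` norms, by the root of the
sum of squared increments. When `Re λ > 1/2` this sum converges, so the martingale converges in
every `L^p` at a polynomial rate. Such a rate, used with `p` large, also gives almost sure
statements (`HasLpGrowth.ae_tendsto_zero`). Since `growth τ₁ λ n` is equivalent to `Γ(τ₁) / Γ(τ₁ +
λ) n ^ λ`, the variable `W k` is this Gamma quotient times the martingale limit.

Remaining coordinates. Principal semisimplicity forces every index beyond the first `r` to have a
root of real part `< σ₂`. Fix `ρ` in `(1/2, σ₂)` above all these real parts. The backward products
of `1 + A / (j + τ₁)` from `n` down to `j` are `O((n / j) ^ ρ)` on the corresponding forms, and the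
same Hoeffding estimate gives coordinates `O(n ^ ρ) = o(n ^ σ₂)`. The coordinate along `u₁` is
deterministic.

Moments. Give weight `1` to `u₁`, `σ₂` to `u₂, …, u_r` and `ρ` to the other forms; polynomials of
weight at most `τ` have mean `O(n ^ τ)` along the process. A difference lowers the weight by at
least `ρ` and a product with `l k` raises it by at most `1`, so `Φ u^α - ⟨α, λ⟩ u^α` has weight at
most that of `u^α` plus `1 - 2ρ`, strictly less than `Re ⟨α, λ⟩`. By linear algebra the same bound
holds for `u^α - Q_α` and for `Φ Q_α - ⟨α, λ⟩ Q_α`. The latter lies in the characteristic space of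
`⟨α, λ⟩` but grows too slowly for that root, so its mean vanishes (`integral_eq_zero_of_mem`). Hence
the mean of `Q_α` is exactly `growth τ₁ ⟨α, λ⟩ n * Q_α(X₁)`, even if `Q_α` is only a generalized
eigenfunction; the mean of `u^α` is equivalent up to lower order, and `L^p` convergence passes this
to the limit. -/

set_option linter.unusedSectionVars false

namespace Polya

/-! ### Reachable states, tenability and transition probabilities -/

section Reach

variable {V : Type*} [AddCommGroup V] [Module ℝ V] {s : ℕ} (D : PolyaData V s)

theorem PolyaData.eq_zero_of_forall_coord {v : V} (h : ∀ k, D.l k v = 0) : v = 0 := by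
  rw [← Module.forall_dual_apply_eq_zero_iff ℝ v]
  intro φ
  rw [← D.l.sum_repr φ, LinearMap.sum_apply]
  exact Finset.sum_eq_zero fun k _ => by rw [LinearMap.smul_apply, h k, smul_zero]

theorem PolyaData.tau1_pos : 0 < D.tau1 := by
  refine (Finset.sum_nonneg fun k _ => D.init_nonneg k).lt_of_ne fun h => D.init_ne_zero ?_
  refine D.eq_zero_of_forall_coord fun k => ?_
  exact (Finset.sum_eq_zero_iff_of_nonneg fun k _ => D.init_nonneg k).1 h.symm k (Finset.mem_univ k)

theorem PolyaData.add_tau1_pos (n : ℕ) : 0 < (n : ℝ) + D.tau1 :=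
  add_pos_of_nonneg_of_pos n.cast_nonneg D.tau1_pos

open Classical in
/-- The states that can be reached in `n` steps. -/
noncomputable def PolyaData.reach : ℕ → Finset V
  | 0 => {D.x₁}
  | n + 1 => (PolyaData.reach n).biUnion fun v =>
      (Finset.univ.filter fun k => D.l k v ≠ 0).image fun k => v + D.w k

theorem PolyaData.mem_reach_zero {v : V} : v ∈ D.reach 0 ↔ v = D.x₁ := by
  simp [PolyaData.reach]

theorem PolyaData.mem_reach_succ {n : ℕ} {v : V} :
    v ∈ D.reach (n + 1) ↔ ∃ u ∈ D.reach n, ∃ k, D.l k u ≠ 0 ∧ u + D.w k = v := by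
  simp [PolyaData.reach]

/-- A reachable coordinate is a sum of the initial coordinate and of increments, and the diagonal
tenability condition puts all of these in the group generated by the negative entry. -/
theorem PolyaData.coord_mem_zmultiples {n : ℕ} {v : V} (hv : v ∈ D.reach n) (k : Fin s)
    (hk : D.l k (D.w k) < 0) : D.l k v ∈ AddSubgroup.zmultiples (D.l k (D.w k)) := by
  have h := (D.tenable_diag k).resolve_left (not_le.2 hk)
  induction n generalizing v with
  | zero =>
    rw [D.mem_reach_zero.1 hv, ← h]
    exact AddSubgroup.mem_sup_left (AddSubgroup.mem_zmultiples _)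
  | succ n ih =>
    obtain ⟨u, hu, j, -, rfl⟩ := D.mem_reach_succ.1 hv
    rw [map_add]
    refine add_mem (ih hu) ?_
    exact h.le (AddSubgroup.mem_sup_right
      (AddSubgroup.mem_iSup_of_mem j (AddSubgroup.mem_zmultiples _)))

/-- Only a negative diagonal entry could break positivity. Its colour is drawn only when the
coordinate is nonzero, hence positive; being a multiple of the entry, the coordinate is then at
least its absolute value. -/
theorem PolyaData.coord_nonneg {n : ℕ} {v : V} (hv : v ∈ D.reach n) (k : Fin s) :
    0 ≤ D.l k v := by
  induction n generalizing v with
  | zero =>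
    rw [D.mem_reach_zero.1 hv]
    exact D.init_nonneg k
  | succ n ih =>
    obtain ⟨u, hu, j, hj, rfl⟩ := D.mem_reach_succ.1 hv
    rw [map_add]
    by_cases hkj : k = j
    · subst hkj
      rcases le_or_gt 0 (D.l k (D.w k)) with h0 | h0
      · exact add_nonneg (ih hu) h0
      · obtain ⟨m, hm⟩ := AddSubgroup.mem_zmultiples_iff.1 (D.coord_mem_zmultiples hu k h0)
        have hpos : 0 < D.l k u := (ih hu).lt_of_ne (Ne.symm hj)
        rw [← hm, zsmul_eq_mul] at hpos ⊢
        have hm0 : (m : ℝ) < 0 := by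
          by_contra hcon
          exact absurd hpos (not_lt.2 (mul_nonpos_of_nonneg_of_nonpos (not_lt.1 hcon) h0.le))
        have hm1 : (m : ℝ) ≤ -1 := by
          have : m ≤ -1 := by
            have : m < 0 := by exact_mod_cast hm0
            omega
          exact_mod_cast this
        nlinarith
    · exact add_nonneg (ih hu) (D.tenable_off_diag k j hkj)

theorem PolyaData.sum_coord {n : ℕ} {v : V} (hv : v ∈ D.reach n) :
    ∑ k, D.l k v = n + D.tau1 := by
  induction n generalizing v with
  | zero =>
    rw [D.mem_reach_zero.1 hv]
    simp [PolyaData.tau1]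
  | succ n ih =>
    obtain ⟨u, hu, j, hj, rfl⟩ := D.mem_reach_succ.1 hv
    simp only [map_add, Finset.sum_add_distrib, ih hu, D.balance j]
    push_cast
    ring

/-- The probability of the transition `v ↦ v + w k` after `n` steps. -/
noncomputable def PolyaData.prob (n : ℕ) (k : Fin s) (v : V) : ℝ := D.l k v / (n + D.tau1)

theorem PolyaData.prob_nonneg {n : ℕ} {v : V} (hv : v ∈ D.reach n) (k : Fin s) :
    0 ≤ D.prob n k v :=
  div_nonneg (D.coord_nonneg hv k) (D.add_tau1_pos n).le

theorem PolyaData.sum_prob {n : ℕ} {v : V} (hv : v ∈ D.reach n) : ∑ k, D.prob n k v = 1 := by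
  simp only [PolyaData.prob]
  rw [← Finset.sum_div, D.sum_coord hv, div_self (D.add_tau1_pos n).ne']

theorem PolyaData.add_mem_reach {n : ℕ} {v : V} (hv : v ∈ D.reach n) {k : Fin s}
    (hk : D.prob n k v ≠ 0) : v + D.w k ∈ D.reach (n + 1) :=
  D.mem_reach_succ.2 ⟨v, hv, k, fun h => hk (by simp [PolyaData.prob, h]), rfl⟩

end Reach

/-! ### The Markov property as identities between integrals -/

section Step

variable {V : Type*} [AddCommGroup V] [Module ℝ V] [MeasurableSpace V] [MeasurableSingletonClass V]
  {s : ℕ} {D : PolyaData V s} {Ω : Type*} {mΩ : MeasurableSpace Ω} {μ : Measure Ω}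
  [IsProbabilityMeasure μ] {X : ℕ → Ω → V}

theorem pastSigma_le (hX : IsPolyaProcess D μ X) (n : ℕ) : pastSigma X n ≤ mΩ :=
  iSup₂_le fun m hm => (hX.measurable m (Finset.mem_Icc.1 hm).1).comap_le

theorem measurableSet_pastSigma {m n : ℕ} (h1 : 1 ≤ m) (hmn : m ≤ n) {A : Set V}
    (hA : MeasurableSet A) : MeasurableSet[pastSigma X n] (X m ⁻¹' A) := by
  have h : MeasurableSpace.comap (X m) inferInstance ≤ pastSigma X n :=
    le_iSup₂ (f := fun m (_ : m ∈ Finset.Icc 1 n) => MeasurableSpace.comap (X m) inferInstance) m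
      (Finset.mem_Icc.2 ⟨h1, hmn⟩)
  exact h _ ⟨A, hA, rfl⟩

/-- The probability of entering `S` at time `n + 2`, jointly with an event `A` of the past. -/
theorem IsPolyaProcess.setIntegral_step (hX : IsPolyaProcess D μ X) (n : ℕ) {A : Set Ω}
    (hA : MeasurableSet[pastSigma X (n + 1)] A) {S : Set V} (hS : MeasurableSet S) :
    ∫ ω in A, ∑ k, D.prob n k (X (n + 1) ω) * S.indicator (fun _ => (1 : ℝ))
        (X (n + 1) ω + D.w k) ∂μ
      = μ.real (A ∩ X (n + 2) ⁻¹' S) := by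
  have hle := pastSigma_le hX (n + 1)
  have hmS : MeasurableSet (X (n + 2) ⁻¹' S) := hX.measurable (n + 2) (by omega) hS
  have h1 := hX.step (n + 1) (by omega) S hS
  have h2 : ∫ ω in A, (μ[(X (n + 1 + 1) ⁻¹' S).indicator (fun _ => (1 : ℝ))
      | pastSigma X (n + 1)]) ω ∂μ = ∫ ω in A, (X (n + 2) ⁻¹' S).indicator (fun _ => (1 : ℝ)) ω ∂μ :=
    setIntegral_condExp hle ((integrable_const _).indicator hmS) hA
  rw [setIntegral_indicator hmS, setIntegral_one_eq_measureReal] at h2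
  rw [← h2]
  refine setIntegral_congr_ae (hle _ hA) ?_
  filter_upwards [h1] with ω h1 _
  rw [h1]
  refine Finset.sum_congr rfl fun k _ => ?_
  -- At time `n + 1` the denominator of `step` is `(n + 1) + τ₁ - 1 = n + τ₁`, the one used in
  -- `prob`.
  rw [PolyaData.prob]
  congr 2
  push_cast
  ring

/-- Colours of nonzero probability lead from `reach n` into `reach (n + 1)`, so the complement is
entered with probability zero. As these sets are finite, any function of finitely many of the `X n`
is almost surely a simple function. -/
theorem IsPolyaProcess.mem_reach (hX : IsPolyaProcess D μ X) (n : ℕ) :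
    ∀ᵐ ω ∂μ, X (n + 1) ω ∈ D.reach n := by
  induction n with
  | zero =>
    filter_upwards [hX.init] with ω h
    exact D.mem_reach_zero.2 h
  | succ n ih =>
    have hS : MeasurableSet ((D.reach (n + 1) : Set V)ᶜ) := (Finset.measurableSet _).compl
    have h := hX.setIntegral_step n (A := Set.univ) MeasurableSet.univ hS
    rw [setIntegral_univ, Set.univ_inter] at h
    rw [integral_eq_zero_of_ae, eq_comm, measureReal_eq_zero_iff] at h
    · rw [ae_iff]
      exact h
    · filter_upwards [ih] with ω hω
      refine Finset.sum_eq_zero fun k _ => ?_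
      by_cases hk : D.prob n k (X (n + 1) ω) = 0
      · simp [hk]
      · have := D.add_mem_reach hω hk
        simp [this]

theorem IsPolyaProcess.ae_eq_finset_sum (hX : IsPolyaProcess D μ X) {E : Type*}
    [AddCommMonoid E] (n : ℕ) (g : V → Ω → E) :
    (fun ω => g (X (n + 1) ω) ω) =ᵐ[μ]
      fun ω => ∑ b ∈ D.reach n, (X (n + 1) ⁻¹' {b}).indicator (g b) ω := by
  classical
  filter_upwards [hX.mem_reach n] with ω hω
  rw [Finset.sum_eq_single_of_mem _ hω]
  · simp
  · intro b _ hb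
    rw [Set.indicator_of_notMem]
    simpa using hb.symm

variable {E : Type*} [NormedAddCommGroup E] [NormedSpace ℝ E]

theorem IsPolyaProcess.aestronglyMeasurable (hX : IsPolyaProcess D μ X) (n : ℕ) (g : V → E) :
    AEStronglyMeasurable (fun ω => g (X (n + 1) ω)) μ := by
  refine AEStronglyMeasurable.congr ?_ (hX.ae_eq_finset_sum n fun b _ => g b).symm
  refine Finset.aestronglyMeasurable_fun_sum _ fun b _ => ?_
  exact aestronglyMeasurable_const.indicator (hX.measurable _ (by omega) (measurableSet_singleton b))

theorem IsPolyaProcess.aestronglyMeasurable₂ (hX : IsPolyaProcess D μ X) (m n : ℕ)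
    (g : V → V → E) : AEStronglyMeasurable (fun ω => g (X (m + 1) ω) (X (n + 1) ω)) μ := by
  refine AEStronglyMeasurable.congr ?_
    (hX.ae_eq_finset_sum m fun b ω => g b (X (n + 1) ω)).symm
  refine Finset.aestronglyMeasurable_fun_sum _ fun b _ => ?_
  exact (hX.aestronglyMeasurable n (g b)).indicator
    (hX.measurable _ (by omega) (measurableSet_singleton b))

theorem IsPolyaProcess.exists_bound₂ (hX : IsPolyaProcess D μ X) (m n : ℕ) (g : V → V → E) :
    ∃ C, ∀ᵐ ω ∂μ, ‖g (X (m + 1) ω) (X (n + 1) ω)‖ ≤ C := by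
  refine ⟨∑ a ∈ D.reach m, ∑ b ∈ D.reach n, ‖g a b‖, ?_⟩
  filter_upwards [hX.mem_reach m, hX.mem_reach n] with ω h1 h2
  refine le_trans ?_ (Finset.single_le_sum (f := fun a => ∑ b ∈ D.reach n, ‖g a b‖)
    (fun a _ => Finset.sum_nonneg fun b _ => norm_nonneg _) h1)
  exact Finset.single_le_sum (f := fun b => ‖g (X (m + 1) ω) b‖) (fun b _ => norm_nonneg _) h2

theorem IsPolyaProcess.memLp₂ (hX : IsPolyaProcess D μ X) (m n : ℕ) (g : V → V → E) (p : ℝ≥0∞) :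
    MemLp (fun ω => g (X (m + 1) ω) (X (n + 1) ω)) p μ := by
  obtain ⟨C, hC⟩ := hX.exists_bound₂ m n g
  exact MemLp.of_bound (hX.aestronglyMeasurable₂ m n g) C hC

theorem IsPolyaProcess.integrable₂ (hX : IsPolyaProcess D μ X) (m n : ℕ) (g : V → V → E) :
    Integrable (fun ω => g (X (m + 1) ω) (X (n + 1) ω)) μ :=
  memLp_one_iff_integrable.1 (hX.memLp₂ m n g 1)

/-- The Markov property, for a function of the present state and of one past state. -/
theorem IsPolyaProcess.integral_step [CompleteSpace E] (hX : IsPolyaProcess D μ X) {m n : ℕ} (hmn : m ≤ n)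
    (g : V → V → E) :
    ∫ ω, g (X (m + 1) ω) (X (n + 2) ω) ∂μ
      = ∫ ω, ∑ k, D.prob n k (X (n + 1) ω) • g (X (m + 1) ω) (X (n + 1) ω + D.w k) ∂μ := by
  classical
  have hms : ∀ (i : ℕ) (a : V), MeasurableSet (X (i + 1) ⁻¹' {a}) := fun i a =>
    hX.measurable _ (by omega) (measurableSet_singleton a)
  set q : V → Ω → ℝ := fun b ω => ∑ k, D.prob n k (X (n + 1) ω) *
    ({b} : Set V).indicator (fun _ => (1 : ℝ)) (X (n + 1) ω + D.w k) with hq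
  have hqi : ∀ b, Integrable (q b) μ := fun b =>
    hX.integrable₂ m n fun _ y => ∑ k, D.prob n k y *
      ({b} : Set V).indicator (fun _ => (1 : ℝ)) (y + D.w k)
  -- Both integrals are expanded over the finitely many pairs of values `(a, b)`; the coefficients
  -- agree by `setIntegral_step` applied to the past event `X (m + 1) = a`.
  have e1 : ∫ ω, g (X (m + 1) ω) (X (n + 2) ω) ∂μ = ∑ a ∈ D.reach m, ∑ b ∈ D.reach (n + 1),
      μ.real (X (m + 1) ⁻¹' {a} ∩ X (n + 2) ⁻¹' {b}) • g a b := by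
    rw [integral_congr_ae (hX.ae_eq_finset_sum m fun a ω => g a (X (n + 2) ω)), integral_finsetSum]
    · refine Finset.sum_congr rfl fun a _ => ?_
      rw [integral_indicator (hms m a), setIntegral_congr_ae (hms m a)
        ((hX.ae_eq_finset_sum (n + 1) fun b _ => g a b).mono fun ω h _ => h), integral_finsetSum]
      · refine Finset.sum_congr rfl fun b _ => ?_
        rw [setIntegral_indicator (hms (n + 1) b), setIntegral_const]
      · exact fun b _ => ((integrable_const _).indicator (hms (n + 1) b)).integrableOn
    · exact fun a _ => (hX.integrable₂ m (n + 1) fun _ y => g a y).indicator (hms m a)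
  rw [e1]
  have e2 : (fun ω => ∑ k, D.prob n k (X (n + 1) ω) • g (X (m + 1) ω) (X (n + 1) ω + D.w k)) =ᵐ[μ]
      fun ω => ∑ a ∈ D.reach m, ∑ b ∈ D.reach (n + 1),
        (X (m + 1) ⁻¹' {a}).indicator (fun ω => q b ω • g a b) ω := by
    refine EventuallyEq.trans ?_ (EventuallyEq.trans (hX.ae_eq_finset_sum m fun a ω =>
      ∑ b ∈ D.reach (n + 1), q b ω • g a b) (Eventually.of_forall fun ω => ?_))
    · filter_upwards [hX.mem_reach n] with ω hω
      simp only [hq, Finset.sum_smul]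
      rw [Finset.sum_comm]
      refine Finset.sum_congr rfl fun k _ => ?_
      by_cases hk : D.prob n k (X (n + 1) ω) = 0
      · simp [hk]
      · rw [Finset.sum_eq_single_of_mem _ (D.add_mem_reach hω hk)]
        · simp
        · intro b _ hb
          rw [Set.indicator_of_notMem (by simpa using hb.symm)]
          simp
    · refine Finset.sum_congr rfl fun a _ => ?_
      by_cases h : ω ∈ X (m + 1) ⁻¹' {a}
      · simp only [Set.indicator_of_mem h]
      · simp only [Set.indicator_of_notMem h, Finset.sum_const_zero]
  have hi : ∀ a b, Integrable ((X (m + 1) ⁻¹' {a}).indicator fun ω => q b ω • g a b) μ :=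
    fun a b => ((hqi b).smul_const _).indicator (hms m a)
  rw [integral_congr_ae e2, integral_finsetSum _ fun a _ => integrable_finsetSum _ fun b _ => hi a b]
  refine Finset.sum_congr rfl fun a _ => ?_
  rw [integral_finsetSum _ fun b _ => hi a b]
  refine Finset.sum_congr rfl fun b _ => ?_
  rw [integral_indicator (hms m a), integral_smul_const, ← hX.setIntegral_step n
    (measurableSet_pastSigma (by omega) (by omega) (measurableSet_singleton a))
    (measurableSet_singleton b)]

end Step

/-! ### Asymptotics of the growth products, and elementary sums -/

section Growth

/-- The product `∏_{j < n} (1 + z / (j + τ))`. -/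
noncomputable def growth (τ : ℝ) (z : ℂ) (n : ℕ) : ℂ :=
  ∏ j ∈ Finset.range n, (1 + z / ((j + τ : ℝ) : ℂ))

theorem growth_zero (τ : ℝ) (z : ℂ) : growth τ z 0 = 1 := by simp [growth]

theorem growth_succ (τ : ℝ) (z : ℂ) (n : ℕ) :
    growth τ z (n + 1) = growth τ z n * (1 + z / ((n + τ : ℝ) : ℂ)) := by
  simp [growth, Finset.prod_range_succ]

theorem growth_ne_zero {τ : ℝ} (hτ : 0 < τ) {z : ℂ} (hz : 0 ≤ z.re) (n : ℕ) :
    growth τ z n ≠ 0 := by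
  refine Finset.prod_ne_zero_iff.2 fun j _ h => ?_
  have h1 := congrArg Complex.re h
  rw [Complex.add_re, Complex.div_ofReal_re] at h1
  have : 0 ≤ z.re / (j + τ) := by positivity
  simp at h1
  linarith

/-- The product is a quotient of two rising factorials, which are the denominators of Euler's
sequences for Gamma; the factorials cancel and the powers of `n` leave `n ^ z`. -/
theorem growth_succ_eq {τ : ℝ} (hτ : 0 < τ) {z : ℂ} (hz : 0 ≤ z.re) {n : ℕ} (hn : n ≠ 0) :
    growth τ z (n + 1)
      = (n : ℂ) ^ z * (Complex.GammaSeq τ n / Complex.GammaSeq (τ + z) n) := by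
  have hn' : (n : ℂ) ≠ 0 := Nat.cast_ne_zero.2 hn
  have h1 : ∀ j : ℕ, (τ : ℂ) + j ≠ 0 := fun j h => by
    have h1 := congrArg Complex.re h
    simp at h1
    have : (0 : ℝ) ≤ j := j.cast_nonneg
    linarith
  have h2 : ∀ j : ℕ, (τ : ℂ) + z + j ≠ 0 := fun j h => by
    have h1 := congrArg Complex.re h
    simp at h1
    have : (0 : ℝ) ≤ j := j.cast_nonneg
    linarith
  have h3 : growth τ z (n + 1) = (∏ j ∈ Finset.range (n + 1), ((τ : ℂ) + z + j))
      / ∏ j ∈ Finset.range (n + 1), ((τ : ℂ) + j) := by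
    rw [growth, ← Finset.prod_div_distrib]
    refine Finset.prod_congr rfl fun j _ => ?_
    have := h1 j
    push_cast
    rw [add_comm (j : ℂ)]
    field_simp
    ring
  have h4 := Finset.prod_ne_zero_iff.2 fun j (_ : j ∈ Finset.range (n + 1)) => h1 j
  have h5 := Finset.prod_ne_zero_iff.2 fun j (_ : j ∈ Finset.range (n + 1)) => h2 j
  have h6 : (n : ℂ) ^ (τ : ℂ) ≠ 0 := by simp [Complex.cpow_eq_zero_iff, hn']
  have h7 : (n : ℂ) ^ z ≠ 0 := by simp [Complex.cpow_eq_zero_iff, hn']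
  have h8 : ((n.factorial : ℕ) : ℂ) ≠ 0 := Nat.cast_ne_zero.2 n.factorial_ne_zero
  rw [h3, Complex.GammaSeq, Complex.GammaSeq, Complex.cpow_add _ _ hn']
  field_simp

theorem tendsto_growth {τ : ℝ} (hτ : 0 < τ) {z : ℂ} (hz : 0 ≤ z.re) :
    Tendsto (fun n : ℕ => growth τ z n / ((n + 1 : ℕ) : ℂ) ^ z) atTop
      (𝓝 (Complex.Gamma τ / Complex.Gamma (τ + z))) := by
  have hG : Complex.Gamma (τ + z) ≠ 0 := Complex.Gamma_ne_zero_of_re_pos (by simp; linarith)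
  rw [← tendsto_add_atTop_iff_nat 1]
  have h1 := (Complex.GammaSeq_tendsto_Gamma (τ : ℂ)).div
    (Complex.GammaSeq_tendsto_Gamma (τ + z)) hG
  -- After the shift the normalisation is `(n + 2) ^ z`, while `growth_succ_eq` produces `n ^ z`.
  have h2 : Tendsto (fun n : ℕ => (((n : ℝ) / (n + 2) : ℝ) : ℂ) ^ z) atTop (𝓝 1) := by
    have h3 : Tendsto (fun n : ℕ => (n : ℝ) / (n + 2)) atTop (𝓝 1) :=
      tendsto_natCast_div_add_atTop 2
    have h4 : Tendsto (fun n : ℕ => (((n : ℝ) / (n + 2) : ℝ) : ℂ)) atTop (𝓝 1) := by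
      exact_mod_cast (Complex.continuous_ofReal.tendsto 1).comp h3
    have h5 := h4.cpow (tendsto_const_nhds (x := z)) (by simp)
    simpa using h5
  have h6 := h1.mul h2
  rw [mul_one] at h6
  refine h6.congr' ?_
  filter_upwards [eventually_ne_atTop 0] with n hn
  rw [growth_succ_eq hτ hz hn]
  have h7 : (((n + 1 + 1 : ℕ) : ℝ) : ℂ) ^ z * (((n : ℝ) / (n + 2) : ℝ) : ℂ) ^ z
      = ((n : ℝ) : ℂ) ^ z := by
    rw [← Complex.mul_cpow_ofReal_nonneg (by positivity) (by positivity), ← Complex.ofReal_mul]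
    congr 2
    push_cast
    field_simp
    ring
  have h8 : ((n + 1 + 1 : ℕ) : ℂ) ^ z ≠ 0 := by
    simp only [ne_eq, Complex.cpow_eq_zero_iff]
    exact fun h => absurd h.1 (Nat.cast_ne_zero.2 (by omega))
  simp only [Complex.ofReal_natCast] at h7
  rw [Pi.div_apply]
  rw [eq_div_iff h8, ← h7]
  ring

theorem norm_natCast_succ_cpow (z : ℂ) (n : ℕ) :
    ‖((n + 1 : ℕ) : ℂ) ^ z‖ = ((n : ℝ) + 1) ^ z.re := by
  rw [Complex.norm_natCast_cpow_of_pos n.succ_pos]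
  push_cast
  rfl

/-- The normalised product never vanishes and has a nonzero limit, so both it and its inverse are
bounded. -/
theorem exists_bounds_growth {τ : ℝ} (hτ : 0 < τ) {z : ℂ} (hz : 0 ≤ z.re) :
    ∃ c C : ℝ, 0 < c ∧ 0 < C ∧ ∀ n : ℕ, c * ((n : ℝ) + 1) ^ z.re ≤ ‖growth τ z n‖ ∧
      ‖growth τ z n‖ ≤ C * ((n : ℝ) + 1) ^ z.re := by
  have hG : Complex.Gamma (τ + z) ≠ 0 := Complex.Gamma_ne_zero_of_re_pos (by simp; linarith)
  have hG' : Complex.Gamma τ ≠ 0 := Complex.Gamma_ne_zero_of_re_pos (by simpa)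
  have h := (tendsto_growth hτ hz).norm
  obtain ⟨C, hC⟩ := h.bddAbove_range
  obtain ⟨C', hC'⟩ := (h.inv₀ (norm_ne_zero_iff.2 (div_ne_zero hG' hG))).bddAbove_range
  have key : ∀ n : ℕ, ‖growth τ z n / ((n + 1 : ℕ) : ℂ) ^ z‖
      = ‖growth τ z n‖ / ((n : ℝ) + 1) ^ z.re := fun n => by
    rw [norm_div, norm_natCast_succ_cpow]
  have hpos : ∀ n : ℕ, 0 < ((n : ℝ) + 1) ^ z.re := fun n => by positivity
  have hgp : ∀ n : ℕ, 0 < ‖growth τ z n‖ := fun n => norm_pos_iff.2 (growth_ne_zero hτ hz n)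
  have h1 : ∀ n : ℕ, ‖growth τ z n‖ / ((n : ℝ) + 1) ^ z.re ≤ C := fun n => by
    rw [← key]; exact hC ⟨n, rfl⟩
  have h2 : ∀ n : ℕ, (‖growth τ z n‖ / ((n : ℝ) + 1) ^ z.re)⁻¹ ≤ C' := fun n => by
    rw [← key]; exact hC' ⟨n, rfl⟩
  have hCp : 0 < C := (div_pos (hgp 0) (hpos 0)).trans_le (h1 0)
  have hCp' : 0 < C' := (inv_pos.2 (div_pos (hgp 0) (hpos 0))).trans_le (h2 0)
  refine ⟨C'⁻¹, C, inv_pos.2 hCp', hCp, fun n => ⟨?_, (div_le_iff₀ (hpos n)).1 (h1 n)⟩⟩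
  rw [← le_div_iff₀ (hpos n)]
  exact inv_le_of_inv_le₀ (div_pos (hgp n) (hpos n)) (h2 n)

theorem norm_growth_succ_ofReal {τ : ℝ} (hτ : 0 < τ) {ρ : ℝ} (hρ : 0 ≤ ρ) (n : ℕ) :
    ‖growth τ ρ (n + 1)‖ = ‖growth τ ρ n‖ * (1 + ρ / (n + τ)) := by
  rw [growth_succ, norm_mul, ← Complex.ofReal_div, ← Complex.ofReal_one, ← Complex.ofReal_add,
    Complex.norm_of_nonneg (by positivity)]

/-- A backward recursive inequality, with ratio at most `1 + ρ / (j + τ)` from the rank `i₀` on. -/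
theorem mul_growth_le {τ : ℝ} (hτ : 0 < τ) {ρ : ℝ} (hρ : 0 ≤ ρ) {K : ℝ} (hK : 1 ≤ K) (i₀ : ℕ)
    {n : ℕ} {a : ℕ → ℝ} (ha : ∀ j, 0 ≤ a j) (h1 : ∀ j < n, a j ≤ K * a (j + 1))
    (h2 : ∀ j < n, i₀ ≤ j → a j ≤ (1 + ρ / (j + τ)) * a (j + 1)) (j : ℕ) (hj : j ≤ n) :
    a j * ‖growth τ ρ j‖ ≤ K ^ (i₀ - j) * (a n * ‖growth τ ρ n‖) := by
  induction hj using Nat.decreasingInduction with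
  | self => exact le_mul_of_one_le_left (by have := ha n; positivity) (one_le_pow₀ hK)
  | of_succ j hj ih =>
    have hg := norm_growth_succ_ofReal hτ hρ j
    have hq : 0 ≤ ρ / (j + τ) := by positivity
    rcases le_or_gt i₀ j with h | h
    · rw [Nat.sub_eq_zero_of_le h, Nat.sub_eq_zero_of_le (by omega)] at *
      refine le_trans ?_ ih
      rw [hg]
      calc a j * ‖growth τ ρ j‖ ≤ ((1 + ρ / (j + τ)) * a (j + 1)) * ‖growth τ ρ j‖ := by
            gcongr
            exact h2 j hj h
        _ = _ := by ring
    -- Below `i₀` only the crude ratio `K` is available; each such step costs one factor `K`.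
    · obtain ⟨d, hd⟩ : ∃ d, i₀ - j = d + 1 := ⟨i₀ - j - 1, by omega⟩
      rw [hd, pow_succ', mul_assoc]
      rw [show i₀ - (j + 1) = d by omega] at ih
      calc a j * ‖growth τ ρ j‖ ≤ (K * a (j + 1)) * ‖growth τ ρ j‖ := by
            gcongr
            exact h1 j hj
        _ ≤ (K * a (j + 1)) * ‖growth τ ρ (j + 1)‖ := by
            have := ha (j + 1)
            rw [hg]
            gcongr
            exact le_mul_of_one_le_right (norm_nonneg _) (by linarith)
        _ = K * (a (j + 1) * ‖growth τ ρ (j + 1)‖) := by ring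
        _ ≤ _ := by gcongr

theorem exists_sum_rpow_le {a : ℝ} (ha : 1 < a) :
    ∃ C : ℝ, 0 < C ∧ ∀ S : Finset ℕ, ∑ j ∈ S, ((j : ℝ) + 1) ^ (-a) ≤ C := by
  have h := (summable_nat_add_iff 1).2 (Real.summable_nat_rpow.2 (neg_lt_neg ha))
  have h' : Summable fun j : ℕ => ((j : ℝ) + 1) ^ (-a) := by simpa using h
  refine ⟨∑' j : ℕ, ((j : ℝ) + 1) ^ (-a), ?_, fun S => h'.sum_le_tsum S fun j _ => by positivity⟩
  exact h'.tsum_pos (fun j => by positivity) 0 (by positivity)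

/-- Split off the decreasing factor `(j + 1) ^ (-δ)`, at most its value at `m`; the remaining
exponent still exceeds `1`. -/
theorem exists_sum_Ico_rpow_le {a δ : ℝ} (hδ : 0 ≤ δ) (ha : 1 + δ < a) :
    ∃ C : ℝ, 0 < C ∧ ∀ m n : ℕ, ∑ j ∈ Finset.Ico m n, ((j : ℝ) + 1) ^ (-a)
      ≤ C * ((m : ℝ) + 1) ^ (-δ) := by
  obtain ⟨C, hC, h⟩ := exists_sum_rpow_le (a := a - δ) (by linarith)
  refine ⟨C, hC, fun m n => ?_⟩
  rw [mul_comm]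
  refine le_trans ?_ (mul_le_mul_of_nonneg_left (h (Finset.Ico m n)) (by positivity))
  rw [Finset.mul_sum]
  refine Finset.sum_le_sum fun j hj => ?_
  have hj1 : (m : ℝ) ≤ j := by exact_mod_cast (Finset.mem_Ico.1 hj).1
  have e : ((j : ℝ) + 1) ^ (-a) = ((j : ℝ) + 1) ^ (-δ) * ((j : ℝ) + 1) ^ (-(a - δ)) := by
    rw [← Real.rpow_add (by positivity)]
    congr 1
    ring
  rw [e]
  gcongr ?_ * _
  exact Real.rpow_le_rpow_of_nonpos (by positivity) (by linarith) (by linarith)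

end Growth

/-! ### Exponential inequalities -/

section Exponential

/-- Averaged over a centred variable, the linear term disappears and a Gaussian bound is left. -/
theorem exp_le_add_exp_sq (x : ℝ) : Real.exp x ≤ x + Real.exp (x ^ 2) := by
  have h1 := Real.add_one_le_exp (x ^ 2)
  rcases le_or_gt |x| 1 with h | h
  · have := (abs_le.1 (Real.abs_exp_sub_one_sub_id_le h)).2
    linarith
  · rcases lt_abs.1 h with h | h
    · have : Real.exp x ≤ Real.exp (x ^ 2) := Real.exp_le_exp.2 (by nlinarith)
      linarith
    · have : Real.exp x ≤ 1 := Real.exp_le_one_iff.2 (by linarith)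
      nlinarith

/-- A form of Hoeffding's lemma, for finite probability vectors. -/
theorem sum_mul_exp_sub_le {ι : Type*} [Fintype ι] {p x : ι → ℝ} (hp : ∀ i, 0 ≤ p i)
    (hp1 : ∑ i, p i = 1) {c : ℝ} (hx : ∀ i, |x i| ≤ c) :
    ∑ i, p i * Real.exp (x i - ∑ j, p j * x j) ≤ Real.exp (4 * c ^ 2) := by
  set y := ∑ j, p j * x j with hy
  have hyc : |y| ≤ c := by
    refine (Finset.abs_sum_le_sum_abs _ _).trans ?_
    calc ∑ i, |p i * x i| ≤ ∑ i, p i * c := by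
          refine Finset.sum_le_sum fun i _ => ?_
          rw [abs_mul, abs_of_nonneg (hp i)]
          exact mul_le_mul_of_nonneg_left (hx i) (hp i)
      _ = c := by rw [← Finset.sum_mul, hp1, one_mul]
  calc ∑ i, p i * Real.exp (x i - y)
      ≤ ∑ i, p i * ((x i - y) + Real.exp (4 * c ^ 2)) := by
        refine Finset.sum_le_sum fun i _ => mul_le_mul_of_nonneg_left ?_ (hp i)
        -- The value `x i` and the mean `y` are both bounded by `c`, so the deviation is at most `2
        -- * c`; hence `4 * c ^ 2`.
        refine (exp_le_add_exp_sq _).trans (add_le_add_right (Real.exp_le_exp.2 ?_) _)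
        have h1 := abs_le.1 (hx i)
        have h2 := abs_le.1 hyc
        nlinarith
    _ = Real.exp (4 * c ^ 2) := by
        simp only [mul_add, mul_sub, Finset.sum_add_distrib, Finset.sum_sub_distrib,
          ← Finset.sum_mul, hp1]
        linarith

theorem pow_le_factorial_mul_exp_add_exp (x : ℝ) (p : ℕ) :
    |x| ^ p ≤ p.factorial * (Real.exp x + Real.exp (-x)) := by
  have h1 := Real.pow_div_factorial_le_exp |x| (abs_nonneg x) p
  rw [div_le_iff₀' (by positivity)] at h1
  refine h1.trans (mul_le_mul_of_nonneg_left ?_ (by positivity))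
  rcases abs_choice x with h | h <;> rw [h]
  · linarith [Real.exp_pos (-x)]
  · linarith [Real.exp_pos x]

end Exponential

/-! ### Azuma–Hoeffding bounds for martingales of linear forms -/

section Azuma

variable {V : Type*} [AddCommGroup V] [Module ℝ V] {s : ℕ} {D : PolyaData V s}

theorem PolyaData.replacement_apply (v : V) : D.replacement v = ∑ k, D.l k v • D.w k := by
  simp [PolyaData.replacement]

variable [MeasurableSpace V] [MeasurableSingletonClass V]
  {Ω : Type*} {mΩ : MeasurableSpace Ω} {μ : Measure Ω}
  [IsProbabilityMeasure μ] {X : ℕ → Ω → V}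

/-- An exponential moment bound for the martingales `ψₙ(Xₙ₊₁)` attached to sequences of linear
forms with `ψₙ = ψₙ₊₁ ∘ (1 + A / (n + τ₁))`. -/
theorem IsPolyaProcess.integral_exp_le (hX : IsPolyaProcess D μ X) {m n : ℕ} (hmn : m ≤ n)
    (ψ : ℕ → V →ₗ[ℝ] ℝ) (c : ℕ → ℝ)
    (hψ : ∀ j, m ≤ j → j < n → ∀ v,
      ψ j v = ψ (j + 1) v + ψ (j + 1) (D.replacement v) / (j + D.tau1))
    (hc : ∀ j, m ≤ j → j < n → ∀ k, |ψ (j + 1) (D.w k)| ≤ c j) :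
    ∫ ω, Real.exp (ψ n (X (n + 1) ω) - ψ m (X (m + 1) ω)) ∂μ
      ≤ Real.exp (4 * ∑ j ∈ Finset.Ico m n, c j ^ 2) := by
  induction n, hmn using Nat.le_induction with
  | base => simp
  | succ n hmn ih =>
    have ih' := ih (fun j h1 h2 => hψ j h1 (by omega)) (fun j h1 h2 => hc j h1 (by omega))
    rw [hX.integral_step hmn fun x y => Real.exp (ψ (n + 1) y - ψ m x)]
    rw [Finset.sum_Ico_succ_top hmn, mul_add, Real.exp_add]
    refine le_trans ?_ (mul_le_mul_of_nonneg_right ih' (Real.exp_pos _).le)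
    rw [← integral_mul_const]
    refine integral_mono_ae (hX.integrable₂ m n fun x y => ∑ k, D.prob n k y •
      Real.exp (ψ (n + 1) (y + D.w k) - ψ m x))
      ((hX.integrable₂ m n fun x y => Real.exp (ψ n y - ψ m x)).mul_const _) ?_
    filter_upwards [hX.mem_reach n] with ω hω
    set x := X (m + 1) ω
    set y := X (n + 1) ω
    -- This is the conditional mean of the increment of `ψ (n + 1)`. With `hψ` it shows that the
    -- exponent is the past difference plus a centred increment, to which Hoeffding's lemma applies.
    have h1 : ψ (n + 1) (D.replacement y) / (n + D.tau1)
        = ∑ k, D.prob n k y * ψ (n + 1) (D.w k) := by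
      rw [D.replacement_apply, map_sum, Finset.sum_div]
      refine Finset.sum_congr rfl fun k _ => ?_
      rw [map_smul, smul_eq_mul, PolyaData.prob]
      ring
    have h2 := sum_mul_exp_sub_le (fun k => D.prob_nonneg hω k) (D.sum_prob hω)
      (hc n hmn n.lt_succ_self)
    refine le_trans (le_of_eq ?_) (mul_le_mul_of_nonneg_left h2 (Real.exp_pos (ψ n y - ψ m x)).le)
    rw [Finset.mul_sum]
    refine Finset.sum_congr rfl fun k _ => ?_
    rw [smul_eq_mul, mul_left_comm, ← Real.exp_add, hψ n hmn n.lt_succ_self y, h1, map_add]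
    congr 2
    ring

/-- Rescaling the forms by `± 1 / L` makes the sum of squares at most `1`, so both exponential
moments are at most `exp 4`, and these dominate every power. -/
theorem IsPolyaProcess.integral_abs_pow_le (hX : IsPolyaProcess D μ X) {m n : ℕ} (hmn : m ≤ n)
    (ψ : ℕ → V →ₗ[ℝ] ℝ) (c : ℕ → ℝ)
    (hψ : ∀ j, m ≤ j → j < n → ∀ v,
      ψ j v = ψ (j + 1) v + ψ (j + 1) (D.replacement v) / (j + D.tau1))
    (hc : ∀ j, m ≤ j → j < n → ∀ k, |ψ (j + 1) (D.w k)| ≤ c j)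
    {L : ℝ} (hL : 0 < L) (hcL : ∑ j ∈ Finset.Ico m n, c j ^ 2 ≤ L ^ 2) (p : ℕ) :
    ∫ ω, |ψ n (X (n + 1) ω) - ψ m (X (m + 1) ω)| ^ p ∂μ
      ≤ 2 * p.factorial * Real.exp 4 * L ^ p := by
  have hexp : ∀ t : ℝ, |t| = L⁻¹ →
      ∫ ω, Real.exp (t * (ψ n (X (n + 1) ω) - ψ m (X (m + 1) ω))) ∂μ ≤ Real.exp 4 := by
    intro t ht
    have h := hX.integral_exp_le hmn (fun j => t • ψ j) (fun j => |t| * c j)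
      (fun j h1 h2 v => by
        simp only [LinearMap.smul_apply, smul_eq_mul, hψ j h1 h2 v]
        ring)
      (fun j h1 h2 k => by
        simp only [LinearMap.smul_apply, smul_eq_mul, abs_mul]
        exact mul_le_mul_of_nonneg_left (hc j h1 h2 k) (abs_nonneg t))
    simp only [LinearMap.smul_apply, smul_eq_mul, ← mul_sub] at h
    refine h.trans (Real.exp_le_exp.2 ?_)
    simp only [mul_pow, ← Finset.mul_sum]
    rw [ht]
    have : (L⁻¹) ^ 2 * ∑ j ∈ Finset.Ico m n, c j ^ 2 ≤ (L⁻¹) ^ 2 * L ^ 2 := by gcongr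
    have h3 : (L⁻¹) ^ 2 * L ^ 2 = 1 := by field_simp
    linarith
  have hint : ∀ t : ℝ, Integrable (fun ω =>
      Real.exp (t * (ψ n (X (n + 1) ω) - ψ m (X (m + 1) ω)))) μ := fun t =>
    hX.integrable₂ m n fun x y => Real.exp (t * (ψ n y - ψ m x))
  have h1 := hexp L⁻¹ (abs_of_pos (inv_pos.2 hL))
  have h2 := hexp (-L⁻¹) (by rw [abs_neg, abs_of_pos (inv_pos.2 hL)])
  calc ∫ ω, |ψ n (X (n + 1) ω) - ψ m (X (m + 1) ω)| ^ p ∂μ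
      ≤ ∫ ω, L ^ p * (p.factorial *
        (Real.exp (L⁻¹ * (ψ n (X (n + 1) ω) - ψ m (X (m + 1) ω)))
          + Real.exp (-L⁻¹ * (ψ n (X (n + 1) ω) - ψ m (X (m + 1) ω))))) ∂μ := by
        refine integral_mono (hX.integrable₂ m n fun x y => |ψ n y - ψ m x| ^ p)
          ((((hint L⁻¹).add (hint (-L⁻¹))).const_mul _).const_mul _) fun ω => ?_
        have h3 := pow_le_factorial_mul_exp_add_exp
          (L⁻¹ * (ψ n (X (n + 1) ω) - ψ m (X (m + 1) ω))) p
        rw [abs_mul, abs_of_pos (inv_pos.2 hL), mul_pow, ← neg_mul] at h3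
        refine le_trans (le_of_eq ?_) (mul_le_mul_of_nonneg_left h3 (pow_pos hL p).le)
        rw [← mul_assoc, ← mul_pow, mul_inv_cancel₀ hL.ne', one_pow, one_mul]
    _ = L ^ p * (p.factorial *
        (∫ ω, Real.exp (L⁻¹ * (ψ n (X (n + 1) ω) - ψ m (X (m + 1) ω))) ∂μ
          + ∫ ω, Real.exp (-L⁻¹ * (ψ n (X (n + 1) ω) - ψ m (X (m + 1) ω))) ∂μ)) := by
        rw [integral_const_mul, integral_const_mul, integral_add (hint _) (hint _)]
    _ ≤ L ^ p * (p.factorial * (Real.exp 4 + Real.exp 4)) := by gcongr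
    _ = _ := by ring

theorem IsPolyaProcess.eLpNorm_real_le (hX : IsPolyaProcess D μ X) {m n : ℕ} (hmn : m ≤ n)
    (ψ : ℕ → V →ₗ[ℝ] ℝ) (c : ℕ → ℝ)
    (hψ : ∀ j, m ≤ j → j < n → ∀ v,
      ψ j v = ψ (j + 1) v + ψ (j + 1) (D.replacement v) / (j + D.tau1))
    (hc : ∀ j, m ≤ j → j < n → ∀ k, |ψ (j + 1) (D.w k)| ≤ c j)
    {L : ℝ} (hL : 0 < L) (hcL : ∑ j ∈ Finset.Ico m n, c j ^ 2 ≤ L ^ 2) {p : ℕ} (hp : p ≠ 0) :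
    eLpNorm (fun ω => ψ n (X (n + 1) ω) - ψ m (X (m + 1) ω)) p μ
      ≤ ENNReal.ofReal ((2 * p.factorial * Real.exp 4) ^ ((p : ℝ)⁻¹) * L) := by
  rw [(hX.memLp₂ m n (fun x y => ψ n y - ψ m x) p).eLpNorm_eq_integral_rpow_norm
    (by simpa using hp) (by simp)]
  refine ENNReal.ofReal_le_ofReal ?_
  simp only [ENNReal.toReal_natCast, Real.rpow_natCast, Real.norm_eq_abs]
  refine (Real.rpow_le_rpow (integral_nonneg fun ω => by positivity)
    (hX.integral_abs_pow_le hmn ψ c hψ hc hL hcL p) (by positivity)).trans (le_of_eq ?_)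
  rw [Real.mul_rpow (by positivity) (by positivity), Real.pow_rpow_inv_natCast hL.le hp]

/-- Real and imaginary parts are real martingales. The constant is chosen before the times and the
forms, because later the forms themselves depend on the final time. -/
theorem IsPolyaProcess.exists_eLpNorm_le (hX : IsPolyaProcess D μ X) {p : ℕ} (hp : p ≠ 0) :
    ∃ K : ℝ, 0 < K ∧ ∀ {m n : ℕ}, m ≤ n → ∀ (φ : ℕ → V →ₗ[ℝ] ℂ) (c : ℕ → ℝ),
    (∀ j, m ≤ j → j < n → ∀ v,
      φ j v = φ (j + 1) v + φ (j + 1) (D.replacement v) / ((j + D.tau1 : ℝ) : ℂ)) →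
    (∀ j, m ≤ j → j < n → ∀ k, ‖φ (j + 1) (D.w k)‖ ≤ c j) →
    ∀ {L : ℝ}, 0 < L → ∑ j ∈ Finset.Ico m n, c j ^ 2 ≤ L ^ 2 →
    eLpNorm (fun ω => φ n (X (n + 1) ω) - φ m (X (m + 1) ω)) p μ ≤ ENNReal.ofReal (K * L) := by
  have hp1 : (1 : ℝ≥0∞) ≤ p := by exact_mod_cast Nat.one_le_iff_ne_zero.2 hp
  refine ⟨(2 * p.factorial * Real.exp 4) ^ ((p : ℝ)⁻¹) + (2 * p.factorial * Real.exp 4) ^ ((p : ℝ)⁻¹),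
    by positivity, fun {m n} hmn φ c hφ hc {L} hL hcL => ?_⟩
  have h1 := hX.eLpNorm_real_le hmn (fun j => Complex.reLm ∘ₗ φ j) c
    (fun j h1 h2 v => by simp [hφ j h1 h2 v, Complex.div_ofReal_re,
      -Complex.ofReal_natCast, -Complex.ofReal_add])
    (fun j h1 h2 k => (Complex.abs_re_le_norm _).trans (hc j h1 h2 k)) hL hcL hp
  have h2 := hX.eLpNorm_real_le hmn (fun j => Complex.imLm ∘ₗ φ j) c
    (fun j h1 h2 v => by simp [hφ j h1 h2 v, Complex.div_ofReal_im,
      -Complex.ofReal_natCast, -Complex.ofReal_add])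
    (fun j h1 h2 k => (Complex.abs_im_le_norm _).trans (hc j h1 h2 k)) hL hcL hp
  rw [add_mul, ENNReal.ofReal_add (by positivity) (by positivity)]
  refine le_trans ?_ (add_le_add h1 h2)
  refine le_trans ?_ ((eLpNorm_add_le (f := fun ω => |(φ n (X (n + 1) ω) - φ m (X (m + 1) ω)).re|)
    (g := fun ω => |(φ n (X (n + 1) ω) - φ m (X (m + 1) ω)).im|)
    (hX.aestronglyMeasurable₂ m n fun x y => |(φ n y - φ m x).re|)
    (hX.aestronglyMeasurable₂ m n fun x y => |(φ n y - φ m x).im|) hp1).trans ?_)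
  · refine eLpNorm_mono_real fun ω => ?_
    exact Complex.norm_le_abs_re_add_abs_im _
  · refine add_le_add (eLpNorm_mono fun ω => ?_) (eLpNorm_mono fun ω => ?_)
    · simp
    · simp

end Azuma

/-! ### The spectrum of the replacement endomorphism and Jordan bases -/

section Spectrum

variable {V : Type*} [AddCommGroup V] [Module ℝ V] [FiniteDimensional ℝ V] {s : ℕ}

/-- The basis of `V` dual to the basis of linear forms. -/
noncomputable def PolyaData.dualBasis (D : PolyaData V s) : Module.Basis (Fin s) ℝ V :=
  D.l.dualBasis.map (Module.evalEquiv ℝ V).symm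

theorem PolyaData.l_dualBasis (D : PolyaData V s) (k j : Fin s) :
    D.l k (D.dualBasis j) = if k = j then 1 else 0 := by
  have h : Module.evalEquiv ℝ V (D.dualBasis j) = D.l.dualBasis j := by
    simp [PolyaData.dualBasis]
  have h2 := LinearMap.congr_fun h (D.l k)
  rw [Module.Basis.dualBasis_apply_self] at h2
  exact h2

theorem PolyaData.dualBasis_repr (D : PolyaData V s) (v : V) (k : Fin s) :
    D.dualBasis.repr v k = D.l k v := by
  conv_rhs => rw [← D.dualBasis.sum_repr v]
  simp [D.l_dualBasis, -Module.Basis.sum_repr]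

/-- Gershgorin for the transposed matrix: off-diagonal entries are nonnegative and each column sums
to `1`, so the disc centred at `l k (w k)` has radius `1 - l k (w k)`. -/
theorem PolyaData.re_le_one (D : PolyaData V s) {z : ℂ} (hz : D.replacementC.HasEigenvalue z) :
    z.re ≤ 1 := by
  classical
  set M : Matrix (Fin s) (Fin s) ℝ := LinearMap.toMatrix D.dualBasis D.dualBasis D.replacement
    with hM
  have hMe : ∀ j k, M j k = D.l j (D.w k) := fun j k => by
    rw [hM, LinearMap.toMatrix_apply, D.dualBasis_repr, D.replacement_apply]
    simp [D.l_dualBasis]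
  have h1 : D.replacementC.charpoly = (M.map (algebraMap ℝ ℂ)).transpose.charpoly := by
    rw [PolyaData.replacementC, LinearMap.charpoly_baseChange, Matrix.charpoly_transpose,
      Matrix.charpoly_map, hM, LinearMap.charpoly_toMatrix]
  rw [Module.End.hasEigenvalue_iff_isRoot_charpoly, h1, ← Matrix.charpoly_toLin',
    ← Module.End.hasEigenvalue_iff_isRoot_charpoly] at hz
  obtain ⟨k, hk⟩ := eigenvalue_mem_ball hz
  have h2 : ∑ j ∈ Finset.univ.erase k, ‖(M.map (algebraMap ℝ ℂ)).transpose k j‖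
      = 1 - D.l k (D.w k) := by
    rw [← D.balance k, ← Finset.add_sum_erase _ _ (Finset.mem_univ k), add_sub_cancel_left]
    refine Finset.sum_congr rfl fun j hj => ?_
    simp [hMe, abs_of_nonneg (D.tenable_off_diag j k (Finset.ne_of_mem_erase hj))]
  rw [h2, mem_closedBall_iff_norm] at hk
  simp only [Matrix.transpose_apply, Matrix.map_apply, hMe, Complex.coe_algebraMap] at hk
  have h3 : z.re - D.l k (D.w k) ≤ 1 - D.l k (D.w k) := by
    have := (Complex.re_le_norm (z - D.l k (D.w k))).trans hk
    simpa using this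
  linarith

variable [NeZero s] {D : PolyaData V s}

/-- The index that precedes `k` (and `0` when `k = 0`). -/
def predIndex (k : Fin s) : Fin s := ⟨k - 1, by omega⟩

theorem JordanBasis.u_zero_comp (B : JordanBasis D) : B.u 0 ∘ₗ D.replacementC = B.u 0 := by
  refine TensorProduct.AlgebraTensorModule.curry_injective ?_
  ext v
  simp only [TensorProduct.AlgebraTensorModule.curry_apply, 
    TensorProduct.curry_apply, LinearMap.coe_restrictScalars, LinearMap.comp_apply,
    PolyaData.replacementC, LinearMap.baseChange_tmul, B.u_zero, LinearMap.sum_apply]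
  have h : ∑ k, D.l k (D.replacement v) = ∑ k, D.l k v := by
    simp only [D.replacement_apply, map_sum, map_smul, smul_eq_mul]
    rw [Finset.sum_comm]
    simp only [← Finset.mul_sum, D.balance, mul_one]
  simpa using congrArg (fun x : ℝ => (x : ℂ)) h

theorem JordanBasis.u_comp (B : JordanBasis D) (k : Fin s) :
    B.u k ∘ₗ D.replacementC = B.lam k • B.u k + B.eps k • B.u (predIndex k) := by
  by_cases hk : k = 0
  · subst hk
    simp [B.u_zero_comp, B.lam_zero, B.eps_zero]
  · have : (k : ℕ) ≠ 0 := fun h => hk (Fin.ext (by simpa using h))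
    exact B.comp_eq _ k (by simp only [predIndex]; omega)

theorem JordanBasis.lam_predIndex (B : JordanBasis D) {k : Fin s} (hk : B.eps k ≠ 0) :
    B.lam (predIndex k) = B.lam k := by
  have h0 : k ≠ 0 := fun h => hk (h ▸ B.eps_zero)
  have : (k : ℕ) ≠ 0 := fun h => h0 (Fin.ext (by simpa using h))
  by_contra hne
  exact hk (B.eps_eq_zero _ k (by simp only [predIndex]; omega) (Ne.symm hne))

theorem JordanBasis.isEigenform_iff (B : JordanBasis D) (k : Fin s) :
    B.IsEigenform k ↔ B.eps k = 0 := by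
  rw [JordanBasis.IsEigenform, B.u_comp]
  simp [B.u.ne_zero]

theorem JordanBasis.v_repr (B : JordanBasis D) (x : ℂ ⊗[ℝ] V) (k : Fin s) :
    B.v.repr x k = B.u k x := by
  conv_rhs => rw [← B.v.sum_repr x]
  simp [B.u_v, -Module.Basis.sum_repr]

theorem JordanBasis.sum_u_smul_v (B : JordanBasis D) (x : ℂ ⊗[ℝ] V) :
    ∑ k, B.u k x • B.v k = x := by
  conv_rhs => rw [← B.v.sum_repr x]
  simp only [B.v_repr]

/-- In the dual basis the matrix is triangular with the roots on its diagonal, since `u k ∘ A`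
involves only `u k` and its predecessor. -/
theorem JordanBasis.charpoly_eq (B : JordanBasis D) :
    D.replacementC.charpoly = ∏ k, (Polynomial.X - Polynomial.C (B.lam k)) := by
  classical
  set M := LinearMap.toMatrix B.v B.v D.replacementC with hM
  have hMe : ∀ i j, M i j = B.lam i * (if i = j then 1 else 0)
      + B.eps i * (if predIndex i = j then 1 else 0) := fun i j => by
    rw [hM, LinearMap.toMatrix_apply, B.v_repr, ← LinearMap.comp_apply, B.u_comp]
    simp [B.u_v]
  have hd : ∀ i, M i i = B.lam i := fun i => by
    rw [hMe]
    by_cases h : B.eps i = 0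
    · simp [h]
    · have h0 : i ≠ 0 := fun h' => h (h' ▸ B.eps_zero)
      have : (i : ℕ) ≠ 0 := fun h => h0 (Fin.ext (by simpa using h))
      have : predIndex i ≠ i := fun h => by
        have := congrArg Fin.val h
        simp only [predIndex] at this
        omega
      simp [this]
  rw [← LinearMap.charpoly_toMatrix _ B.v, ← Matrix.charpoly_transpose,
    Matrix.charpoly_of_isUpperTriangular]
  · exact Finset.prod_congr rfl fun i _ => by rw [Matrix.transpose_apply, ← hM, hd]
  · intro i j hij
    have hij : (j : ℕ) < i := hij
    rw [Matrix.transpose_apply, ← hM, hMe, if_neg, if_neg]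
    · simp
    · intro h
      have := congrArg Fin.val h
      simp only [predIndex] at this
      omega
    · intro h
      have := congrArg Fin.val h
      omega

theorem JordanBasis.hasEigenvalue_iff (B : JordanBasis D) (z : ℂ) :
    D.replacementC.HasEigenvalue z ↔ ∃ k, z = B.lam k := by
  rw [Module.End.hasEigenvalue_iff_isRoot_charpoly, B.charpoly_eq, Polynomial.IsRoot.def,
    Polynomial.eval_prod, Finset.prod_eq_zero_iff]
  simp [sub_eq_zero]

/-- Index `0` already carries the root `1`. A second root equal to `1` makes it multiple, where `σ₂
= 1`; any other root belongs to the set whose supremum is `σ₂`. -/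
theorem JordanBasis.re_le_sigma2 (B : JordanBasis D) {k : Fin s} (hk : k ≠ 0) :
    (B.lam k).re ≤ D.sigma2 := by
  have hev : D.replacementC.HasEigenvalue (B.lam k) := (B.hasEigenvalue_iff _).2 ⟨k, rfl⟩
  rw [PolyaData.sigma2]
  split_ifs with h
  · exact D.re_le_one hev
  · refine le_csSup ⟨1, ?_⟩ ⟨B.lam k, hev, ?_, rfl⟩
    · rintro x ⟨z, hz, -, rfl⟩
      exact D.re_le_one hz
    · intro h1
      refine h ?_
      have hne : D.replacementC.charpoly ≠ 0 := (LinearMap.charpoly_monic _).ne_zero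
      rw [Polynomial.le_rootMultiplicity_iff hne, B.charpoly_eq,
        ← Finset.mul_prod_erase _ _ (Finset.mem_univ 0),
        ← Finset.mul_prod_erase _ _ (Finset.mem_erase.2 ⟨hk, Finset.mem_univ k⟩), B.lam_zero, h1,
        ← mul_assoc, pow_two]
      exact dvd_mul_right _ _

theorem JordanBasis.lam_eq_of_isChainOfIndices (B : JordanBasis D) {J : Finset (Fin s)}
    (hJ : B.IsChainOfIndices J) {i k : Fin s} (hi : i ∈ J) (hk : k ∈ J) : B.lam i = B.lam k := by
  obtain ⟨m, M, hmM, rfl, -, h1⟩ := hJ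
  have key : ∀ n : ℕ, ∀ i : Fin s, (i : ℕ) = n → i ∈ Finset.Icc m M → B.lam i = B.lam m := by
    intro n
    induction n with
    | zero =>
      intro i hi him
      have : (m : ℕ) ≤ i := (Finset.mem_Icc.1 him).1
      rw [Fin.ext (show (i : ℕ) = m by omega)]
    | succ n ih =>
      intro i hi him
      obtain ⟨h2, h3⟩ := Finset.mem_Icc.1 him
      by_cases him' : m = i
      · rw [him']
      · have h4 : m < i := lt_of_le_of_ne h2 him'
        have h4' : (m : ℕ) < i := h4
        have h3' : (i : ℕ) ≤ M := h3
        rw [← B.lam_predIndex (k := i) (by rw [h1 i h4 h3]; exact one_ne_zero)]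
        refine ih _ (by simp only [predIndex]; omega) (Finset.mem_Icc.2 ⟨?_, ?_⟩)
        · change (m : ℕ) ≤ (predIndex i : ℕ)
          simp only [predIndex]; omega
        · change (predIndex i : ℕ) ≤ (M : ℕ)
          simp only [predIndex]; omega
  rw [key _ i rfl hi, key _ k rfl hk]

/-- Otherwise `k` and the start `m` of its chain lie in one monogenic block of size at least two at
real part `σ₂`, and a largest block of this kind is principal. -/
theorem JordanBasis.eps_eq_zero_of_re_eq (B : JordanBasis D) (hss : D.IsPrincipallySemisimple)
    {k : Fin s} (hk : (B.lam k).re = D.sigma2) : B.eps k = 0 := by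
  classical
  by_contra hne
  have h0 : k ≠ 0 := fun h => hne (h ▸ B.eps_zero)
  obtain ⟨m, hm, hmax⟩ := Finset.exists_max_image
    (Finset.univ.filter fun i : Fin s => i ≤ k ∧ B.eps i = 0) id
    ⟨0, by simp [B.eps_zero]⟩
  simp only [Finset.mem_filter, Finset.mem_univ, true_and, id] at hm hmax
  have hchain : B.IsChainOfIndices (Finset.Icc m k) := by
    refine ⟨m, k, hm.1, rfl, hm.2, fun i h1 h2 => (B.eps_mem i).resolve_left fun h => ?_⟩
    exact absurd (hmax i ⟨h2, h⟩) (not_le.2 h1)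
  obtain ⟨J, hJle, hJ⟩ := Finite.exists_le_maximal hchain
  have hkJ : k ∈ J := hJle (Finset.mem_Icc.2 ⟨hm.1, le_rfl⟩)
  have hmJ : m ∈ J := hJle (Finset.mem_Icc.2 ⟨le_rfl, hm.1⟩)
  have hJre : ∀ i ∈ J, (B.lam i).re = D.sigma2 := fun i hi => by
    rw [B.lam_eq_of_isChainOfIndices hJ.prop hi hkJ, hk]
  have hmk : m ≠ k := fun h => hne (h ▸ hm.2)
  have hcard : 2 ≤ J.card := Finset.one_lt_card.2 ⟨m, hmJ, k, hkJ, hmk⟩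
  obtain ⟨J', hJ', hJmax⟩ := Finset.exists_max_image
    (Finset.univ.filter fun J => B.IsMonogenicBlock J ∧ ∀ i ∈ J, (B.lam i).re = D.sigma2)
    Finset.card ⟨J, by simpa using ⟨hJ, hJre⟩⟩
  simp only [Finset.mem_filter, Finset.mem_univ, true_and] at hJ' hJmax
  have h1 := hss B J' ⟨hJ'.1, hJ'.2, fun J'' h h' => hJmax J'' ⟨h, h'⟩⟩
  have h2 := hJmax J ⟨hJ, hJre⟩
  omega

variable {B : JordanBasis D} {r : ℕ}

theorem JordanBasis.eps_eq_zero_of_lt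
    (hB : ∀ k : Fin s, (k : ℕ) < r ↔ B.IsEigenform k ∧ D.sigma2 ≤ (B.lam k).re)
    {k : Fin s} (hk : (k : ℕ) < r) : B.eps k = 0 :=
  (B.isEigenform_iff k).1 ((hB k).1 hk).1

theorem mem_secondIndices {k : Fin s} : k ∈ secondIndices s r ↔ 1 ≤ (k : ℕ) ∧ (k : ℕ) < r := by
  simp [secondIndices]

theorem JordanBasis.re_eq_of_mem
    (hB : ∀ k : Fin s, (k : ℕ) < r ↔ B.IsEigenform k ∧ D.sigma2 ≤ (B.lam k).re)
    {k : Fin s} (hk : k ∈ secondIndices s r) : (B.lam k).re = D.sigma2 := by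
  rw [mem_secondIndices] at hk
  refine le_antisymm (B.re_le_sigma2 ?_) ((hB k).1 hk.2).2
  rintro rfl
  simp at hk

theorem JordanBasis.re_lt_of_le (hss : D.IsPrincipallySemisimple) (hr : 2 ≤ r)
    (hB : ∀ k : Fin s, (k : ℕ) < r ↔ B.IsEigenform k ∧ D.sigma2 ≤ (B.lam k).re)
    {k : Fin s} (hk : r ≤ (k : ℕ)) : (B.lam k).re < D.sigma2 := by
  by_contra hcon
  have hk0 : k ≠ 0 := by
    rintro rfl
    simp at hk
    omega
  have h1 := le_antisymm (B.re_le_sigma2 hk0) (not_lt.1 hcon)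
  exact absurd ((hB k).2 ⟨(B.isEigenform_iff k).2 (B.eps_eq_zero_of_re_eq hss h1), h1.ge⟩)
    (not_lt.2 hk)

/-- Linked indices share their root, so a link cannot leave the indices of real part `< σ₂`. The
tail forms thus span a subspace stable under composition with `A`. -/
theorem JordanBasis.le_predIndex (hss : D.IsPrincipallySemisimple) (hr : 2 ≤ r)
    (hB : ∀ k : Fin s, (k : ℕ) < r ↔ B.IsEigenform k ∧ D.sigma2 ≤ (B.lam k).re)
    {k : Fin s} (hk : r ≤ (k : ℕ)) (he : B.eps k ≠ 0) : r ≤ (predIndex k : ℕ) := by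
  by_contra hcon
  have h1 := ((hB (predIndex k)).1 (not_le.1 hcon)).2
  rw [B.lam_predIndex he] at h1
  exact absurd (JordanBasis.re_lt_of_le hss hr hB hk) (not_lt.2 h1)

end Spectrum

/-! ### Backward products on forms with small roots -/

section Backward

variable {V : Type*} [AddCommGroup V] [Module ℝ V] [FiniteDimensional ℝ V] {s : ℕ}

/-- The restriction to `V` of a linear form on the complexified space, as a real linear map. -/
noncomputable def realForm (V : Type*) [AddCommGroup V] [Module ℝ V]
    (φ : Module.Dual ℂ (ℂ ⊗[ℝ] V)) : V →ₗ[ℝ] ℂ :=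
  (φ.restrictScalars ℝ) ∘ₗ TensorProduct.mk ℝ ℂ V 1

theorem realForm_apply (φ : Module.Dual ℂ (ℂ ⊗[ℝ] V)) (v : V) :
    realForm V φ v = φ (1 ⊗ₜ[ℝ] v) := rfl

theorem PolyaData.replacementC_tmul (D : PolyaData V s) (v : V) :
    D.replacementC (1 ⊗ₜ[ℝ] v) = 1 ⊗ₜ[ℝ] D.replacement v := by
  simp [PolyaData.replacementC]

/-- The form `φ ∘ (1 + A / (j + τ₁))`. -/
noncomputable def PolyaData.pullback (D : PolyaData V s) (j : ℕ)
    (φ : Module.Dual ℂ (ℂ ⊗[ℝ] V)) : Module.Dual ℂ (ℂ ⊗[ℝ] V) :=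
  φ + (((j + D.tau1 : ℝ) : ℂ)⁻¹) • (φ ∘ₗ D.replacementC)

theorem PolyaData.realForm_pullback (D : PolyaData V s) (j : ℕ)
    (φ : Module.Dual ℂ (ℂ ⊗[ℝ] V)) (v : V) :
    realForm V (D.pullback j φ) v
      = realForm V φ v + realForm V φ (D.replacement v) / ((j + D.tau1 : ℝ) : ℂ) := by
  simp only [realForm_apply, PolyaData.pullback, LinearMap.add_apply, LinearMap.smul_apply,
    LinearMap.comp_apply, D.replacementC_tmul, smul_eq_mul]
  ring

variable [NeZero s] {D : PolyaData V s}

/-- A weighted sum norm on linear forms. -/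
noncomputable def JordanBasis.weightNorm (B : JordanBasis D) (η : ℝ)
    (φ : Module.Dual ℂ (ℂ ⊗[ℝ] V)) : ℝ :=
  ∑ i : Fin s, η ^ (i : ℕ) * ‖φ (B.v i)‖

theorem JordanBasis.weightNorm_nonneg (B : JordanBasis D) {η : ℝ} (hη : 0 ≤ η)
    (φ : Module.Dual ℂ (ℂ ⊗[ℝ] V)) : 0 ≤ B.weightNorm η φ :=
  Finset.sum_nonneg fun i _ => by positivity

theorem JordanBasis.replacementC_v (B : JordanBasis D) (φ : Module.Dual ℂ (ℂ ⊗[ℝ] V))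
    (i : Fin s) : φ (D.replacementC (B.v i)) = B.lam i * φ (B.v i)
      + ∑ k, if predIndex k = i then B.eps k * φ (B.v k) else 0 := by
  conv_lhs => rw [← B.sum_u_smul_v (D.replacementC (B.v i))]
  simp only [map_sum, map_smul, smul_eq_mul]
  have : ∀ k, B.u k (D.replacementC (B.v i)) * φ (B.v k)
      = (if k = i then B.lam i * φ (B.v i) else 0)
        + if predIndex k = i then B.eps k * φ (B.v k) else 0 := fun k => by
    rw [← LinearMap.comp_apply, B.u_comp]
    simp only [LinearMap.add_apply, LinearMap.smul_apply, B.u_v, smul_eq_mul]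
    by_cases h1 : k = i
    · subst h1
      by_cases h2 : predIndex k = k <;> simp [h2, add_mul]
    · simp only [h1, if_false]
      split_ifs <;> simp
  simp only [this, Finset.sum_add_distrib, Finset.sum_ite_eq', Finset.mem_univ, if_true]

theorem JordanBasis.norm_apply_le (B : JordanBasis D) {η : ℝ} (hη : 1 ≤ η)
    (φ : Module.Dual ℂ (ℂ ⊗[ℝ] V)) (x : ℂ ⊗[ℝ] V) :
    ‖φ x‖ ≤ B.weightNorm η φ * ∑ k, ‖B.u k x‖ := by
  conv_lhs => rw [← B.sum_u_smul_v x]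
  rw [map_sum, Finset.mul_sum]
  refine (norm_sum_le _ _).trans (Finset.sum_le_sum fun k _ => ?_)
  rw [map_smul, smul_eq_mul, norm_mul, mul_comm]
  refine mul_le_mul_of_nonneg_right ?_ (norm_nonneg _)
  have h1 : η ^ (k : ℕ) * ‖φ (B.v k)‖ ≤ B.weightNorm η φ :=
    Finset.single_le_sum (f := fun i : Fin s => η ^ (i : ℕ) * ‖φ (B.v i)‖)
      (fun i _ => by positivity) (Finset.mem_univ k)
  exact (le_mul_of_one_le_left (norm_nonneg _) (one_le_pow₀ hη)).trans h1

/-- A Jordan link moves a coefficient from an index to its predecessor, where the weight is smaller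
by the factor `η⁻¹`; a large `η` makes the nilpotent part as small as desired. The diagonal bound is
needed only on the support of `φ`. -/
theorem JordanBasis.weightNorm_pullback_le (B : JordanBasis D) {η : ℝ} (hη : 0 < η) (j : ℕ)
    {φ : Module.Dual ℂ (ℂ ⊗[ℝ] V)} {b : ℝ}
    (hb : ∀ i, φ (B.v i) ≠ 0 → ‖1 + B.lam i / ((j + D.tau1 : ℝ) : ℂ)‖ ≤ b) :
    B.weightNorm η (D.pullback j φ) ≤ (b + η⁻¹ / (j + D.tau1)) * B.weightNorm η φ := by
  have hq := D.add_tau1_pos j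
  have h1 : ∀ i, ‖D.pullback j φ (B.v i)‖ ≤ b * ‖φ (B.v i)‖ + (j + D.tau1)⁻¹ *
      ∑ k, if predIndex k = i then ‖B.eps k‖ * ‖φ (B.v k)‖ else 0 := by
    intro i
    have e : D.pullback j φ (B.v i) = (1 + B.lam i / ((j + D.tau1 : ℝ) : ℂ)) * φ (B.v i)
        + ((j + D.tau1 : ℝ) : ℂ)⁻¹ * ∑ k, if predIndex k = i then B.eps k * φ (B.v k) else 0 := by
      simp only [PolyaData.pullback, LinearMap.add_apply, LinearMap.smul_apply,
        LinearMap.comp_apply, smul_eq_mul, B.replacementC_v]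
      ring
    rw [e]
    refine (norm_add_le _ _).trans (add_le_add ?_ ?_)
    · rw [norm_mul]
      by_cases h : φ (B.v i) = 0
      · simp [h]
      · exact mul_le_mul_of_nonneg_right (hb i h) (norm_nonneg _)
    · rw [norm_mul, norm_inv, Complex.norm_of_nonneg hq.le]
      refine mul_le_mul_of_nonneg_left ((norm_sum_le _ _).trans (Finset.sum_le_sum fun k _ => ?_))
        (by positivity)
      split_ifs <;> simp
  have h2 : ∑ i : Fin s, η ^ (i : ℕ) *
      (∑ k, if predIndex k = i then ‖B.eps k‖ * ‖φ (B.v k)‖ else 0)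
        ≤ η⁻¹ * B.weightNorm η φ := by
    simp only [Finset.mul_sum, JordanBasis.weightNorm, mul_ite, mul_zero]
    rw [Finset.sum_comm]
    refine Finset.sum_le_sum fun k _ => ?_
    rw [Finset.sum_ite_eq, if_pos (Finset.mem_univ _)]
    rcases B.eps_mem k with h | h
    · rw [h]
      simp only [norm_zero, zero_mul, mul_zero]
      positivity
    · have h0 : (k : ℕ) ≠ 0 := fun h' => by
        have : k = 0 := Fin.ext (by simpa using h')
        rw [this, B.eps_zero] at h
        exact zero_ne_one h
      obtain ⟨d, hd⟩ := Nat.exists_eq_succ_of_ne_zero h0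
      have hp : ((predIndex k : Fin s) : ℕ) = d := by simp only [predIndex]; omega
      rw [h, hp, hd, pow_succ]
      simp only [norm_one, one_mul]
      refine le_of_eq ?_
      field_simp
  calc B.weightNorm η (D.pullback j φ)
      ≤ ∑ i : Fin s, η ^ (i : ℕ) * (b * ‖φ (B.v i)‖ + (j + D.tau1)⁻¹ *
          ∑ k, if predIndex k = i then ‖B.eps k‖ * ‖φ (B.v k)‖ else 0) :=
        Finset.sum_le_sum fun i _ => mul_le_mul_of_nonneg_left (h1 i) (by positivity)
    _ = b * B.weightNorm η φ + (j + D.tau1)⁻¹ * ∑ i : Fin s, η ^ (i : ℕ) *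
          (∑ k, if predIndex k = i then ‖B.eps k‖ * ‖φ (B.v k)‖ else 0) := by
        simp only [JordanBasis.weightNorm]
        rw [Finset.mul_sum, Finset.mul_sum, ← Finset.sum_add_distrib]
        exact Finset.sum_congr rfl fun i _ => by ring
    _ ≤ b * B.weightNorm η φ + (j + D.tau1)⁻¹ * (η⁻¹ * B.weightNorm η φ) := by gcongr
    _ = _ := by
        rw [div_eq_mul_inv]
        ring

/-- After squaring, the quadratic term `‖z‖ ^ 2 / q ^ 2`, with `q = j + τ`, is absorbed by the gap
`2 (ρ - Re z) / q` once `q` is large. -/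
theorem eventually_norm_one_add_le {τ : ℝ} {z : ℂ} {ρ : ℝ} (h : z.re < ρ) :
    ∀ᶠ j : ℕ in atTop, ‖1 + z / ((j + τ : ℝ) : ℂ)‖ ≤ 1 + ρ / (j + τ) := by
  have ht : Tendsto (fun j : ℕ => (j : ℝ) + τ) atTop atTop :=
    tendsto_atTop_add_const_right _ _ tendsto_natCast_atTop_atTop
  filter_upwards [ht.eventually_ge_atTop (‖z‖ ^ 2 / (2 * (ρ - z.re))),
    ht.eventually_ge_atTop |ρ|, ht.eventually_gt_atTop 0] with j h1 h2 h3
  set q := (j : ℝ) + τ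
  have h4 : 0 ≤ 1 + ρ / q := by
    have : -1 ≤ ρ / q := by
      rw [le_div_iff₀ h3]
      linarith [neg_abs_le ρ]
    linarith
  refine le_of_sq_le_sq ?_ h4
  rw [Complex.sq_norm, Complex.normSq_apply]
  rw [div_le_iff₀ (by linarith), Complex.sq_norm, Complex.normSq_apply] at h1
  simp only [Complex.add_re, Complex.one_re, Complex.div_ofReal_re, Complex.add_im, Complex.one_im,
    Complex.div_ofReal_im, zero_add]
  have e : (1 + ρ / q) ^ 2 - ((1 + z.re / q) * (1 + z.re / q) + z.im / q * (z.im / q))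
      = (q * (2 * (ρ - z.re)) - (z.re * z.re + z.im * z.im) + ρ ^ 2) / q ^ 2 := by
    field_simp
    ring
  have : 0 ≤ (q * (2 * (ρ - z.re)) - (z.re * z.re + z.im * z.im) + ρ ^ 2) / q ^ 2 := by
    have := sq_nonneg ρ
    apply div_nonneg _ (sq_nonneg q)
    linarith
  linarith

/-- The form `φ ∘ (1 + A / q_{n-d}) ∘ ⋯ ∘ (1 + A / q_{n-1})`, where `q_j = j + τ₁`. -/
noncomputable def PolyaData.iterPullback (D : PolyaData V s) (n : ℕ)
    (φ : Module.Dual ℂ (ℂ ⊗[ℝ] V)) : ℕ → Module.Dual ℂ (ℂ ⊗[ℝ] V)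
  | 0 => φ
  | d + 1 => D.pullback (n - (d + 1)) (D.iterPullback n φ d)

theorem PolyaData.iterPullback_sub (D : PolyaData V s) {n j : ℕ} (hj : j < n)
    (φ : Module.Dual ℂ (ℂ ⊗[ℝ] V)) :
    D.iterPullback n φ (n - j) = D.pullback j (D.iterPullback n φ (n - (j + 1))) := by
  obtain ⟨d, hd⟩ : ∃ d, n - j = d + 1 := ⟨n - j - 1, by omega⟩
  rw [hd, show n - (j + 1) = d by omega, PolyaData.iterPullback, show n - (d + 1) = j by omega]

theorem JordanBasis.iterPullback_v_eq_zero (B : JordanBasis D) {I : Set (Fin s)}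
    (hI : ∀ k ∈ I, B.eps k ≠ 0 → predIndex k ∈ I) {φ : Module.Dual ℂ (ℂ ⊗[ℝ] V)}
    (hφ : ∀ i ∉ I, φ (B.v i) = 0) (n d : ℕ) : ∀ i ∉ I, D.iterPullback n φ d (B.v i) = 0 := by
  induction d with
  | zero => exact hφ
  | succ d ih =>
    intro i hi
    simp only [PolyaData.iterPullback, PolyaData.pullback, LinearMap.add_apply,
      LinearMap.smul_apply, LinearMap.comp_apply, B.replacementC_v, ih i hi, mul_zero, zero_add]
    rw [Finset.sum_eq_zero, smul_zero]
    intro k _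
    split_ifs with h
    · by_cases he : B.eps k = 0
      · rw [he, zero_mul]
      · by_cases hk : k ∈ I
        · exact absurd (h ▸ hI k hk he) hi
        · rw [ih k hk, mul_zero]
    · rfl

/-- Growth of the backward products on the forms supported by indices whose roots have real part
less than `ρ`. -/
theorem JordanBasis.exists_norm_iterPullback_le (B : JordanBasis D) {I : Set (Fin s)}
    (hI : ∀ k ∈ I, B.eps k ≠ 0 → predIndex k ∈ I) {ρ : ℝ} (hρ : 0 ≤ ρ)
    (hre : ∀ k ∈ I, (B.lam k).re < ρ) {φ : Module.Dual ℂ (ℂ ⊗[ℝ] V)}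
    (hφ : ∀ i ∉ I, φ (B.v i) = 0) (x : ℂ ⊗[ℝ] V) :
    ∃ C : ℝ, 0 < C ∧ ∀ n j : ℕ, j ≤ n →
      ‖D.iterPullback n φ (n - j) x‖ ≤ C * (((n : ℝ) + 1) ^ ρ * ((j : ℝ) + 1) ^ (-ρ)) := by
  have hτ := D.tau1_pos
  -- The room between the roots and `ρ` pays for the nilpotent part, so Jordan blocks produce no
  -- logarithms in the bound.
  obtain ⟨η, hη1, hη⟩ : ∃ η : ℝ, 1 ≤ η ∧ ∀ k ∈ I, (B.lam k).re < ρ - η⁻¹ := by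
    have h : ∀ k, ∀ᶠ η : ℝ in atTop, k ∈ I → (B.lam k).re < ρ - η⁻¹ := fun k => by
      by_cases hk : k ∈ I
      · have ht : Tendsto (fun η : ℝ => ρ - η⁻¹) atTop (𝓝 (ρ - 0)) :=
          tendsto_const_nhds.sub tendsto_inv_atTop_zero
        rw [sub_zero] at ht
        exact (ht.eventually_const_lt (hre k hk)).mono fun _ h _ => h
      · exact Eventually.of_forall fun _ h => absurd h hk
    obtain ⟨η, h1, h2⟩ := ((eventually_ge_atTop 1).and (eventually_all.2 h)).exists
    exact ⟨η, h1, h2⟩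
  have hη0 : 0 < η := by linarith
  obtain ⟨i₀, hi₀⟩ : ∃ i₀ : ℕ, ∀ j ≥ i₀, ∀ k ∈ I,
      ‖1 + B.lam k / ((j + D.tau1 : ℝ) : ℂ)‖ ≤ 1 + (ρ - η⁻¹) / (j + D.tau1) := by
    have h : ∀ k, ∀ᶠ j : ℕ in atTop, k ∈ I →
        ‖1 + B.lam k / ((j + D.tau1 : ℝ) : ℂ)‖ ≤ 1 + (ρ - η⁻¹) / (j + D.tau1) := fun k => by
      by_cases hk : k ∈ I
      · exact (eventually_norm_one_add_le (hη k hk)).mono fun _ h _ => h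
      · exact Eventually.of_forall fun _ h => absurd h hk
    exact eventually_atTop.1 (eventually_all.2 h)
  -- A crude ratio valid at every rank, used for the finitely many ranks below `i₀`.
  set K : ℝ := (1 + ∑ k, ‖B.lam k‖ / D.tau1) + η⁻¹ / D.tau1 with hKdef
  have hK1 : 1 ≤ K := by
    have : 0 ≤ ∑ k, ‖B.lam k‖ / D.tau1 := Finset.sum_nonneg fun k _ => by positivity
    have : 0 ≤ η⁻¹ / D.tau1 := by positivity
    linarith
  obtain ⟨c, C, hc, hC, hcC⟩ := exists_bounds_growth hτ (z := (ρ : ℂ)) (by simpa using hρ)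
  have hsupp : ∀ n d i, D.iterPullback n φ d (B.v i) ≠ 0 → i ∈ I := fun n d i h => by
    by_contra hi
    exact h (B.iterPullback_v_eq_zero hI hφ n d i hi)
  have key : ∀ n j : ℕ, j ≤ n → B.weightNorm η (D.iterPullback n φ (n - j)) * ‖growth D.tau1 ρ j‖
      ≤ K ^ i₀ * (B.weightNorm η φ * ‖growth D.tau1 ρ n‖) := by
    intro n j hj
    have h := mul_growth_le hτ hρ hK1 i₀ (n := n)
      (a := fun j => B.weightNorm η (D.iterPullback n φ (n - j)))
      (fun j => B.weightNorm_nonneg hη0.le _)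
      (fun j hj => by
        rw [D.iterPullback_sub hj]
        refine (B.weightNorm_pullback_le hη0 j (b := 1 + ∑ k, ‖B.lam k‖ / D.tau1) fun i hi => ?_).trans
          (mul_le_mul_of_nonneg_right ?_ (B.weightNorm_nonneg hη0.le _))
        · refine (norm_add_le _ _).trans ?_
          rw [norm_one, norm_div, Complex.norm_of_nonneg (D.add_tau1_pos j).le]
          have h1 : ‖B.lam i‖ / (j + D.tau1) ≤ ‖B.lam i‖ / D.tau1 := by
            gcongr
            exact le_add_of_nonneg_left j.cast_nonneg
          have h2 : ‖B.lam i‖ / D.tau1 ≤ ∑ k, ‖B.lam k‖ / D.tau1 :=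
            Finset.single_le_sum (f := fun k => ‖B.lam k‖ / D.tau1)
              (fun k _ => by positivity) (Finset.mem_univ i)
          linarith
        · have h1 : η⁻¹ / (j + D.tau1) ≤ η⁻¹ / D.tau1 := by
            gcongr
            exact le_add_of_nonneg_left j.cast_nonneg
          linarith)
      (fun j hj hij => by
        rw [D.iterPullback_sub hj]
        refine (B.weightNorm_pullback_le hη0 j (b := 1 + (ρ - η⁻¹) / (j + D.tau1))
          fun i hi => hi₀ j hij i (hsupp _ _ i hi)).trans (le_of_eq ?_)
        congr 1
        ring) j hj
    refine h.trans ?_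
    simp only [Nat.sub_self, PolyaData.iterPullback]
    exact mul_le_mul_of_nonneg_right (pow_le_pow_right₀ hK1 (Nat.sub_le _ _))
      (mul_nonneg (B.weightNorm_nonneg hη0.le _) (norm_nonneg _))
  have hN := B.weightNorm_nonneg hη0.le φ
  have hU : 0 ≤ ∑ k, ‖B.u k x‖ := Finset.sum_nonneg fun k _ => norm_nonneg _
  -- The summand `1` only ensures that the constant is positive.
  refine ⟨K ^ i₀ * B.weightNorm η φ * C * c⁻¹ * (∑ k, ‖B.u k x‖) + 1, by positivity,
    fun n j hj => ?_⟩
  have hjp : 0 < ((j : ℝ) + 1) ^ ρ := by positivity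
  have h1 : B.weightNorm η (D.iterPullback n φ (n - j)) * (c * ((j : ℝ) + 1) ^ ρ)
      ≤ K ^ i₀ * (B.weightNorm η φ * (C * ((n : ℝ) + 1) ^ ρ)) := by
    have h2 := (hcC j).1
    have h3 := (hcC n).2
    simp only [Complex.ofReal_re] at h2 h3
    refine (mul_le_mul_of_nonneg_left h2 (B.weightNorm_nonneg hη0.le _)).trans
      ((key n j hj).trans ?_)
    gcongr
  refine (B.norm_apply_le hη1 _ x).trans ?_
  rw [add_mul]
  refine le_add_of_le_of_nonneg ?_ (by positivity)
  rw [← le_div_iff₀ (by positivity)] at h1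
  refine (mul_le_mul_of_nonneg_right h1 hU).trans (le_of_eq ?_)
  rw [Real.rpow_neg (by positivity)]
  field_simp

end Backward

/-! ### Polynomial growth in all `L^p` -/

section LpGrowth

variable {Ω : Type*} {mΩ : MeasurableSpace Ω} {μ : Measure Ω} [IsProbabilityMeasure μ]

/-- The sequence `f` is `O(n ^ a)` in `L^p`, for every finite `p`. -/
def HasLpGrowth (μ : Measure Ω) (f : ℕ → Ω → ℂ) (a : ℝ) : Prop :=
  ∀ p : ℕ, p ≠ 0 → ∃ C : ℝ, 0 ≤ C ∧
    ∀ n, eLpNorm (f n) p μ ≤ ENNReal.ofReal (C * ((n : ℝ) + 1) ^ a)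

variable {f g : ℕ → Ω → ℂ} {a b : ℝ}

theorem HasLpGrowth.mono (hf : HasLpGrowth μ f a) (hab : a ≤ b) : HasLpGrowth μ f b := by
  intro p hp
  obtain ⟨C, hC, h⟩ := hf p hp
  refine ⟨C, hC, fun n => (h n).trans (ENNReal.ofReal_le_ofReal ?_)⟩
  gcongr
  exact le_add_of_nonneg_left n.cast_nonneg

theorem HasLpGrowth.add (hf : HasLpGrowth μ f a) (hg : HasLpGrowth μ g a)
    (mf : ∀ n, AEStronglyMeasurable (f n) μ) (mg : ∀ n, AEStronglyMeasurable (g n) μ) :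
    HasLpGrowth μ (fun n ω => f n ω + g n ω) a := by
  intro p hp
  obtain ⟨C, hC, h⟩ := hf p hp
  obtain ⟨C', hC', h'⟩ := hg p hp
  refine ⟨C + C', by positivity, fun n => ?_⟩
  refine (eLpNorm_add_le (mf n) (mg n) (by exact_mod_cast Nat.one_le_iff_ne_zero.2 hp)).trans ?_
  rw [add_mul, ENNReal.ofReal_add (by positivity) (by positivity)]
  exact add_le_add (h n) (h' n)

theorem holderTriple_two_mul (p : ℕ) :
    ENNReal.HolderTriple ((2 * p : ℕ) : ℝ≥0∞) ((2 * p : ℕ) : ℝ≥0∞) (p : ℝ≥0∞) := by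
  refine ⟨?_⟩
  push_cast
  rw [ENNReal.mul_inv (by simp) (by simp), ← add_mul, ENNReal.inv_two_add_inv_two, one_mul]

theorem eLpNorm_mul_le {f g : Ω → ℂ} (mf : AEStronglyMeasurable f μ)
    (mg : AEStronglyMeasurable g μ) (p : ℕ) :
    eLpNorm (fun ω => f ω * g ω) p μ
      ≤ eLpNorm f ((2 * p : ℕ) : ℝ≥0∞) μ * eLpNorm g ((2 * p : ℕ) : ℝ≥0∞) μ := by
  have := holderTriple_two_mul p
  generalize ((2 * p : ℕ) : ℝ≥0∞) = q at *
  exact eLpNorm_smul_le_mul_eLpNorm (φ := f) (f := g) (p := q) (q := q) (r := p) mg mf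

/-- Cauchy–Schwarz bounds the `L^p` norm of a product by `L^{2p}` norms, which are available because
every exponent is controlled. -/
theorem HasLpGrowth.mul (hf : HasLpGrowth μ f a) (hg : HasLpGrowth μ g b)
    (mf : ∀ n, AEStronglyMeasurable (f n) μ) (mg : ∀ n, AEStronglyMeasurable (g n) μ) :
    HasLpGrowth μ (fun n ω => f n ω * g n ω) (a + b) := by
  intro p hp
  obtain ⟨C, hC, h⟩ := hf (2 * p) (by omega)
  obtain ⟨C', hC', h'⟩ := hg (2 * p) (by omega)
  refine ⟨C * C', by positivity, fun n => ?_⟩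
  refine (eLpNorm_mul_le (mf n) (mg n) p).trans ((mul_le_mul' (h n) (h' n)).trans (le_of_eq ?_))
  rw [← ENNReal.ofReal_mul (by positivity), Real.rpow_add (by positivity)]
  congr 1
  ring

theorem hasLpGrowth_of_bound {C : ℝ} (hC : 0 ≤ C)
    (h : ∀ n, ∀ᵐ ω ∂μ, ‖f n ω‖ ≤ C * ((n : ℝ) + 1) ^ a) : HasLpGrowth μ f a := by
  intro p hp
  refine ⟨C, hC, fun n => ?_⟩
  refine (eLpNorm_le_of_ae_bound (h n)).trans ?_
  simp

theorem hasLpGrowth_const (c : ℂ) : HasLpGrowth μ (fun _ _ => c) 0 :=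
  hasLpGrowth_of_bound (norm_nonneg c) fun n => Eventually.of_forall fun ω => by simp

theorem HasLpGrowth.const_mul (hf : HasLpGrowth μ f a)
    (mf : ∀ n, AEStronglyMeasurable (f n) μ) (c : ℂ) :
    HasLpGrowth μ (fun n ω => c * f n ω) a := by
  have := (hasLpGrowth_const (μ := μ) c).mul hf (fun _ => aestronglyMeasurable_const) mf
  rwa [zero_add] at this

theorem HasLpGrowth.exists_norm_integral_le (hf : HasLpGrowth μ f a) :
    ∃ C : ℝ, 0 ≤ C ∧ ∀ n, ‖∫ ω, f n ω ∂μ‖ ≤ C * ((n : ℝ) + 1) ^ a := by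
  obtain ⟨C, hC, h⟩ := hf 1 one_ne_zero
  refine ⟨C, hC, fun n => ?_⟩
  rw [← ENNReal.ofReal_le_ofReal_iff (by positivity), ofReal_norm]
  refine (enorm_integral_le_lintegral_enorm _).trans ?_
  rw [← eLpNorm_one_eq_lintegral_enorm]
  simpa using h n

/-- Take `p` with `p * (-a) > 1`: the series of the `p`-th moments converges, so almost surely the
series of `‖f n‖ ^ p` converges and its terms tend to zero. -/
theorem HasLpGrowth.ae_tendsto_zero (hf : HasLpGrowth μ f a) (ha : a < 0)
    (mf : ∀ n, AEStronglyMeasurable (f n) μ) :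
    ∀ᵐ ω ∂μ, Tendsto (fun n => f n ω) atTop (𝓝 0) := by
  obtain ⟨p, hp⟩ := exists_nat_gt (1 / -a)
  have hp0 : p ≠ 0 := by
    rintro rfl
    have : 0 < 1 / -a := by
      have := neg_pos.2 ha
      positivity
    simp at hp
    linarith
  have hpa : 1 < p * -a := by rwa [div_lt_iff₀ (neg_pos.2 ha)] at hp
  obtain ⟨C, hC, h⟩ := hf p hp0
  have h1 : ∀ n, ∫⁻ ω, ‖f n ω‖ₑ ^ (p : ℝ) ∂μ
      ≤ ENNReal.ofReal (C ^ p * ((n : ℝ) + 1) ^ (-(p * -a))) := fun n => by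
    have e := eLpNorm_nnreal_pow_eq_lintegral (f := f n) (μ := μ) (p := (p : NNReal))
      (by exact_mod_cast hp0)
    simp only [ENNReal.coe_natCast, NNReal.coe_natCast] at e
    rw [← e, ENNReal.rpow_natCast]
    refine (pow_le_pow_left' (h n) p).trans (le_of_eq ?_)
    rw [← ENNReal.ofReal_pow (by positivity), mul_pow, ← Real.rpow_mul_natCast (by positivity)]
    congr 3
    ring
  have h2 : Summable fun n : ℕ => C ^ p * ((n : ℝ) + 1) ^ (-(p * -a)) := by
    refine Summable.mul_left _ ?_
    have := (summable_nat_add_iff 1).2 (Real.summable_nat_rpow.2 (neg_lt_neg hpa))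
    simpa using this
  have h3 : ∫⁻ ω, ∑' n, ‖f n ω‖ₑ ^ (p : ℝ) ∂μ ≠ ∞ := by
    rw [lintegral_tsum fun n => (mf n).enorm.pow_const _]
    exact ne_top_of_le_ne_top h2.tsum_ofReal_ne_top (ENNReal.tsum_le_tsum h1)
  have h4 := ae_lt_top' (AEMeasurable.tsum fun n => (mf n).enorm.pow_const _) h3
  filter_upwards [h4] with ω hω
  have h5 := ENNReal.tendsto_atTop_zero_of_tsum_ne_top hω.ne
  have hp' : (p : ℝ) ≠ 0 := by exact_mod_cast hp0
  have h6 := ((ENNReal.continuous_rpow_const (y := (p : ℝ)⁻¹)).tendsto 0).comp h5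
  rw [ENNReal.zero_rpow_of_pos (by positivity)] at h6
  have h7 : Tendsto (fun n => ‖f n ω‖ₑ) atTop (𝓝 0) := by
    refine h6.congr fun n => ?_
    simp only [Function.comp_apply]
    rw [← ENNReal.rpow_mul, mul_inv_cancel₀ hp', ENNReal.rpow_one]
  rw [tendsto_zero_iff_norm_tendsto_zero]
  have h8 := (ENNReal.tendsto_toReal ENNReal.zero_ne_top).comp h7
  simpa [Function.comp_def] using h8

theorem hasLpGrowth_of_memLp {Z : Ω → ℂ} (h : ∀ p : ℕ, p ≠ 0 → MemLp Z p μ) :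
    HasLpGrowth μ (fun _ => Z) 0 := by
  intro p hp
  refine ⟨(eLpNorm Z p μ).toReal, ENNReal.toReal_nonneg, fun n => ?_⟩
  rw [Real.rpow_zero, mul_one, ENNReal.ofReal_toReal (h p hp).eLpNorm_ne_top]

/-- A sequence that is Cauchy in all `L^p` at a polynomial rate has a limit, at the same rate. -/
theorem exists_limit_of_eLpNorm_sub_le (mf : ∀ n (p : ℕ), MemLp (f n) p μ) (ha : a < 0)
    (h : ∀ p : ℕ, p ≠ 0 → ∃ C : ℝ, 0 ≤ C ∧ ∀ m n, m ≤ n →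
      eLpNorm (fun ω => f n ω - f m ω) p μ ≤ ENNReal.ofReal (C * ((m : ℝ) + 1) ^ a)) :
    ∃ Z : Ω → ℂ, Measurable Z ∧ (∀ p : ℕ, p ≠ 0 → MemLp Z p μ) ∧
      HasLpGrowth μ (fun n ω => f n ω - Z ω) a := by
  have m1 : ∀ n, MemLp (f n) 1 μ := fun n => by simpa using mf n 1
  obtain ⟨C, hC, hCau⟩ := h 1 one_ne_zero
  have hlim : Tendsto (fun m : ℕ => ENNReal.ofReal (C * ((m : ℝ) + 1) ^ a)) atTop (𝓝 0) := by
    rw [← ENNReal.ofReal_zero]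
    refine ENNReal.tendsto_ofReal ?_
    have h1 := (tendsto_rpow_neg_atTop (neg_pos.2 ha)).comp
      (tendsto_atTop_add_const_right atTop (1 : ℝ) tendsto_natCast_atTop_atTop)
    simpa [Function.comp_def] using h1.const_mul C
  have hcs : CauchySeq fun n => (m1 n).toLp (f n) := by
    rw [EMetric.cauchySeq_iff_le_tendsto_0]
    refine ⟨fun m => ENNReal.ofReal (C * ((m : ℝ) + 1) ^ a)
      + ENNReal.ofReal (C * ((m : ℝ) + 1) ^ a), ?_, by simpa using hlim.add hlim⟩
    have hle : ∀ N n, N ≤ n → edist ((m1 n).toLp (f n)) ((m1 N).toLp (f N))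
        ≤ ENNReal.ofReal (C * ((N : ℝ) + 1) ^ a) := fun N n hn => by
      rw [Lp.edist_toLp_toLp]
      simpa using! hCau N n hn
    intro n m N hn hm
    refine (edist_triangle_right _ _ ((m1 N).toLp (f N))).trans (add_le_add (hle N n hn) (hle N m hm))
  obtain ⟨Z, hZ⟩ := cauchySeq_tendsto_of_complete hcs
  have hZ1 : Tendsto (fun n => eLpNorm (f n - ⇑Z) 1 μ) atTop (𝓝 0) := by
    have e := (Lp.tendsto_Lp_iff_tendsto_eLpNorm'' (fun n => f n) m1 (⇑Z) (Lp.memLp Z)).1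
      (by simpa using hZ)
    exact e
  obtain ⟨ns, hns, hae⟩ := (tendstoInMeasure_of_tendsto_eLpNorm one_ne_zero
    (fun n => (m1 n).1) (Lp.aestronglyMeasurable Z) hZ1).exists_seq_tendsto_ae
  have hmk := (Lp.aestronglyMeasurable Z).ae_eq_mk
  set Z' := (Lp.aestronglyMeasurable Z).mk with hZ'
  have hZm : StronglyMeasurable Z' := (Lp.aestronglyMeasurable Z).stronglyMeasurable_mk
  have hg : HasLpGrowth μ (fun n ω => f n ω - Z' ω) a := by
    intro p hp
    obtain ⟨C, hC, hCau⟩ := h p hp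
    refine ⟨C, hC, fun m => ?_⟩
    -- Fatou along an almost surely convergent subsequence carries the Cauchy rate in each `L^p`
    -- over to the single limit found in `L^1`.
    have h1 := Lp.eLpNorm_lim_le_liminf_eLpNorm (p := (p : ℝ≥0∞)) (μ := μ)
      (f := fun i ω => f m ω - f (ns i) ω) (fun i => (m1 m).1.sub (m1 (ns i)).1)
      (fun ω => f m ω - Z' ω) (by
        filter_upwards [hae, hmk] with ω h1 h2
        rw [← h2]
        exact tendsto_const_nhds.sub h1)
    refine h1.trans (liminf_le_of_le (by isBoundedDefault) fun b hb => ?_)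
    obtain ⟨i, hi1, hi2⟩ := (hb.and (hns.tendsto_atTop.eventually_ge_atTop m)).exists
    refine hi1.trans ?_
    have e : eLpNorm (fun ω => f m ω - f (ns i) ω) p μ = eLpNorm (fun ω => f (ns i) ω - f m ω) p μ :=
      eLpNorm_sub_comm _ _ _ _
    rw [e]
    exact hCau m (ns i) hi2
  refine ⟨Z', hZm.measurable, fun p hp => ?_, hg⟩
  obtain ⟨C, hC, hb⟩ := hg p hp
  have h2 : MemLp (fun ω => f 0 ω - Z' ω) p μ :=
    ⟨(m1 0).1.sub hZm.aestronglyMeasurable, (hb 0).trans_lt ENNReal.ofReal_lt_top⟩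
  have h3 := (mf 0 p).sub h2
  refine (memLp_congr_ae (Eventually.of_forall fun ω => ?_)).1 h3
  simp

end LpGrowth

/-! ### Growth and convergence of the coordinates of the process -/

section Coordinates

variable {V : Type*} [AddCommGroup V] [Module ℝ V] [FiniteDimensional ℝ V] [MeasurableSpace V]
  [MeasurableSingletonClass V] {s : ℕ} [NeZero s] {D : PolyaData V s}
  {Ω : Type*} {mΩ : MeasurableSpace Ω} {μ : Measure Ω} [IsProbabilityMeasure μ] {X : ℕ → Ω → V}

theorem JordanBasis.u_zero_tmul (B : JordanBasis D) {n : ℕ} {v : V} (hv : v ∈ D.reach n) :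
    B.u 0 (1 ⊗ₜ[ℝ] v) = ((n + D.tau1 : ℝ) : ℂ) := by
  rw [← D.sum_coord hv, B.u_zero]
  simp

theorem IsPolyaProcess.hasLpGrowth_zero (hX : IsPolyaProcess D μ X) (B : JordanBasis D) :
    HasLpGrowth μ (fun n ω => B.u 0 (1 ⊗ₜ[ℝ] X (n + 1) ω)) 1 := by
  have hτ := D.tau1_pos
  refine hasLpGrowth_of_bound (C := 1 + D.tau1) (by positivity) fun n => ?_
  filter_upwards [hX.mem_reach n] with ω hω
  rw [B.u_zero_tmul hω, Complex.norm_of_nonneg (D.add_tau1_pos n).le, Real.rpow_one]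
  have : (0 : ℝ) ≤ n := n.cast_nonneg
  nlinarith

/-- Growth of the coordinates with small roots. -/
theorem IsPolyaProcess.hasLpGrowth_of_re_lt (hX : IsPolyaProcess D μ X) (B : JordanBasis D)
    {I : Set (Fin s)} (hI : ∀ k ∈ I, B.eps k ≠ 0 → predIndex k ∈ I) {ρ : ℝ} (hρ : 1 / 2 < ρ)
    (hre : ∀ k ∈ I, (B.lam k).re < ρ) {k : Fin s} (hk : k ∈ I) :
    HasLpGrowth μ (fun n ω => B.u k (1 ⊗ₜ[ℝ] X (n + 1) ω)) ρ := by
  have hρ0 : 0 ≤ ρ := by linarith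
  have hφ : ∀ i ∉ I, B.u k (B.v i) = 0 := fun i hi => by
    rw [B.u_v, if_neg]
    rintro rfl
    exact hi hk
  choose C hC hCb using fun x : ℂ ⊗[ℝ] V => B.exists_norm_iterPullback_le hI hρ0 hre hφ x
  obtain ⟨Cs, hCs, hCsum⟩ := exists_sum_rpow_le (a := 2 * ρ) (by linarith)
  set W : ℝ := 1 + ∑ j, C (1 ⊗ₜ[ℝ] D.w j) with hW
  have hWp : 0 < W := by
    have : 0 ≤ ∑ j, C (1 ⊗ₜ[ℝ] D.w j) := Finset.sum_nonneg fun j _ => (hC _).le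
    linarith
  intro p hp
  obtain ⟨K, hK, hKb⟩ := hX.exists_eLpNorm_le hp
  refine ⟨K * (W * Real.sqrt Cs) + C (1 ⊗ₜ[ℝ] D.x₁),
    add_nonneg (by positivity) (hC _).le, fun n => ?_⟩
  -- For fixed final time `n`, the pulled back forms give a martingale ending at `u k (X (n + 1))`.
  -- Its increments are `O((n / j) ^ ρ)`, and `∑ j ^ (-2ρ)` converges since `ρ > 1/2`.
  set φ : ℕ → V →ₗ[ℝ] ℂ := fun j => realForm V (D.iterPullback n (B.u k) (n - j)) with hφdef
  have h1 := hKb n.zero_le φ (fun j => W * (((n : ℝ) + 1) ^ ρ * ((j : ℝ) + 1) ^ (-ρ)))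
    (fun j _ hj v => by
      simp only [hφdef]
      rw [D.iterPullback_sub hj, D.realForm_pullback])
    (fun j _ hj i => by
      simp only [hφdef, realForm_apply]
      refine (hCb _ n (j + 1) hj).trans ?_
      have h2 : C (1 ⊗ₜ[ℝ] D.w i) ≤ W := by
        have := Finset.single_le_sum (f := fun j => C (1 ⊗ₜ[ℝ] D.w j)) (fun j _ => (hC _).le)
          (Finset.mem_univ i)
        linarith
      have h3 : (((j + 1 : ℕ) : ℝ) + 1) ^ (-ρ) ≤ ((j : ℝ) + 1) ^ (-ρ) := by
        push_cast
        exact Real.rpow_le_rpow_of_nonpos (by positivity) (by linarith) (by linarith)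
      have := (hC (1 ⊗ₜ[ℝ] D.w i)).le
      gcongr)
    (L := W * Real.sqrt Cs * ((n : ℝ) + 1) ^ ρ) (by positivity) (by
      have e : ∀ j : ℕ, (W * (((n : ℝ) + 1) ^ ρ * ((j : ℝ) + 1) ^ (-ρ))) ^ 2
          = (W ^ 2 * (((n : ℝ) + 1) ^ ρ) ^ 2) * ((j : ℝ) + 1) ^ (-(2 * ρ)) := fun j => by
        rw [mul_pow, mul_pow, ← Real.rpow_mul_natCast (by positivity) (-ρ)]
        push_cast
        rw [show -ρ * 2 = -(2 * ρ) by ring]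
        ring
      simp only [e, ← Finset.mul_sum]
      rw [mul_pow, mul_pow, Real.sq_sqrt hCs.le]
      have := hCsum (Finset.Ico 0 n)
      calc W ^ 2 * (((n : ℝ) + 1) ^ ρ) ^ 2 * ∑ j ∈ Finset.Ico 0 n, ((j : ℝ) + 1) ^ (-(2 * ρ))
          ≤ W ^ 2 * (((n : ℝ) + 1) ^ ρ) ^ 2 * Cs := by gcongr
        _ = _ := by ring)
  have h2 : eLpNorm (fun ω => φ 0 (X (0 + 1) ω)) p μ
      ≤ ENNReal.ofReal (C (1 ⊗ₜ[ℝ] D.x₁) * ((n : ℝ) + 1) ^ ρ) := by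
    refine (eLpNorm_le_of_ae_bound (C := C (1 ⊗ₜ[ℝ] D.x₁) * ((n : ℝ) + 1) ^ ρ) ?_).trans ?_
    · filter_upwards [hX.init] with ω hω
      rw [zero_add, hω]
      have := hCb (1 ⊗ₜ[ℝ] D.x₁) n 0 n.zero_le
      simpa [hφdef, realForm_apply] using this
    · simp
  have h3 : (fun ω => B.u k (1 ⊗ₜ[ℝ] X (n + 1) ω))
      = (fun ω => φ n (X (n + 1) ω) - φ 0 (X (0 + 1) ω)) + fun ω => φ 0 (X (0 + 1) ω) := by
    funext ω
    simp [hφdef, realForm_apply, PolyaData.iterPullback]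
  beta_reduce
  rw [h3]
  refine (eLpNorm_add_le (hX.aestronglyMeasurable₂ 0 n fun x y => φ n y - φ 0 x)
    (hX.aestronglyMeasurable 0 fun x => φ 0 x)
    (by exact_mod_cast Nat.one_le_iff_ne_zero.2 hp)).trans ((add_le_add h1 h2).trans (le_of_eq ?_))
  have := (hC (1 ⊗ₜ[ℝ] D.x₁)).le
  rw [← ENNReal.ofReal_add (by positivity) (by positivity)]
  congr 1
  ring

/-- Convergence of the martingale attached to an eigenform whose root has real part `> 1 / 2`. -/
theorem IsPolyaProcess.exists_limit (hX : IsPolyaProcess D μ X) (B : JordanBasis D)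
    {k : Fin s} (hk : B.eps k = 0) (hre : 1 / 2 < (B.lam k).re) :
    ∃ Z : Ω → ℂ, Measurable Z ∧ (∀ p : ℕ, p ≠ 0 → MemLp Z p μ) ∧
      HasLpGrowth μ (fun n ω => (growth D.tau1 (B.lam k) n)⁻¹ * B.u k (1 ⊗ₜ[ℝ] X (n + 1) ω) - Z ω)
        (-((2 * (B.lam k).re - 1) / 4)) := by
  set σ := (B.lam k).re with hσ
  have hτ := D.tau1_pos
  have hz : 0 ≤ (B.lam k).re := by linarith
  obtain ⟨c, _, hc, _, hcb⟩ := exists_bounds_growth hτ hz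
  -- Half of the available exponent `2σ - 1` is kept for the tail of the squared increments; its
  -- square root gives the rate `(2σ - 1) / 4`.
  obtain ⟨Cs, hCs, hCsum⟩ := exists_sum_Ico_rpow_le (δ := (2 * σ - 1) / 2) (a := 2 * σ)
    (by linarith) (by linarith)
  set W : ℝ := 1 + ∑ j, ‖B.u k (1 ⊗ₜ[ℝ] D.w j)‖ with hW
  have hWp : 0 < W := by positivity
  refine exists_limit_of_eLpNorm_sub_le (fun n p => hX.memLp₂ n n (fun _ y =>
    (growth D.tau1 (B.lam k) n)⁻¹ * B.u k (1 ⊗ₜ[ℝ] y)) p) (by linarith) fun p hp => ?_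
  obtain ⟨K, hK, hKb⟩ := hX.exists_eLpNorm_le hp
  refine ⟨K * (W * c⁻¹ * Real.sqrt Cs), by positivity, fun m n hmn => ?_⟩
  have h1 := hKb hmn (fun j => realForm V ((growth D.tau1 (B.lam k) j)⁻¹ • B.u k))
    (fun j => W * c⁻¹ * ((j : ℝ) + 1) ^ (-σ))
    (fun j _ hj v => by
      have hg := growth_ne_zero hτ hz j
      have hg' := growth_ne_zero hτ hz (j + 1)
      have he : B.u k (1 ⊗ₜ[ℝ] D.replacement v) = B.lam k * B.u k (1 ⊗ₜ[ℝ] v) := by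
        rw [← D.replacementC_tmul, ← LinearMap.comp_apply, B.u_comp, hk]
        simp
      simp only [realForm_apply, LinearMap.smul_apply, smul_eq_mul, he]
      rw [growth_succ] at hg' ⊢
      have hg2 := right_ne_zero_of_mul hg'
      have : (growth D.tau1 (B.lam k) j * (1 + B.lam k / ((j + D.tau1 : ℝ) : ℂ)))⁻¹
          * B.u k (1 ⊗ₜ[ℝ] v) + (growth D.tau1 (B.lam k) j * (1 + B.lam k / ((j + D.tau1 : ℝ) : ℂ)))⁻¹
          * (B.lam k * B.u k (1 ⊗ₜ[ℝ] v)) / ((j + D.tau1 : ℝ) : ℂ)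
          = (growth D.tau1 (B.lam k) j)⁻¹ * ((1 + B.lam k / ((j + D.tau1 : ℝ) : ℂ))⁻¹
          * (1 + B.lam k / ((j + D.tau1 : ℝ) : ℂ))) * B.u k (1 ⊗ₜ[ℝ] v) := by
        rw [mul_inv]
        ring
      rw [this, inv_mul_cancel₀ hg2, mul_one])
    (fun j _ hj i => by
      simp only [realForm_apply, LinearMap.smul_apply, smul_eq_mul, norm_mul, norm_inv]
      have h2 : ‖B.u k (1 ⊗ₜ[ℝ] D.w i)‖ ≤ W := by
        have := Finset.single_le_sum (f := fun j => ‖B.u k (1 ⊗ₜ[ℝ] D.w j)‖)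
          (fun j _ => norm_nonneg _) (Finset.mem_univ i)
        linarith
      have h3 : ‖growth D.tau1 (B.lam k) (j + 1)‖⁻¹ ≤ c⁻¹ * ((j : ℝ) + 1) ^ (-σ) := by
        rw [Real.rpow_neg (by positivity), ← mul_inv]
        refine inv_anti₀ (by positivity) (le_trans ?_ (hcb (j + 1)).1)
        gcongr
        linarith
      calc ‖growth D.tau1 (B.lam k) (j + 1)‖⁻¹ * ‖B.u k (1 ⊗ₜ[ℝ] D.w i)‖
          ≤ (c⁻¹ * ((j : ℝ) + 1) ^ (-σ)) * W := by gcongr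
        _ = _ := by ring)
    (L := W * c⁻¹ * Real.sqrt Cs * ((m : ℝ) + 1) ^ (-((2 * σ - 1) / 4))) (by positivity) (by
      have e : ∀ j : ℕ, (W * c⁻¹ * ((j : ℝ) + 1) ^ (-σ)) ^ 2
          = (W * c⁻¹) ^ 2 * ((j : ℝ) + 1) ^ (-(2 * σ)) := fun j => by
        rw [mul_pow, ← Real.rpow_mul_natCast (by positivity) (-σ)]
        push_cast
        rw [show -σ * 2 = -(2 * σ) by ring]
      simp only [e, ← Finset.mul_sum]
      rw [mul_pow (W * c⁻¹ * √Cs), mul_pow (W * c⁻¹), Real.sq_sqrt hCs.le,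
        ← Real.rpow_mul_natCast (by positivity) (-((2 * σ - 1) / 4)), mul_assoc]
      refine mul_le_mul_of_nonneg_left ((hCsum m n).trans (le_of_eq ?_)) (by positivity)
      congr 2
      push_cast
      ring)
  rw [mul_assoc]
  simpa [realForm_apply] using h1

end Coordinates

/-! ### The weight filtration on polynomial functions -/

section Filtration

variable {V : Type*} [AddCommGroup V] [Module ℝ V] {s : ℕ} [NeZero s] {D : PolyaData V s}

theorem multiIndex_induction {ι : Type*} [Fintype ι] [DecidableEq ι] {P : (ι → ℕ) → Prop}
    (h0 : P 0) (hs : ∀ k β, P β → P (β + Pi.single k 1)) (β : ι → ℕ) : P β := by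
  obtain ⟨n, hn⟩ : ∃ n, ∑ k, β k = n := ⟨_, rfl⟩
  induction n generalizing β with
  | zero =>
    have : β = 0 := by
      funext k
      exact Finset.sum_eq_zero_iff.1 hn k (Finset.mem_univ k)
    rwa [this]
  | succ n ih =>
    obtain ⟨k, -, hk⟩ := Finset.exists_ne_zero_of_sum_ne_zero (s := Finset.univ) (f := β) (by omega)
    have e : β = (β - Pi.single k 1) + Pi.single k 1 := by
      funext i
      by_cases h : i = k
      · subst h
        simp
        omega
      · simp [h]
    rw [e]
    refine hs _ _ (ih _ ?_)
    have h1 := congrArg (fun β : ι → ℕ => ∑ i, β i) e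
    simp only [Pi.add_apply, Finset.sum_add_distrib, Finset.sum_pi_single', Finset.mem_univ,
      if_true] at h1
    omega

theorem JordanBasis.monomial_zero (B : JordanBasis D) : B.monomial 0 = 1 := by
  simp [JordanBasis.monomial]

theorem JordanBasis.monomial_add (B : JordanBasis D) (α β : Fin s → ℕ) :
    B.monomial (α + β) = B.monomial α * B.monomial β := by
  simp [JordanBasis.monomial, pow_add, Finset.prod_mul_distrib]

theorem JordanBasis.monomial_single (B : JordanBasis D) (k : Fin s) :
    B.monomial (Pi.single k 1) = restrictForm V (B.u k) := by
  rw [JordanBasis.monomial, Finset.prod_eq_single k]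
  · simp
  · intro i _ hi
    simp [hi]
  · simp

/-- The weight of a multi-index. -/
def multiWeight (w : Fin s → ℝ) (β : Fin s → ℕ) : ℝ := ∑ k, β k * w k

theorem multiWeight_add (w : Fin s → ℝ) (α β : Fin s → ℕ) :
    multiWeight w (α + β) = multiWeight w α + multiWeight w β := by
  simp [multiWeight, add_mul, Finset.sum_add_distrib]

theorem multiWeight_single (w : Fin s → ℝ) (k : Fin s) :
    multiWeight w (Pi.single k 1) = w k := by
  rw [multiWeight, Finset.sum_eq_single k]
  · simp
  · intro i _ hi
    simp [hi]
  · simp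

/-- The span of the monomials of weight at most `τ`. -/
noncomputable def JordanBasis.weightFiltration (B : JordanBasis D) (w : Fin s → ℝ) (τ : ℝ) :
    Submodule ℂ (V → ℂ) :=
  Submodule.span ℂ (B.monomial '' {β | multiWeight w β ≤ τ})

variable {B : JordanBasis D} {w : Fin s → ℝ}

theorem JordanBasis.monomial_mem_weightFiltration {β : Fin s → ℕ} {τ : ℝ}
    (h : multiWeight w β ≤ τ) : B.monomial β ∈ B.weightFiltration w τ :=
  Submodule.subset_span ⟨β, h, rfl⟩

theorem JordanBasis.weightFiltration_mono {τ τ' : ℝ} (h : τ ≤ τ') :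
    B.weightFiltration w τ ≤ B.weightFiltration w τ' :=
  Submodule.span_mono (Set.image_mono fun _ hβ => le_trans hβ h)

theorem JordanBasis.mul_mem_weightFiltration {f g : V → ℂ} {a b : ℝ}
    (hf : f ∈ B.weightFiltration w a) (hg : g ∈ B.weightFiltration w b) :
    f * g ∈ B.weightFiltration w (a + b) := by
  have h := Submodule.mul_mem_mul hf hg
  rw [JordanBasis.weightFiltration, JordanBasis.weightFiltration, Submodule.span_mul_span] at h
  refine Submodule.span_le.2 ?_ h
  rintro _ ⟨_, ⟨α, hα, rfl⟩, _, ⟨β, hβ, rfl⟩, rfl⟩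
  change B.monomial α * B.monomial β ∈ _
  rw [← B.monomial_add]
  refine JordanBasis.monomial_mem_weightFiltration ?_
  rw [multiWeight_add]
  exact add_le_add hα hβ

theorem JordanBasis.u_mem_weightFiltration (k : Fin s) :
    restrictForm V (B.u k) ∈ B.weightFiltration w (w k) := by
  rw [← B.monomial_single]
  exact JordanBasis.monomial_mem_weightFiltration (multiWeight_single w k).le

theorem JordanBasis.restrictForm_mem_weightFiltration (hw1 : ∀ k, w k ≤ 1)
    (φ : Module.Dual ℂ (ℂ ⊗[ℝ] V)) : restrictForm V φ ∈ B.weightFiltration w 1 := by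
  rw [← B.u.sum_repr φ, map_sum]
  refine sum_mem fun k _ => ?_
  rw [map_smul]
  exact Submodule.smul_mem _ _
    (JordanBasis.weightFiltration_mono (hw1 k) (JordanBasis.u_mem_weightFiltration k))

theorem JordanBasis.weightFiltration_le_polyFunctions (τ : ℝ) :
    B.weightFiltration w τ ≤ polyFunctions V := by
  refine Submodule.span_le.2 ?_
  rintro _ ⟨β, -, rfl⟩
  exact B.monomial_mem β

theorem JordanBasis.finite_weightFiltration {ρ : ℝ} (hρ : 0 < ρ) (hwρ : ∀ k, ρ ≤ w k) (τ : ℝ) :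
    Module.Finite ℂ (B.weightFiltration w τ) := by
  refine Module.Finite.iff_fg.2 (Submodule.fg_span (Set.Finite.image _ ?_))
  obtain ⟨N, hN⟩ := exists_nat_ge (τ / ρ)
  rw [div_le_iff₀ hρ] at hN
  refine (Set.finite_Iic (fun _ : Fin s => N)).subset fun β hβ k => ?_
  have h1 : (β k : ℝ) * w k ≤ multiWeight w β :=
    Finset.single_le_sum (f := fun k => (β k : ℝ) * w k)
      (fun i _ => mul_nonneg (Nat.cast_nonneg _) (hρ.le.trans (hwρ i))) (Finset.mem_univ k)
  have h2 : (β k : ℝ) * ρ ≤ β k * w k := mul_le_mul_of_nonneg_left (hwρ k) (Nat.cast_nonneg _)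
  have h3 : (β k : ℝ) * ρ ≤ N * ρ := h2.trans (h1.trans (le_trans hβ hN))
  exact_mod_cast le_of_mul_le_mul_right h3 hρ

/-- The difference operator `f ↦ f(· + x) - f`. -/
def difference (x : V) : (V → ℂ) →ₗ[ℂ] (V → ℂ) where
  toFun f := fun v => f (v + x) - f v
  map_add' f g := by
    funext v
    simp only [Pi.add_apply]
    ring
  map_smul' c f := by
    funext v
    simp only [Pi.smul_apply, smul_eq_mul, RingHom.id_apply]
    ring

theorem difference_restrictForm_mul (x : V) (φ : Module.Dual ℂ (ℂ ⊗[ℝ] V)) (f : V → ℂ) :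
    difference x (restrictForm V φ * f) = φ (1 ⊗ₜ[ℝ] x) • f + restrictForm V φ * difference x f
      + φ (1 ⊗ₜ[ℝ] x) • difference x f := by
  funext v
  simp only [difference, restrictForm, LinearMap.coe_mk, AddHom.coe_mk, Pi.mul_apply,
    Pi.add_apply, Pi.smul_apply, smul_eq_mul, TensorProduct.tmul_add, map_add]
  ring

/-- By the discrete Leibniz rule, each term of the difference has at least one factor `u k` replaced
by a constant. -/
theorem JordanBasis.difference_mem_weightFiltration {ρ : ℝ} (hwρ : ∀ k, ρ ≤ w k) (hρ : 0 ≤ ρ)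
    (x : V) {f : V → ℂ} {τ : ℝ} (hf : f ∈ B.weightFiltration w τ) :
    difference x f ∈ B.weightFiltration w (τ - ρ) := by
  refine (Submodule.span_le (p := (B.weightFiltration w (τ - ρ)).comap (difference x))).2 ?_ hf
  rintro _ ⟨β, hβ, rfl⟩
  suffices h : ∀ β, difference x (B.monomial β) ∈ B.weightFiltration w (multiWeight w β - ρ) from
    JordanBasis.weightFiltration_mono (sub_le_sub_right hβ ρ) (h β)
  intro β
  induction β using multiIndex_induction with
  | h0 =>
    have : difference x (B.monomial 0) = 0 := by
      funext v
      simp [difference, B.monomial_zero]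
    rw [this]
    exact zero_mem _
  | hs k β ih =>
    rw [add_comm β, B.monomial_add, B.monomial_single, difference_restrictForm_mul, multiWeight_add,
      multiWeight_single]
    have hk := hwρ k
    refine add_mem (add_mem ?_ ?_) ?_
    · exact Submodule.smul_mem _ _ (JordanBasis.monomial_mem_weightFiltration (by linarith))
    · rw [add_sub_assoc]
      exact JordanBasis.mul_mem_weightFiltration (JordanBasis.u_mem_weightFiltration k) ih
    · exact Submodule.smul_mem _ _ (JordanBasis.weightFiltration_mono (by linarith) ih)

theorem PolyaData.transition_eq_sum (D : PolyaData V s) (f : V → ℂ) :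
    D.transition f
      = ∑ k, restrictForm V ((D.l k).baseChange ℂ) * difference (D.w k) f := by
  funext v
  simp [PolyaData.transition, restrictForm, difference]

theorem JordanBasis.sum_l_mul_u [FiniteDimensional ℝ V] (B : JordanBasis D) (k : Fin s) :
    ∑ j, restrictForm V ((D.l j).baseChange ℂ) * (fun _ => B.u k (1 ⊗ₜ[ℝ] D.w j))
      = B.lam k • restrictForm V (B.u k) + B.eps k • restrictForm V (B.u (predIndex k)) := by
  have e : B.lam k • restrictForm V (B.u k) + B.eps k • restrictForm V (B.u (predIndex k))
      = restrictForm V (B.u k ∘ₗ D.replacementC) := by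
    rw [B.u_comp]
    simp only [map_add, map_smul]
  rw [e]
  funext v
  have h : D.replacementC (1 ⊗ₜ[ℝ] v) = ∑ j, (D.l j v) • ((1 : ℂ) ⊗ₜ[ℝ] D.w j) := by
    rw [D.replacementC_tmul, D.replacement_apply, TensorProduct.tmul_sum]
    simp only [TensorProduct.tmul_smul]
  simp only [restrictForm, LinearMap.coe_mk, AddHom.coe_mk, LinearMap.comp_apply, h, map_sum,
    Finset.sum_apply, Pi.mul_apply]
  refine Finset.sum_congr rfl fun j _ => ?_
  rw [LinearMap.map_smul_of_tower]
  simp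

/-- The first two terms are those of a derivation extending `φ ↦ φ ∘ A`; the last collects the
products of two increments, which will be of lower weight. -/
theorem JordanBasis.transition_u_mul [FiniteDimensional ℝ V] (B : JordanBasis D) (k : Fin s)
    (f : V → ℂ) :
    D.transition (restrictForm V (B.u k) * f)
      = (B.lam k • restrictForm V (B.u k) + B.eps k • restrictForm V (B.u (predIndex k))) * f
        + restrictForm V (B.u k) * D.transition f
        + ∑ j, B.u k (1 ⊗ₜ[ℝ] D.w j) •
          (restrictForm V ((D.l j).baseChange ℂ) * difference (D.w j) f) := by
  rw [D.transition_eq_sum, D.transition_eq_sum, ← B.sum_l_mul_u, Finset.sum_mul, Finset.mul_sum,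
    ← Finset.sum_add_distrib, ← Finset.sum_add_distrib]
  refine Finset.sum_congr rfl fun j _ => ?_
  rw [difference_restrictForm_mul]
  funext v
  simp only [Pi.mul_apply, Pi.add_apply, Pi.smul_apply, smul_eq_mul]
  ring

/-- Jordan links do not raise the weight. In the term with two increments, the product with `l j`
costs at most `1`, while the difference and the lost factor `u k` each give back at least `ρ`, and
`2ρ ≥ 1`. -/
theorem JordanBasis.transition_mem_weightFiltration [FiniteDimensional ℝ V] {ρ : ℝ}
    (hρ : 1 / 2 ≤ ρ) (hwρ : ∀ k, ρ ≤ w k) (hw1 : ∀ k, w k ≤ 1)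
    (hweps : ∀ k, B.eps k ≠ 0 → w (predIndex k) ≤ w k) {f : V → ℂ} {τ : ℝ}
    (hf : f ∈ B.weightFiltration w τ) : D.transition f ∈ B.weightFiltration w τ := by
  refine (Submodule.span_le (p := (B.weightFiltration w τ).comap D.transition)).2 ?_ hf
  rintro _ ⟨β, hβ, rfl⟩
  suffices h : ∀ β, D.transition (B.monomial β) ∈ B.weightFiltration w (multiWeight w β) from
    JordanBasis.weightFiltration_mono hβ (h β)
  intro β
  induction β using multiIndex_induction with
  | h0 =>
    have : D.transition (B.monomial 0) = 0 := by
      funext v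
      simp [PolyaData.transition, B.monomial_zero]
    rw [this]
    exact zero_mem _
  | hs k β ih =>
    rw [add_comm β, B.monomial_add, B.monomial_single, B.transition_u_mul, multiWeight_add,
      multiWeight_single]
    have hk := hwρ k
    have hβ := JordanBasis.monomial_mem_weightFiltration (B := B) (le_refl (multiWeight w β))
    refine add_mem (add_mem ?_ ?_) (sum_mem fun j _ => Submodule.smul_mem _ _ ?_)
    · refine JordanBasis.mul_mem_weightFiltration (add_mem ?_ ?_) hβ
      · exact Submodule.smul_mem _ _ (JordanBasis.u_mem_weightFiltration k)
      · by_cases he : B.eps k = 0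
        · rw [he, zero_smul]
          exact zero_mem _
        · exact Submodule.smul_mem _ _ (JordanBasis.weightFiltration_mono (hweps k he)
            (JordanBasis.u_mem_weightFiltration _))
    · exact JordanBasis.mul_mem_weightFiltration (JordanBasis.u_mem_weightFiltration k) ih
    · refine JordanBasis.weightFiltration_mono (?_ : 1 + (multiWeight w β - ρ) ≤ _)
        (JordanBasis.mul_mem_weightFiltration
          (JordanBasis.restrictForm_mem_weightFiltration hw1 _)
          (JordanBasis.difference_mem_weightFiltration hwρ (by linarith) _ hβ))
      linarith

theorem JordanBasis.pairing_add (B : JordanBasis D) (α β : Fin s → ℕ) :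
    B.pairing (α + β) = B.pairing α + B.pairing β := by
  simp [JordanBasis.pairing, add_mul, Finset.sum_add_distrib]

theorem JordanBasis.pairing_single (B : JordanBasis D) (k : Fin s) :
    B.pairing (Pi.single k 1) = B.lam k := by
  rw [JordanBasis.pairing, Finset.sum_eq_single k]
  · simp
  · intro i _ hi
    simp [hi]
  · simp

/-- On a product of eigenforms the derivation part acts exactly by the scalar `⟨α, λ⟩`. Only terms
with two increments remain, whose weight drops by `2ρ - 1`, a strict loss when `ρ > 1/2`. -/
theorem JordanBasis.transition_monomial_sub_mem [FiniteDimensional ℝ V] {ρ : ℝ}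
    (hρ : 1 / 2 ≤ ρ) (hwρ : ∀ k, ρ ≤ w k) (hw1 : ∀ k, w k ≤ 1) (α : Fin s → ℕ)
    (hα : ∀ k, α k ≠ 0 → B.eps k = 0) :
    D.transition (B.monomial α) - B.pairing α • B.monomial α
      ∈ B.weightFiltration w (multiWeight w α + 1 - 2 * ρ) := by
  induction α using multiIndex_induction with
  | h0 =>
    have : D.transition (B.monomial 0) - B.pairing 0 • B.monomial 0 = 0 := by
      funext v
      simp [PolyaData.transition, B.monomial_zero, JordanBasis.pairing]
    rw [this]
    exact zero_mem _
  | hs k β ih =>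
    have hk : B.eps k = 0 := hα k (by simp)
    have ih' := ih fun i hi => hα i (by
      rw [Pi.add_apply]
      omega)
    rw [add_comm β, B.monomial_add, B.monomial_single, B.transition_u_mul, multiWeight_add,
      multiWeight_single, B.pairing_add, B.pairing_single, hk]
    have hkρ := hwρ k
    have e : (B.lam k • restrictForm V (B.u k) + (0 : ℂ) • restrictForm V (B.u (predIndex k)))
          * B.monomial β + restrictForm V (B.u k) * D.transition (B.monomial β)
          + ∑ j, B.u k (1 ⊗ₜ[ℝ] D.w j) •
            (restrictForm V ((D.l j).baseChange ℂ) * difference (D.w j) (B.monomial β))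
          - (B.lam k + B.pairing β) • (restrictForm V (B.u k) * B.monomial β)
        = restrictForm V (B.u k) * (D.transition (B.monomial β) - B.pairing β • B.monomial β)
          + ∑ j, B.u k (1 ⊗ₜ[ℝ] D.w j) •
            (restrictForm V ((D.l j).baseChange ℂ) * difference (D.w j) (B.monomial β)) := by
      rw [zero_smul, add_zero, add_smul, mul_sub, smul_mul_assoc, mul_smul_comm]
      abel
    rw [e]
    refine add_mem ?_ (sum_mem fun j _ => Submodule.smul_mem _ _ ?_)
    · refine JordanBasis.weightFiltration_mono (le_of_eq ?_)
        (JordanBasis.mul_mem_weightFiltration (JordanBasis.u_mem_weightFiltration k) ih')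
      ring
    · refine JordanBasis.weightFiltration_mono (?_ : 1 + (multiWeight w β - ρ) ≤ _)
        (JordanBasis.mul_mem_weightFiltration
          (JordanBasis.restrictForm_mem_weightFiltration hw1 _)
          (JordanBasis.difference_mem_weightFiltration hwρ (by linarith) _
            (JordanBasis.monomial_mem_weightFiltration le_rfl)))
      linarith

end Filtration

/-! ### Reduced polynomials and characteristic spaces -/

section Reduced

variable {V : Type*} [AddCommGroup V] [Module ℝ V] {s : ℕ} [NeZero s] {D : PolyaData V s}

theorem le_iSup_inf_maxGenEigenspace {E : Type*} [AddCommGroup E] [Module ℂ E]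
    (T : Module.End ℂ E) (U : Submodule ℂ E) [Module.Finite ℂ U] (hU : ∀ x ∈ U, T x ∈ U) :
    U ≤ ⨆ z, U ⊓ T.maxGenEigenspace z := by
  have h1 := congrArg (Submodule.map U.subtype)
    (Module.End.iSup_maxGenEigenspace_eq_top (T.restrict hU))
  rw [Submodule.map_iSup, Submodule.map_top, Submodule.range_subtype] at h1
  conv_lhs => rw [← h1]
  refine iSup_mono fun z => ?_
  have h2 := U.inf_genEigenspace T (k := ⊤) (μ := z) hU
  change U ⊓ T.maxGenEigenspace z
    = (Module.End.maxGenEigenspace (T.restrict hU) z).map U.subtype at h2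
  rw [← h2]

/-- Distinct characteristic spaces are disjoint, so `T - ζ` is injective on this finite-dimensional
stable space, hence surjective. -/
theorem le_map_sub_inf_maxGenEigenspace {E : Type*} [AddCommGroup E] [Module ℂ E]
    (T : Module.End ℂ E) (U : Submodule ℂ E) [Module.Finite ℂ U] (hU : ∀ x ∈ U, T x ∈ U)
    {z ζ : ℂ} (hz : z ≠ ζ) :
    U ⊓ T.maxGenEigenspace z
      ≤ (U ⊓ T.maxGenEigenspace z).map (T - algebraMap ℂ (Module.End ℂ E) ζ) := by
  set S := U ⊓ T.maxGenEigenspace z with hS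
  set N := T - algebraMap ℂ (Module.End ℂ E) ζ with hN
  have hfin : Module.Finite ℂ S := Submodule.finiteDimensional_of_le (inf_le_left : S ≤ U)
  have hTS : ∀ x ∈ S, T x ∈ S := fun x hx => ⟨hU x hx.1,
    Module.End.mapsTo_maxGenEigenspace_of_comm (Commute.refl T) z hx.2⟩
  have hNS : ∀ x ∈ S, N x ∈ S := fun x hx => by
    simp only [hN, LinearMap.sub_apply, Module.algebraMap_end_apply]
    exact sub_mem (hTS x hx) (Submodule.smul_mem _ _ hx)
  have hinj : Function.Injective (N.restrict hNS) := by
    rw [← LinearMap.ker_eq_bot, LinearMap.ker_eq_bot']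
    rintro ⟨x, hx⟩ h
    have h' : N x = 0 := congrArg Subtype.val h
    have hx2 : x ∈ T.maxGenEigenspace ζ := by
      rw [Module.End.mem_maxGenEigenspace]
      refine ⟨1, ?_⟩
      rw [pow_one]
      exact h'
    have hd := (T.independent_maxGenEigenspace).pairwiseDisjoint hz
    exact Subtype.ext (Submodule.disjoint_def.1 hd x hx.2 hx2)
  intro y hy
  obtain ⟨⟨x, hx⟩, hxy⟩ := LinearMap.surjective_of_injective hinj ⟨y, hy⟩
  exact ⟨x, hx, congrArg Subtype.val hxy⟩

/-- Split `T x - ζ x` along the characteristic spaces of `U`. The components away from `ζ` are `(T -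
ζ) f` with `f` in their sum; subtracting `f` from `x` leaves only the component at `ζ`. -/
theorem exists_sub_mem_maxGenEigenspace {E : Type*} [AddCommGroup E] [Module ℂ E]
    (T : Module.End ℂ E) (U : Submodule ℂ E) [Module.Finite ℂ U] (hU : ∀ x ∈ U, T x ∈ U) (ζ : ℂ)
    {x : E} (hx : T x - ζ • x ∈ U) :
    ∃ f ∈ U, f ∈ (⨆ z ≠ ζ, U ⊓ T.maxGenEigenspace z) ∧
      T (x - f) - ζ • (x - f) ∈ U ⊓ T.maxGenEigenspace ζ ∧ x - f ∈ T.maxGenEigenspace ζ := by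
  have hNa : ∀ f, (T - algebraMap ℂ (Module.End ℂ E) ζ) f = T f - ζ • f := fun f => by
    rw [LinearMap.sub_apply, Module.algebraMap_end_apply]
  have h1 : T x - ζ • x ∈ (U ⊓ T.maxGenEigenspace ζ)
      ⊔ ⨆ z ≠ ζ, U ⊓ T.maxGenEigenspace z := by
    refine (iSup_le fun z => ?_ : ⨆ z, U ⊓ T.maxGenEigenspace z ≤ _)
      (le_iSup_inf_maxGenEigenspace T U hU hx)
    by_cases hz : z = ζ
    · subst hz
      exact le_sup_left
    · exact le_trans (le_iSup₂ (f := fun z (_ : z ≠ ζ) => U ⊓ T.maxGenEigenspace z) z hz)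
        le_sup_right
  obtain ⟨a, ha, b, hb, hab⟩ := Submodule.mem_sup.1 h1
  have hle : (⨆ z ≠ ζ, U ⊓ T.maxGenEigenspace z)
      ≤ (⨆ z ≠ ζ, U ⊓ T.maxGenEigenspace z).map (T - algebraMap ℂ (Module.End ℂ E) ζ) :=
    iSup₂_le fun z hz => (le_map_sub_inf_maxGenEigenspace T U hU hz).trans
      (Submodule.map_mono (le_iSup₂ (f := fun z (_ : z ≠ ζ) => U ⊓ T.maxGenEigenspace z) z hz))
  obtain ⟨f, hf, hfb⟩ := hle hb
  have hNQ : (T - algebraMap ℂ (Module.End ℂ E) ζ) (x - f) = a := by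
    rw [map_sub, hfb, hNa, ← hab, add_sub_cancel_right]
  refine ⟨f, (iSup₂_le fun z _ => inf_le_left : ⨆ z ≠ ζ, U ⊓ T.maxGenEigenspace z ≤ U) hf, hf,
    by rwa [← hNa, hNQ], ?_⟩
  obtain ⟨k, hk⟩ := (Module.End.mem_maxGenEigenspace _ _ _).1 ha.2
  refine (Module.End.mem_maxGenEigenspace _ _ _).2 ⟨k + 1, ?_⟩
  rw [pow_succ, Module.End.mul_apply]
  change ((T - algebraMap ℂ (Module.End ℂ E) ζ) ^ k)
    ((T - algebraMap ℂ (Module.End ℂ E) ζ) (x - f)) = 0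
  rw [hNQ]
  exact hk

/-- If `Φ u^α - ⟨α, λ⟩ u^α` lies in a finite-dimensional stable subspace `U` of `S(V)`, then so do
`u^α - Q_α` and `Φ Q_α - ⟨α, λ⟩ Q_α`. -/
theorem JordanBasis.reduced_of_stable [FiniteDimensional ℝ V] (B : JordanBasis D) (α : Fin s → ℕ)
    (U : Submodule ℂ (V → ℂ)) [Module.Finite ℂ U] (hUp : U ≤ polyFunctions V)
    (hU : ∀ f ∈ U, D.transition f ∈ U)
    (h : D.transition (B.monomial α) - B.pairing α • B.monomial α ∈ U) :
    B.monomial α - B.reduced α ∈ U ∧ D.transition (B.reduced α) - B.pairing α • B.reduced α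
      ∈ U ⊓ D.transition.maxGenEigenspace (B.pairing α) := by
  obtain ⟨f, hfU, hf, hN, hgen⟩ :=
    exists_sub_mem_maxGenEigenspace D.transition U hU (B.pairing α) h
  have hproj : D.IsCharProjection (B.pairing α) (B.monomial α) (B.monomial α - f) := by
    refine ⟨⟨sub_mem (B.monomial_mem α) (hUp hfU), hgen⟩, ?_⟩
    rw [sub_sub_cancel]
    exact iSup₂_mono (fun z _ => inf_le_inf_right _ hUp) hf
  have hQ : B.reduced α = B.monomial α - f :=
    (D.existsUnique_charProjection (B.pairing α) (B.monomial_mem α)).unique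
      (B.reduced_spec α) hproj
  rw [hQ, sub_sub_cancel]
  exact ⟨hfU, hN⟩

end Reduced

/-! ### Products and integrals of `L^p` limits -/

section Approx

variable {Ω : Type*} {mΩ : MeasurableSpace Ω} {μ : Measure Ω} [IsProbabilityMeasure μ]

/-- The sequence `f` converges to `Z` in every `L^p`, at the rate `n ^ a`. -/
structure LpApprox (μ : Measure Ω) (f : ℕ → Ω → ℂ) (Z : Ω → ℂ) (a : ℝ) : Prop where
  aesm : ∀ n, AEStronglyMeasurable (f n) μ
  memLp : ∀ p : ℕ, p ≠ 0 → MemLp Z p μ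
  growth_sub : HasLpGrowth μ (fun n ω => f n ω - Z ω) a

variable {f g : ℕ → Ω → ℂ} {Z Z' : Ω → ℂ} {a : ℝ}

theorem LpApprox.aesm_limit (h : LpApprox μ f Z a) : AEStronglyMeasurable Z μ :=
  (h.memLp 1 one_ne_zero).1

theorem LpApprox.growth_left (h : LpApprox μ f Z a) (ha : a ≤ 0) : HasLpGrowth μ f 0 := by
  have := (h.growth_sub.mono ha).add (hasLpGrowth_of_memLp h.memLp)
    (fun n => (h.aesm n).sub h.aesm_limit) (fun _ => h.aesm_limit)
  simpa using this

theorem LpApprox.mul (h : LpApprox μ f Z a) (h' : LpApprox μ g Z' a) (ha : a ≤ 0) :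
    LpApprox μ (fun n ω => f n ω * g n ω) (fun ω => Z ω * Z' ω) a := by
  refine ⟨fun n => (h.aesm n).mul (h'.aesm n), fun p hp => ?_, ?_⟩
  · refine ⟨h.aesm_limit.mul h'.aesm_limit, ?_⟩
    exact (eLpNorm_mul_le h.aesm_limit h'.aesm_limit p).trans_lt (ENNReal.mul_lt_top
      (h.memLp (2 * p) (by omega)).2 (h'.memLp (2 * p) (by omega)).2)
  · have h1 := h.growth_sub.mul (h'.growth_left ha) (fun n => (h.aesm n).sub h.aesm_limit) h'.aesm
    have h2 := (hasLpGrowth_of_memLp h.memLp).mul h'.growth_sub (fun _ => h.aesm_limit)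
      (fun n => (h'.aesm n).sub h'.aesm_limit)
    rw [add_zero] at h1
    rw [zero_add] at h2
    have h3 := h1.add h2 (fun n => ((h.aesm n).sub h.aesm_limit).mul (h'.aesm n))
      (fun n => h.aesm_limit.mul ((h'.aesm n).sub h'.aesm_limit))
    convert h3 using 3
    ring

theorem lpApprox_one : LpApprox μ (fun _ _ => 1) (fun _ => 1) a := by
  refine ⟨fun _ => aestronglyMeasurable_const, fun p _ => memLp_const _, ?_⟩
  simp only [sub_self]
  exact hasLpGrowth_of_bound le_rfl fun n => by simp

theorem LpApprox.pow (h : LpApprox μ f Z a) (ha : a ≤ 0) (m : ℕ) :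
    LpApprox μ (fun n ω => f n ω ^ m) (fun ω => Z ω ^ m) a := by
  induction m with
  | zero => simpa using lpApprox_one
  | succ m ih =>
    simp only [pow_succ]
    exact ih.mul h ha

theorem LpApprox.prod {ι : Type*} (S : Finset ι) {f : ι → ℕ → Ω → ℂ} {Z : ι → Ω → ℂ}
    (h : ∀ i ∈ S, LpApprox μ (f i) (Z i) a) (ha : a ≤ 0) :
    LpApprox μ (fun n ω => ∏ i ∈ S, f i n ω) (fun ω => ∏ i ∈ S, Z i ω) a := by
  classical
  induction S using Finset.induction_on with
  | empty => simpa using lpApprox_one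
  | insert i S hi ih =>
    simp only [Finset.prod_insert hi]
    exact (h i (Finset.mem_insert_self i S)).mul
      (ih fun j hj => h j (Finset.mem_insert_of_mem hj)) ha

theorem tendsto_add_one_rpow_neg (ha : a < 0) :
    Tendsto (fun n : ℕ => ((n : ℝ) + 1) ^ a) atTop (𝓝 0) := by
  have h1 := (tendsto_rpow_neg_atTop (neg_pos.2 ha)).comp
    (tendsto_atTop_add_const_right atTop (1 : ℝ) tendsto_natCast_atTop_atTop)
  simpa [Function.comp_def] using h1

theorem LpApprox.integrable_limit (h : LpApprox μ f Z a) : Integrable Z μ :=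
  memLp_one_iff_integrable.1 (by simpa using h.memLp 1 one_ne_zero)

theorem LpApprox.tendsto_integral (h : LpApprox μ f Z a) (ha : a < 0) :
    Tendsto (fun n => ∫ ω, f n ω ∂μ) atTop (𝓝 (∫ ω, Z ω ∂μ)) := by
  have hf : ∀ n, Integrable (f n) μ := fun n => by
    obtain ⟨C, -, hC⟩ := h.growth_left ha.le 1 one_ne_zero
    exact memLp_one_iff_integrable.1 ⟨h.aesm n, by
      simpa using (hC n).trans_lt ENNReal.ofReal_lt_top⟩
  obtain ⟨C, hC, hb⟩ := h.growth_sub.exists_norm_integral_le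
  rw [tendsto_iff_norm_sub_tendsto_zero]
  refine squeeze_zero (fun _ => norm_nonneg _) (fun n => ?_)
    (by simpa using (tendsto_add_one_rpow_neg ha).const_mul C)
  rw [← integral_sub (hf n) h.integrable_limit]
  exact hb n

end Approx

/-! ### Expectations along the process -/

section Expectation

variable {V : Type*} [AddCommGroup V] [Module ℝ V] [MeasurableSpace V]
  [MeasurableSingletonClass V] {s : ℕ} {D : PolyaData V s}
  {Ω : Type*} {mΩ : MeasurableSpace Ω} {μ : Measure Ω} [IsProbabilityMeasure μ] {X : ℕ → Ω → V}

theorem IsPolyaProcess.integrable (hX : IsPolyaProcess D μ X) (n : ℕ) (f : V → ℂ) :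
    Integrable (fun ω => f (X (n + 1) ω)) μ :=
  hX.integrable₂ n n fun _ y => f y

theorem IsPolyaProcess.integral_zero (hX : IsPolyaProcess D μ X) (f : V → ℂ) :
    ∫ ω, f (X (0 + 1) ω) ∂μ = f D.x₁ := by
  rw [integral_congr_ae (g := fun _ => f D.x₁)]
  · simp
  · filter_upwards [hX.init] with ω h
    rw [zero_add, h]

theorem IsPolyaProcess.integral_succ (hX : IsPolyaProcess D μ X) (n : ℕ) (f : V → ℂ) :
    ∫ ω, f (X (n + 2) ω) ∂μ = ∫ ω, f (X (n + 1) ω) ∂μ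
      + (∫ ω, D.transition f (X (n + 1) ω) ∂μ) / ((n + D.tau1 : ℝ) : ℂ) := by
  rw [hX.integral_step (le_refl n) fun _ y => f y, ← integral_div,
    ← integral_add (hX.integrable n f) ((hX.integrable n _).div_const _)]
  refine integral_congr_ae ?_
  filter_upwards [hX.mem_reach n] with ω hω
  set v := X (n + 1) ω
  have h1 : D.transition f v / ((n + D.tau1 : ℝ) : ℂ)
      = ∑ k, D.prob n k v • (f (v + D.w k) - f v) := by
    simp only [PolyaData.transition, LinearMap.coe_mk, AddHom.coe_mk]
    rw [Finset.sum_div]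
    refine Finset.sum_congr rfl fun k _ => ?_
    rw [PolyaData.prob, Complex.real_smul, Complex.ofReal_div]
    ring
  rw [h1]
  simp only [smul_sub, Finset.sum_sub_distrib, ← Finset.sum_smul, D.sum_prob hω, one_smul]
  ring

/-- An approximate eigenfunction: if `Φ f - ζ f` has zero expectation along the process, the
expectation of `f` is a multiple of the growth sequence. -/
theorem IsPolyaProcess.integral_eq_growth (hX : IsPolyaProcess D μ X) {f : V → ℂ} {ζ : ℂ}
    (h : ∀ n, ∫ ω, (D.transition f - ζ • f) (X (n + 1) ω) ∂μ = 0) (n : ℕ) :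
    ∫ ω, f (X (n + 1) ω) ∂μ = growth D.tau1 ζ n * f D.x₁ := by
  induction n with
  | zero => rw [hX.integral_zero, growth_zero, one_mul]
  | succ n ih =>
    have h1 : ∫ ω, D.transition f (X (n + 1) ω) ∂μ = ζ * ∫ ω, f (X (n + 1) ω) ∂μ := by
      have h2 := h n
      simp only [Pi.sub_apply, Pi.smul_apply, smul_eq_mul] at h2
      rw [integral_sub (hX.integrable n _) ((hX.integrable n f).const_mul ζ),
        integral_const_mul] at h2
      exact sub_eq_zero.1 h2
    rw [hX.integral_succ, h1, ih, growth_succ]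
    ring

/-- Functions of slow growth in the characteristic space of `ζ` have zero expectation along the
process. -/
theorem IsPolyaProcess.integral_eq_zero_of_mem (hX : IsPolyaProcess D μ X)
    (U : Submodule ℂ (V → ℂ)) (hU : ∀ f ∈ U, D.transition f ∈ U) {τ : ℝ} {ζ : ℂ}
    (hζ : 0 ≤ ζ.re) (hτζ : τ < ζ.re)
    (hgrowth : ∀ f ∈ U, ∃ C : ℝ, ∀ n, ‖∫ ω, f (X (n + 1) ω) ∂μ‖ ≤ C * ((n : ℝ) + 1) ^ τ)
    {f : V → ℂ} (hf : f ∈ U ⊓ D.transition.maxGenEigenspace ζ) (n : ℕ) :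
    ∫ ω, f (X (n + 1) ω) ∂μ = 0 := by
  obtain ⟨hfU, hfg⟩ := hf
  obtain ⟨m, hm⟩ := (Module.End.mem_maxGenEigenspace _ _ _).1 hfg
  clear hfg
  induction m generalizing f n with
  | zero =>
    have h0 : f = 0 := hm
    simp [h0]
  | succ m ih =>
    -- Induction on the nilpotency order: `(Φ - ζ) f` has zero mean, so the mean of `f` is exactly
    -- `growth * f(X₁)`.
    have h1 : ∀ n, ∫ ω, (D.transition f - ζ • f) (X (n + 1) ω) ∂μ = 0 := by
      refine fun n => ih n (sub_mem (hU f hfU) (Submodule.smul_mem _ _ hfU)) ?_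
      rw [pow_succ, Module.End.mul_apply] at hm
      exact hm
    have h2 := hX.integral_eq_growth h1
    obtain ⟨C, hC⟩ := hgrowth f hfU
    obtain ⟨c, _, hc, _, hcb⟩ := exists_bounds_growth D.tau1_pos hζ
    -- The growth product has order `n ^ Re ζ`, yet the mean is `O(n ^ τ)` with `τ < Re ζ`; this
    -- forces `f(X₁) = 0`.
    have h3 : ∀ n : ℕ, ‖f D.x₁‖ ≤ c⁻¹ * C * ((n : ℝ) + 1) ^ (τ - ζ.re) := fun n => by
      have h4 := hC n
      rw [h2 n, norm_mul] at h4
      have h5 := (mul_le_mul_of_nonneg_right (hcb n).1 (norm_nonneg (f D.x₁))).trans h4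
      have hp : 0 < ((n : ℝ) + 1) ^ ζ.re := by positivity
      rw [Real.rpow_sub (by positivity)]
      have e : c⁻¹ * C * (((n : ℝ) + 1) ^ τ / ((n : ℝ) + 1) ^ ζ.re)
          = C * ((n : ℝ) + 1) ^ τ / (c * ((n : ℝ) + 1) ^ ζ.re) := by
        field_simp
      rw [e, le_div_iff₀ (by positivity), mul_comm]
      exact h5
    have ht : Tendsto (fun n : ℕ => c⁻¹ * C * ((n : ℝ) + 1) ^ (τ - ζ.re)) atTop (𝓝 0) := by
      simpa using (tendsto_add_one_rpow_neg (sub_neg.2 hτζ)).const_mul (c⁻¹ * C)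
    have h6 : ‖f D.x₁‖ ≤ 0 := ge_of_tendsto' ht h3
    rw [h2 n, norm_le_zero_iff.1 h6, mul_zero]

end Expectation

/-! ### Expectations of monomials in the eigenforms -/

section MonomialGrowth

variable {V : Type*} [AddCommGroup V] [Module ℝ V] [FiniteDimensional ℝ V] [MeasurableSpace V]
  [MeasurableSingletonClass V] {s : ℕ} [NeZero s] {D : PolyaData V s}
  {Ω : Type*} {mΩ : MeasurableSpace Ω} {μ : Measure Ω} [IsProbabilityMeasure μ] {X : ℕ → Ω → V}
  {B : JordanBasis D} {w : Fin s → ℝ}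

theorem IsPolyaProcess.hasLpGrowth_of_mem (hX : IsPolyaProcess D μ X)
    (hw : ∀ k, HasLpGrowth μ (fun n ω => B.u k (1 ⊗ₜ[ℝ] X (n + 1) ω)) (w k))
    {f : V → ℂ} {τ : ℝ} (hf : f ∈ B.weightFiltration w τ) :
    HasLpGrowth μ (fun n ω => f (X (n + 1) ω)) τ := by
  have hmon : ∀ β, HasLpGrowth μ (fun n ω => B.monomial β (X (n + 1) ω)) (multiWeight w β) := by
    intro β
    induction β using multiIndex_induction with
    | h0 =>
      have e : multiWeight w 0 = 0 := by simp [multiWeight]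
      rw [B.monomial_zero, e]
      exact hasLpGrowth_const 1
    | hs k β ih =>
      rw [add_comm β, B.monomial_add, B.monomial_single, multiWeight_add, multiWeight_single]
      exact (hw k).mul ih (fun n => hX.aestronglyMeasurable n fun v => B.u k (1 ⊗ₜ[ℝ] v))
        (fun n => hX.aestronglyMeasurable n _)
  induction hf using Submodule.span_induction with
  | mem f hf =>
    obtain ⟨β, hβ, rfl⟩ := hf
    exact (hmon β).mono hβ
  | zero => exact hasLpGrowth_of_bound le_rfl fun n => by simp
  | add f g _ _ hf hg =>
    exact hf.add hg (fun n => hX.aestronglyMeasurable n _) (fun n => hX.aestronglyMeasurable n _)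
  | smul c f _ hf => exact hf.const_mul (fun n => hX.aestronglyMeasurable n _) c

/-- Asymptotics of the expectation of a monomial in eigenforms. -/
theorem IsPolyaProcess.tendsto_integral_monomial (hX : IsPolyaProcess D μ X) {ρ : ℝ}
    (hρ : 1 / 2 < ρ) (hwρ : ∀ k, ρ ≤ w k) (hw1 : ∀ k, w k ≤ 1)
    (hweps : ∀ k, B.eps k ≠ 0 → w (predIndex k) ≤ w k)
    (hw : ∀ k, HasLpGrowth μ (fun n ω => B.u k (1 ⊗ₜ[ℝ] X (n + 1) ω)) (w k))
    (α : Fin s → ℕ) (hα : ∀ k, α k ≠ 0 → B.eps k = 0 ∧ (B.lam k).re = w k) :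
    Tendsto (fun n => (∫ ω, B.monomial α (X (n + 1) ω) ∂μ) / growth D.tau1 (B.pairing α) n) atTop
      (𝓝 (B.reduced α D.x₁)) := by
  have hre : (B.pairing α).re = multiWeight w α := by
    simp only [JordanBasis.pairing, multiWeight, Complex.re_sum]
    refine Finset.sum_congr rfl fun k _ => ?_
    by_cases hk : α k = 0
    · simp [hk]
    · simp [(hα k hk).2]
  have hre0 : 0 ≤ (B.pairing α).re := by
    rw [hre]
    exact Finset.sum_nonneg fun k _ => mul_nonneg (Nat.cast_nonneg _) (by linarith [hwρ k])
  set τ := multiWeight w α + 1 - 2 * ρ with hτ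
  have hτζ : τ < (B.pairing α).re := by
    rw [hre, hτ]
    linarith
  have hfin := JordanBasis.finite_weightFiltration (B := B) (by linarith) hwρ τ
  have hU : ∀ f ∈ B.weightFiltration w τ, D.transition f ∈ B.weightFiltration w τ :=
    fun f hf => JordanBasis.transition_mem_weightFiltration hρ.le hwρ hw1 hweps hf
  obtain ⟨h1, h2⟩ := B.reduced_of_stable α (B.weightFiltration w τ)
    (JordanBasis.weightFiltration_le_polyFunctions τ) hU
    (JordanBasis.transition_monomial_sub_mem hρ.le hwρ hw1 α fun k hk => (hα k hk).1)
  -- The defect of `Q_α` from being an eigenfunction has zero mean at every time, so the mean of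
  -- `Q_α` is known exactly.
  have h3 := hX.integral_eq_growth (hX.integral_eq_zero_of_mem (B.weightFiltration w τ) hU hre0 hτζ
    (fun f hf => by
      obtain ⟨C, -, hC⟩ := (hX.hasLpGrowth_of_mem hw hf).exists_norm_integral_le
      exact ⟨C, hC⟩) h2)
  obtain ⟨C, hC, hCb⟩ := (hX.hasLpGrowth_of_mem hw h1).exists_norm_integral_le
  obtain ⟨c, _, hc, _, hcb⟩ := exists_bounds_growth D.tau1_pos hre0
  rw [tendsto_iff_norm_sub_tendsto_zero]
  refine squeeze_zero (fun _ => norm_nonneg _) (fun n => ?_)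
    (by simpa using (tendsto_add_one_rpow_neg (sub_neg.2 hτζ)).const_mul (C * c⁻¹))
  have hg := growth_ne_zero D.tau1_pos hre0 n
  have h4 : (∫ ω, B.monomial α (X (n + 1) ω) ∂μ) / growth D.tau1 (B.pairing α) n
      - B.reduced α D.x₁ = (∫ ω, (B.monomial α - B.reduced α) (X (n + 1) ω) ∂μ)
        / growth D.tau1 (B.pairing α) n := by
    simp only [Pi.sub_apply]
    rw [integral_sub (hX.integrable n _) (hX.integrable n _), h3 n]
    field_simp
  rw [h4, norm_div, div_le_iff₀ (norm_pos_iff.2 hg)]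
  refine (hCb n).trans ?_
  have h5 := (hcb n).1
  have hp : 0 < ((n : ℝ) + 1) ^ (B.pairing α).re := by positivity
  calc C * ((n : ℝ) + 1) ^ τ
      = C * c⁻¹ * ((n : ℝ) + 1) ^ (τ - (B.pairing α).re)
        * (c * ((n : ℝ) + 1) ^ (B.pairing α).re) := by
        rw [Real.rpow_sub (by positivity) τ (B.pairing α).re]
        field_simp
    _ ≤ _ := by gcongr

end MonomialGrowth

/-! ### Sequences negligible almost surely and in `L^p` -/

section Small

variable {Ω : Type*} {mΩ : MeasurableSpace Ω} {μ : Measure Ω} [IsProbabilityMeasure μ]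

/-- The sequence `f` is `o(n ^ σ)`, almost surely and in every `L^p`. -/
structure IsSmall (μ : Measure Ω) (f : ℕ → Ω → ℂ) (σ : ℝ) : Prop where
  aesm : ∀ n, AEStronglyMeasurable (f n) μ
  ae_tendsto : ∀ᵐ ω ∂μ, Tendsto (fun n : ℕ => ‖f n ω‖ / ((n : ℝ) + 1) ^ σ) atTop (𝓝 0)
  tendsto_eLpNorm : ∀ p : ℕ, p ≠ 0 → Tendsto (fun n : ℕ => eLpNorm (f n) p μ
    / ENNReal.ofReal (((n : ℝ) + 1) ^ σ)) atTop (𝓝 0)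

variable {f g : ℕ → Ω → ℂ} {σ a : ℝ}

theorem IsSmall.add (hf : IsSmall μ f σ) (hg : IsSmall μ g σ) :
    IsSmall μ (fun n ω => f n ω + g n ω) σ := by
  refine ⟨fun n => (hf.aesm n).add (hg.aesm n), ?_, fun p hp => ?_⟩
  · filter_upwards [hf.ae_tendsto, hg.ae_tendsto] with ω h1 h2
    refine squeeze_zero (fun n => by positivity) (fun n => ?_) (by simpa using h1.add h2)
    rw [← add_div]
    exact div_le_div_of_nonneg_right (norm_add_le _ _) (by positivity)
  · refine tendsto_of_tendsto_of_tendsto_of_le_of_le tendsto_const_nhds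
      (by simpa using (hf.tendsto_eLpNorm p hp).add (hg.tendsto_eLpNorm p hp))
      (fun n => zero_le) (fun n => ?_)
    simp only
    rw [← ENNReal.add_div]
    exact ENNReal.div_le_div_right (eLpNorm_add_le (hf.aesm n) (hg.aesm n)
      (by exact_mod_cast Nat.one_le_iff_ne_zero.2 hp)) _

theorem HasLpGrowth.isSmall (hf : HasLpGrowth μ f a) (ha : a < σ)
    (mf : ∀ n, AEStronglyMeasurable (f n) μ) : IsSmall μ f σ := by
  refine ⟨mf, ?_, fun p hp => ?_⟩
  · have h1 : HasLpGrowth μ (fun (n : ℕ) (_ : Ω) => ((((n : ℝ) + 1) ^ (-σ) : ℝ) : ℂ)) (-σ) :=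
      hasLpGrowth_of_bound zero_le_one fun n => Eventually.of_forall fun ω => by
        rw [Complex.norm_of_nonneg (by positivity), one_mul]
    have h2 := hf.mul h1 mf (fun _ => aestronglyMeasurable_const)
    filter_upwards [h2.ae_tendsto_zero (by linarith) (fun n => (mf n).mul_const _)] with ω h
    have h3 := h.norm
    rw [norm_zero] at h3
    refine h3.congr fun n => ?_
    rw [norm_mul, Complex.norm_of_nonneg (by positivity), Real.rpow_neg (by positivity),
      div_eq_mul_inv]
  · obtain ⟨C, hC, h⟩ := hf p hp
    have h1 : Tendsto (fun n : ℕ => ENNReal.ofReal (C * ((n : ℝ) + 1) ^ (a - σ))) atTop (𝓝 0) := by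
      rw [← ENNReal.ofReal_zero]
      refine ENNReal.tendsto_ofReal ?_
      simpa using (tendsto_add_one_rpow_neg (sub_neg.2 ha)).const_mul C
    refine tendsto_of_tendsto_of_tendsto_of_le_of_le tendsto_const_nhds h1
      (fun n => zero_le) (fun n => ?_)
    simp only
    refine (ENNReal.div_le_div_right (h n) _).trans (le_of_eq ?_)
    rw [← ENNReal.ofReal_div_of_pos (by positivity), Real.rpow_sub (by positivity), mul_div_assoc]

theorem isSmall_mul_of_tendsto {c : ℕ → ℂ} {Z : Ω → ℂ} (hZ : ∀ p : ℕ, p ≠ 0 → MemLp Z p μ)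
    (hc : Tendsto (fun n : ℕ => ‖c n‖ / ((n : ℝ) + 1) ^ σ) atTop (𝓝 0)) :
    IsSmall μ (fun n ω => c n * Z ω) σ := by
  refine ⟨fun n => (hZ 1 one_ne_zero).1.const_mul _, Eventually.of_forall fun ω => ?_,
    fun p hp => ?_⟩
  · have h := hc.mul_const ‖Z ω‖
    rw [zero_mul] at h
    refine h.congr fun n => ?_
    rw [norm_mul]
    ring
  · have h1 : Tendsto (fun n : ℕ => ENNReal.ofReal (‖c n‖ / ((n : ℝ) + 1) ^ σ)) atTop (𝓝 0) := by
      rw [← ENNReal.ofReal_zero]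
      exact ENNReal.tendsto_ofReal hc
    have h2 := ENNReal.Tendsto.mul_const h1 (Or.inr (hZ p hp).eLpNorm_ne_top)
    rw [zero_mul] at h2
    refine h2.congr fun n => ?_
    have e : eLpNorm (fun ω => c n * Z ω) p μ = ‖c n‖ₑ * eLpNorm Z p μ :=
      eLpNorm_const_smul (c n) Z p μ
    rw [e, ENNReal.ofReal_div_of_pos (by positivity), ofReal_norm]
    simp only [div_eq_mul_inv]
    ring

end Small

/-! ### The expansion read on coordinates, and its uniqueness -/

section Expansion

variable {V : Type*} [AddCommGroup V] [Module ℝ V] [FiniteDimensional ℝ V] {s : ℕ} [NeZero s]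
  {D : PolyaData V s} {Ω : Type*} {mΩ : MeasurableSpace Ω} {μ : Measure Ω}
  [IsProbabilityMeasure μ] {X : ℕ → Ω → V} {B : JordanBasis D} {r : ℕ} {W : Fin s → Ω → ℂ}

theorem JordanBasis.u_remainder (B : JordanBasis D) (r : ℕ) (X : ℕ → Ω → V) (W : Fin s → Ω → ℂ)
    (n : ℕ) (ω : Ω) (k : Fin s) :
    B.u k (B.remainder r X W n ω) = B.u k (1 ⊗ₜ[ℝ] X n ω) - (if k = 0 then (n : ℂ) else 0)
      - if k ∈ secondIndices s r then (n : ℂ) ^ B.lam k * W k ω else 0 := by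
  simp only [JordanBasis.remainder, map_sub, map_smul, map_sum, B.u_v, smul_eq_mul, mul_ite,
    mul_one, mul_zero]
  rw [Finset.sum_ite_eq]

/-- Any seminorm is dominated by the `‖u k x‖` with coefficients `N (v k)`. A finite exponent is
replaced by a larger integer one, as the measure is a probability. -/
theorem JordanBasis.hasExpansion_of_isSmall
    (h : ∀ k, IsSmall μ (fun n ω => B.u k (B.remainder r X W (n + 1) ω)) D.sigma2) :
    B.HasExpansion r μ X W := by
  have hN : ∀ (N : Seminorm ℂ (ℂ ⊗[ℝ] V)) (x : ℂ ⊗[ℝ] V), N x ≤ ∑ k, ‖B.u k x‖ * N (B.v k) := by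
    intro N x
    conv_lhs => rw [← B.sum_u_smul_v x]
    refine (Finset.le_sum_of_subadditive N (map_zero N).le (map_add_le_add N) _ _).trans ?_
    exact Finset.sum_le_sum fun k _ => (map_smul_eq_mul N _ _).le
  refine ⟨?_, fun p hp1 hp N => ?_⟩
  · filter_upwards [ae_all_iff.2 fun k => (h k).ae_tendsto] with ω hω N
    refine isLittleO_of_tendsto' ?_ ?_
    · filter_upwards [eventually_gt_atTop 0] with n hn h0
      exact absurd h0 (Real.rpow_pos_of_pos (by exact_mod_cast hn) _).ne'
    · rw [← tendsto_add_atTop_iff_nat 1]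
      have h1 := tendsto_finsetSum Finset.univ fun k _ => (hω k).mul_const (N (B.v k))
      simp only [zero_mul, Finset.sum_const_zero] at h1
      refine squeeze_zero (fun n => by positivity) (fun n => ?_) h1
      push_cast
      rw [div_le_iff₀ (by positivity), Finset.sum_mul]
      refine (hN N _).trans (le_of_eq (Finset.sum_congr rfl fun k _ => ?_))
      field_simp
  · rw [← tendsto_add_atTop_iff_nat 1]
    obtain ⟨P, hP⟩ := exists_nat_ge p.toReal
    have hpP : p ≤ (P : ℝ≥0∞) := by
      rw [← ENNReal.ofReal_toReal hp, ← ENNReal.ofReal_natCast]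
      exact ENNReal.ofReal_le_ofReal hP
    have hP1 : (1 : ℝ≥0∞) ≤ P := hp1.trans hpP
    have hP0 : P ≠ 0 := by
      rintro rfl
      simp at hP1
    have h1 := tendsto_finsetSum Finset.univ fun k _ => ENNReal.Tendsto.mul_const
      ((h k).tendsto_eLpNorm P hP0) (Or.inr (ENNReal.ofReal_ne_top (r := N (B.v k))))
    simp only [zero_mul, Finset.sum_const_zero] at h1
    refine tendsto_of_tendsto_of_tendsto_of_le_of_le tendsto_const_nhds h1
      (fun n => zero_le) (fun n => ?_)
    simp only
    have hm : ∀ k, AEStronglyMeasurable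
        (fun ω => ‖B.u k (B.remainder r X W (n + 1) ω)‖ * N (B.v k)) μ :=
      fun k => ((h k).aesm n).norm.mul_const _
    have h2 : eLpNorm (fun ω => N (B.remainder r X W (n + 1) ω)) p μ
        ≤ ∑ k, eLpNorm (fun ω => B.u k (B.remainder r X W (n + 1) ω)) P μ
          * ENNReal.ofReal (N (B.v k)) := by
      calc eLpNorm (fun ω => N (B.remainder r X W (n + 1) ω)) p μ
          ≤ eLpNorm (fun ω => ∑ k, ‖B.u k (B.remainder r X W (n + 1) ω)‖ * N (B.v k)) p μ := by
            refine eLpNorm_mono_real fun ω => ?_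
            rw [Real.norm_of_nonneg (apply_nonneg N _)]
            exact hN N _
        _ ≤ eLpNorm (fun ω => ∑ k, ‖B.u k (B.remainder r X W (n + 1) ω)‖ * N (B.v k)) P μ :=
            eLpNorm_le_eLpNorm_of_exponent_le hpP
              (Finset.aestronglyMeasurable_fun_sum _ fun k _ => hm k)
        _ ≤ ∑ k, eLpNorm (fun ω => ‖B.u k (B.remainder r X W (n + 1) ω)‖ * N (B.v k)) P μ := by
            have e : (fun ω => ∑ k, ‖B.u k (B.remainder r X W (n + 1) ω)‖ * N (B.v k))
                = ∑ k, fun ω => ‖B.u k (B.remainder r X W (n + 1) ω)‖ * N (B.v k) := by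
              funext ω
              simp
            rw [e]
            exact eLpNorm_sum_le (fun k _ => hm k) hP1
        _ ≤ _ := by
            refine Finset.sum_le_sum fun k _ => le_of_eq ?_
            have e : (fun ω => ‖B.u k (B.remainder r X W (n + 1) ω)‖ * N (B.v k))
                = N (B.v k) • fun ω => ‖B.u k (B.remainder r X W (n + 1) ω)‖ := by
              funext ω
              simp [mul_comm]
            rw [e, eLpNorm_const_smul, eLpNorm_norm, mul_comm,
              Real.enorm_of_nonneg (apply_nonneg N _)]
    refine (ENNReal.div_le_div_right h2 _).trans (le_of_eq ?_)
    push_cast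
    simp only [div_eq_mul_inv]
    rw [Finset.sum_mul]
    exact Finset.sum_congr rfl fun k _ => by ring

/-- Along `u k` the two remainders differ by `n ^ λ (W' - W)`, whose modulus is exactly `n ^ σ₂ ‖W'
- W‖`. The almost sure half of the expansion suffices. -/
theorem JordanBasis.HasExpansion.ae_eq {W' : Fin s → Ω → ℂ} (h : B.HasExpansion r μ X W)
    (h' : B.HasExpansion r μ X W') {k : Fin s} (hk : k ∈ secondIndices s r)
    (hre : (B.lam k).re = D.sigma2) : W' k =ᵐ[μ] W k := by
  set N : Seminorm ℂ (ℂ ⊗[ℝ] V) := (B.u k).toSeminorm with hN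
  filter_upwards [h.1, h'.1] with ω h1 h2
  have h3 := (h1 N).add (h2 N)
  have h4 : Tendsto (fun n : ℕ => (N (B.remainder r X W n ω) + N (B.remainder r X W' n ω))
      / (n : ℝ) ^ D.sigma2) atTop (𝓝 0) := h3.tendsto_div_nhds_zero
  have h5 : ‖W' k ω - W k ω‖ ≤ 0 := by
    refine ge_of_tendsto h4 ?_
    filter_upwards [eventually_gt_atTop 0] with n hn
    have hp : 0 < (n : ℝ) ^ D.sigma2 := Real.rpow_pos_of_pos (by exact_mod_cast hn) _
    rw [le_div_iff₀ hp]
    have e : (n : ℂ) ^ B.lam k * (W' k ω - W k ω)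
        = B.u k (B.remainder r X W n ω) - B.u k (B.remainder r X W' n ω) := by
      rw [B.u_remainder, B.u_remainder, if_pos hk, if_pos hk]
      ring
    have h6 : ‖(n : ℂ) ^ B.lam k * (W' k ω - W k ω)‖ = ‖W' k ω - W k ω‖ * (n : ℝ) ^ D.sigma2 := by
      rw [norm_mul, Complex.norm_natCast_cpow_of_pos hn, hre, mul_comm]
    rw [← h6, e]
    exact norm_sub_le _ _
  exact sub_eq_zero.1 (norm_le_zero_iff.1 h5)

end Expansion

/-! ### Martingale limits and their joint moments -/

section Limit

theorem cpow_sum_natCast_mul {ι : Type*} (S : Finset ι) (α : ι → ℕ) (lam : ι → ℂ) {x : ℂ}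
    (hx : x ≠ 0) : x ^ (∑ k ∈ S, (α k : ℂ) * lam k) = ∏ k ∈ S, (x ^ lam k) ^ α k := by
  classical
  induction S using Finset.induction_on with
  | empty => simp
  | insert i S hi ih =>
    rw [Finset.sum_insert hi, Finset.prod_insert hi, Complex.cpow_add _ _ hx, ih,
      Complex.cpow_nat_mul]

variable {V : Type*} [AddCommGroup V] [Module ℝ V] [FiniteDimensional ℝ V] [MeasurableSpace V]
  [MeasurableSingletonClass V] {s : ℕ} [NeZero s] {D : PolyaData V s}
  {Ω : Type*} {mΩ : MeasurableSpace Ω} {μ : Measure Ω} [IsProbabilityMeasure μ] {X : ℕ → Ω → V}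
  {B : JordanBasis D} {r : ℕ}

theorem JordanBasis.sigma2_le_one (B : JordanBasis D) (hr : 2 ≤ r) (hrs : r ≤ s)
    (hB : ∀ k : Fin s, (k : ℕ) < r ↔ B.IsEigenform k ∧ D.sigma2 ≤ (B.lam k).re) :
    D.sigma2 ≤ 1 := by
  have h := JordanBasis.re_eq_of_mem hB (k := ⟨1, by omega⟩)
    (mem_secondIndices.2 ⟨le_rfl, by simp only; omega⟩)
  rw [← h]
  exact D.re_le_one ((B.hasEigenvalue_iff _).2 ⟨_, rfl⟩)

/-- Finitely many tail roots have real part strictly below `σ₂`, so one `ρ` just below `σ₂`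
dominates them and stays above `1/2`. -/
theorem JordanBasis.exists_exponent (hlarge : D.IsLarge) (hss : D.IsPrincipallySemisimple)
    (hr : 2 ≤ r)
    (hB : ∀ k : Fin s, (k : ℕ) < r ↔ B.IsEigenform k ∧ D.sigma2 ≤ (B.lam k).re) :
    ∃ ρ : ℝ, 1 / 2 < ρ ∧ ρ < D.sigma2 ∧ ∀ k : Fin s, r ≤ (k : ℕ) → (B.lam k).re < ρ := by
  have h : ∀ k : Fin s, ∀ᶠ ρ in 𝓝[<] D.sigma2, r ≤ (k : ℕ) → (B.lam k).re < ρ := fun k => by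
    by_cases hk : r ≤ (k : ℕ)
    · filter_upwards [Ioo_mem_nhdsLT (JordanBasis.re_lt_of_le hss hr hB hk)] with ρ hρ _
      exact hρ.1
    · exact Eventually.of_forall fun _ h => absurd h hk
  have h2 : ∀ᶠ ρ in 𝓝[<] D.sigma2, ρ ∈ Set.Ioo (1 / 2 : ℝ) D.sigma2 := Ioo_mem_nhdsLT hlarge
  obtain ⟨ρ, h3, h4⟩ := (h2.and (eventually_all.2 h)).exists
  exact ⟨ρ, h3.1, h3.2, h4⟩

theorem hasLpGrowth_growth {τ : ℝ} (hτ : 0 < τ) {z : ℂ} (hz : 0 ≤ z.re) :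
    HasLpGrowth μ (fun n _ => growth τ z n) z.re := by
  obtain ⟨_, C, _, hC, h⟩ := exists_bounds_growth hτ hz
  exact hasLpGrowth_of_bound hC.le fun n => Eventually.of_forall fun _ => (h n).2

/-- The martingale limits of the coordinates of an eigenform of large root. -/
theorem IsPolyaProcess.exists_lpApprox (hX : IsPolyaProcess D μ X) (B : JordanBasis D)
    {k : Fin s} (hk : B.eps k = 0) {σ : ℝ} (hσ : 1 / 2 < σ) (hre : (B.lam k).re = σ) :
    ∃ Z : Ω → ℂ, Measurable Z ∧
      LpApprox μ (fun n ω => (growth D.tau1 (B.lam k) n)⁻¹ * B.u k (1 ⊗ₜ[ℝ] X (n + 1) ω)) Z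
        (-((2 * σ - 1) / 4)) := by
  obtain ⟨Z, h1, h2, h3⟩ := hX.exists_limit B hk (by rwa [hre])
  rw [hre] at h3
  exact ⟨Z, h1, fun n => hX.aestronglyMeasurable n fun v =>
    (growth D.tau1 (B.lam k) n)⁻¹ * B.u k (1 ⊗ₜ[ℝ] v), h2, h3⟩

/-- Two errors add up: the growth times the martingale error, small by the polynomial rate, and the
limit times the error in replacing the growth by its Gamma equivalent. -/
theorem isSmall_sub_of_lpApprox {τ : ℝ} (hτ : 0 < τ) {z : ℂ} (hz : 0 ≤ z.re)
    {f : ℕ → Ω → ℂ} {Z : Ω → ℂ} {a : ℝ} (ha : a < 0)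
    (h : LpApprox μ (fun n ω => (growth τ z n)⁻¹ * f n ω) Z a) :
    IsSmall μ (fun n ω => f n ω
      - ((n + 1 : ℕ) : ℂ) ^ z * (Complex.Gamma τ / Complex.Gamma (τ + z) * Z ω)) z.re := by
  set c := Complex.Gamma τ / Complex.Gamma (τ + z) with hc
  have hg : ∀ n, growth τ z n ≠ 0 := growth_ne_zero hτ hz
  have h1 : IsSmall μ (fun n ω => growth τ z n * ((growth τ z n)⁻¹ * f n ω - Z ω)) z.re :=
    ((hasLpGrowth_growth hτ hz).mul h.growth_sub (fun _ => aestronglyMeasurable_const)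
      (fun n => (h.aesm n).sub h.aesm_limit)).isSmall (by linarith)
      (fun n => ((h.aesm n).sub h.aesm_limit).const_mul _)
  have h2 : IsSmall μ (fun n ω => (growth τ z n - ((n + 1 : ℕ) : ℂ) ^ z * c) * Z ω) z.re := by
    refine isSmall_mul_of_tendsto h.memLp ?_
    have h3 := (tendsto_iff_norm_sub_tendsto_zero.1 (tendsto_growth hτ hz))
    refine h3.congr fun n => ?_
    have hn : ((n + 1 : ℕ) : ℂ) ^ z ≠ 0 := by
      rw [← norm_ne_zero_iff, norm_natCast_succ_cpow]
      positivity
    rw [← norm_natCast_succ_cpow, ← norm_div]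
    congr 1
    rw [← hc]
    field_simp
  have h4 := h1.add h2
  convert h4 using 3 with n ω
  rw [mul_sub, mul_inv_cancel_left₀ (hg n)]
  ring

/-- The joint moments of the limits. -/
theorem integral_prod_eq_of_tendsto {S : Finset (Fin s)} {Z : Fin s → Ω → ℂ} {a : ℝ} (ha : a < 0)
    {α : Fin s → ℕ} (hα : ∀ k, k ∉ S → α k = 0) (hre : ∀ k ∈ S, 0 ≤ (B.lam k).re)
    (hZ : ∀ k ∈ S, LpApprox μ
      (fun n ω => (growth D.tau1 (B.lam k) n)⁻¹ * B.u k (1 ⊗ₜ[ℝ] X (n + 1) ω)) (Z k) a)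
    {q : ℂ} (hq : Tendsto (fun n => (∫ ω, B.monomial α (X (n + 1) ω) ∂μ)
      / growth D.tau1 (B.pairing α) n) atTop (𝓝 q)) :
    Integrable (fun ω => ∏ k ∈ S,
      (Complex.Gamma D.tau1 / Complex.Gamma (D.tau1 + B.lam k) * Z k ω) ^ α k) μ ∧
    ∫ ω, ∏ k ∈ S, (Complex.Gamma D.tau1 / Complex.Gamma (D.tau1 + B.lam k) * Z k ω) ^ α k ∂μ
      = Complex.Gamma D.tau1 / Complex.Gamma (D.tau1 + B.pairing α) * q := by
  have hτ := D.tau1_pos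
  set c : Fin s → ℂ := fun k => Complex.Gamma D.tau1 / Complex.Gamma (D.tau1 + B.lam k) with hc
  have hpair : B.pairing α = ∑ k ∈ S, (α k : ℂ) * B.lam k := by
    rw [JordanBasis.pairing]
    refine (Finset.sum_subset (Finset.subset_univ S) fun k _ hk => ?_).symm
    rw [hα k hk, Nat.cast_zero, zero_mul]
  have hpre : 0 ≤ (B.pairing α).re := by
    rw [hpair, Complex.re_sum]
    refine Finset.sum_nonneg fun k hk => ?_
    rw [show ((α k : ℂ) * B.lam k).re = α k * (B.lam k).re by simp]
    exact mul_nonneg (Nat.cast_nonneg _) (hre k hk)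
  have hc0 : ∏ k ∈ S, c k ^ α k ≠ 0 := by
    refine Finset.prod_ne_zero_iff.2 fun k hk => pow_ne_zero _ (div_ne_zero ?_ ?_)
    · exact Complex.Gamma_ne_zero_of_re_pos (by simpa)
    · refine Complex.Gamma_ne_zero_of_re_pos ?_
      have := hre k hk
      simp
      linarith
  have happ := LpApprox.prod S (fun k hk => (hZ k hk).pow ha.le (α k)) ha.le
  have hmul : (fun ω => ∏ k ∈ S, (c k * Z k ω) ^ α k)
      = fun ω => (∏ k ∈ S, c k ^ α k) * ∏ k ∈ S, Z k ω ^ α k := by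
    funext ω
    rw [← Finset.prod_mul_distrib]
    exact Finset.prod_congr rfl fun k _ => mul_pow _ _ _
  change Integrable (fun ω => ∏ k ∈ S, (c k * Z k ω) ^ α k) μ
    ∧ ∫ ω, ∏ k ∈ S, (c k * Z k ω) ^ α k ∂μ = _
  rw [hmul]
  refine ⟨happ.integrable_limit.const_mul _, ?_⟩
  rw [integral_const_mul]
  have h1 := happ.tendsto_integral ha
  -- The powers of `n` cancel because `⟨α, λ⟩` is the sum of the `α k * λ k`; only Gamma constants
  -- survive.
  have h2 : Tendsto (fun n => growth D.tau1 (B.pairing α) n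
      / ∏ k ∈ S, growth D.tau1 (B.lam k) n ^ α k) atTop
      (𝓝 (Complex.Gamma D.tau1 / Complex.Gamma (D.tau1 + B.pairing α) / ∏ k ∈ S, c k ^ α k)) := by
    have h3 := (tendsto_growth hτ hpre).div
      (tendsto_finsetProd S fun k hk => (tendsto_growth hτ (hre k hk)).pow (α k)) hc0
    refine h3.congr fun n => ?_
    have hn : ((n + 1 : ℕ) : ℂ) ≠ 0 := Nat.cast_ne_zero.2 n.succ_ne_zero
    have hn' : ∏ k ∈ S, (((n + 1 : ℕ) : ℂ) ^ B.lam k) ^ α k ≠ 0 := by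
      rw [← cpow_sum_natCast_mul S α B.lam hn]
      simp only [ne_eq, Complex.cpow_eq_zero_iff, not_and]
      exact fun h => absurd h hn
    rw [Pi.div_apply, hpair, cpow_sum_natCast_mul S α B.lam hn]
    simp only [div_pow, Finset.prod_div_distrib]
    rw [div_div_div_cancel_right₀ hn']
  have h4 : ∀ n, ∫ ω, ∏ k ∈ S,
      ((growth D.tau1 (B.lam k) n)⁻¹ * B.u k (1 ⊗ₜ[ℝ] X (n + 1) ω)) ^ α k ∂μ
      = (∫ ω, B.monomial α (X (n + 1) ω) ∂μ) / growth D.tau1 (B.pairing α) n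
        * (growth D.tau1 (B.pairing α) n / ∏ k ∈ S, growth D.tau1 (B.lam k) n ^ α k) := by
    intro n
    have hg := growth_ne_zero hτ hpre n
    rw [div_mul_div_cancel₀ hg, ← integral_div]
    congr 1
    funext ω
    have e : B.monomial α (X (n + 1) ω) = ∏ k ∈ S, B.u k (1 ⊗ₜ[ℝ] X (n + 1) ω) ^ α k := by
      rw [JordanBasis.monomial, Finset.prod_apply]
      refine (Finset.prod_subset (Finset.subset_univ S) fun k _ hk => ?_).symm
      rw [hα k hk]
      simp
    rw [e, ← Finset.prod_div_distrib]
    refine Finset.prod_congr rfl fun k _ => ?_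
    rw [mul_pow, inv_pow]
    ring
  have h5 := tendsto_nhds_unique (h1.congr h4) (hq.mul h2)
  rw [h5]
  field_simp

end Limit

end Polya

/-! ### Assembly of the theorem -/

theorem theorem2
    {V : Type*} [AddCommGroup V] [Module ℝ V] [FiniteDimensional ℝ V]
    [TopologicalSpace V] [IsTopologicalAddGroup V] [ContinuousSMul ℝ V] [T2Space V]
    [MeasurableSpace V] [BorelSpace V]
    {s : ℕ} [NeZero s] (D : Polya.PolyaData V s)
    {Ω : Type*} [MeasurableSpace Ω] (μ : Measure Ω) [IsProbabilityMeasure μ]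
    (X : ℕ → Ω → V) (hX : Polya.IsPolyaProcess D μ X)
    (hlarge : D.IsLarge) (hss : D.IsPrincipallySemisimple)
    (B : Polya.JordanBasis D) (r : ℕ) (hr : 2 ≤ r) (hrs : r ≤ s)
    (hB : ∀ k : Fin s, (k : ℕ) < r ↔ B.IsEigenform k ∧ D.sigma2 ≤ (B.lam k).re) :
    ∃ W : Fin s → Ω → ℂ,
      (∀ k ∈ Polya.secondIndices s r, Measurable (W k)) ∧
      B.HasExpansion r μ X W ∧
      (∀ W' : Fin s → Ω → ℂ, (∀ k ∈ Polya.secondIndices s r, Measurable (W' k)) →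
        B.HasExpansion r μ X W' → ∀ k ∈ Polya.secondIndices s r, W' k =ᵐ[μ] W k) ∧
      ∀ α : Fin s → ℕ, (∀ k, k ∉ Polya.secondIndices s r → α k = 0) →
        Integrable (fun ω => ∏ k ∈ Polya.secondIndices s r, W k ω ^ α k) μ ∧
        ∫ ω, ∏ k ∈ Polya.secondIndices s r, W k ω ^ α k ∂μ
          = Complex.Gamma (D.tau1 : ℂ) / Complex.Gamma ((D.tau1 : ℂ) + B.pairing α)
            * B.reduced α D.x₁ := by
  have hτ := D.tau1_pos
  have hσ : 1 / 2 < D.sigma2 := hlarge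
  have hσ1 := B.sigma2_le_one hr hrs hB
  obtain ⟨ρ, hρ, hρσ, hρre⟩ := Polya.JordanBasis.exists_exponent hlarge hss hr hB
  have hre : ∀ k ∈ Polya.secondIndices s r, (B.lam k).re = D.sigma2 := fun k hk =>
    Polya.JordanBasis.re_eq_of_mem hB hk
  have heps : ∀ k : Fin s, (k : ℕ) < r → B.eps k = 0 := fun k hk =>
    Polya.JordanBasis.eps_eq_zero_of_lt hB hk
  have ha : -((2 * D.sigma2 - 1) / 4) < 0 := by linarith
  have hex : ∀ k, ∃ Z : Ω → ℂ, k ∈ Polya.secondIndices s r → Measurable Z ∧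
      Polya.LpApprox μ (fun n ω => (Polya.growth D.tau1 (B.lam k) n)⁻¹
        * B.u k (1 ⊗ₜ[ℝ] X (n + 1) ω)) Z (-((2 * D.sigma2 - 1) / 4)) := by
    intro k
    by_cases hk : k ∈ Polya.secondIndices s r
    · obtain ⟨Z, hZ⟩ := hX.exists_lpApprox B (heps k (Polya.mem_secondIndices.1 hk).2) hσ (hre k hk)
      exact ⟨Z, fun _ => hZ⟩
    · exact ⟨0, fun h => absurd h hk⟩
  choose Z hZ using hex
  have hz : ∀ k ∈ Polya.secondIndices s r, 0 ≤ (B.lam k).re := fun k hk => by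
    rw [hre k hk]
    linarith
  have hcases : ∀ k : Fin s, k = 0 ∨ k ∈ Polya.secondIndices s r ∨ r ≤ (k : ℕ) := fun k => by
    rw [Polya.mem_secondIndices]
    by_cases h : k = 0
    · exact Or.inl h
    · have : (k : ℕ) ≠ 0 := fun h' => h (Fin.ext (by simpa using h'))
      omega
  have hzero : (0 : Fin s) ∉ Polya.secondIndices s r := by
    simp [Polya.mem_secondIndices]
  have htail : ∀ k : Fin s, r ≤ (k : ℕ) →
      Polya.HasLpGrowth μ (fun n ω => B.u k (1 ⊗ₜ[ℝ] X (n + 1) ω)) ρ := fun k hk =>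
    hX.hasLpGrowth_of_re_lt B (I := {k | r ≤ (k : ℕ)})
      (fun k hk he => Polya.JordanBasis.le_predIndex hss hr hB hk he) hρ hρre hk
  have hexp : B.HasExpansion r μ X
      fun k ω => Complex.Gamma D.tau1 / Complex.Gamma (D.tau1 + B.lam k) * Z k ω := by
    refine Polya.JordanBasis.hasExpansion_of_isSmall fun k => ?_
    simp only [B.u_remainder]
    rcases hcases k with rfl | hk | hk
    · simp only [if_true, if_neg hzero, sub_zero]
      refine Polya.HasLpGrowth.isSmall (a := 0) ?_ (by linarith) fun n =>
        hX.aestronglyMeasurable n fun v => B.u 0 (1 ⊗ₜ[ℝ] v) - ((n + 1 : ℕ) : ℂ)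
      -- Along `u 0` the remainder at time `n + 1` is the constant `(n + τ₁) - (n + 1) = τ₁ - 1`.
      refine Polya.hasLpGrowth_of_bound (abs_nonneg (D.tau1 - 1)) fun n => ?_
      filter_upwards [hX.mem_reach n] with ω hω
      rw [B.u_zero_tmul hω, Real.rpow_zero, mul_one, ← Real.norm_eq_abs, ← Complex.norm_real]
      refine le_of_eq (congrArg _ ?_)
      push_cast
      ring
    · have h0 : k ≠ 0 := fun h => hzero (h ▸ hk)
      simp only [if_neg h0, if_pos hk, sub_zero]
      rw [← hre k hk]
      exact Polya.isSmall_sub_of_lpApprox hτ (hz k hk) ha (hZ k hk).2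
    · have h0 : k ≠ 0 := by
        rintro rfl
        simp at hk
        omega
      have h1 : k ∉ Polya.secondIndices s r := by
        rw [Polya.mem_secondIndices]
        omega
      simp only [if_neg h0, if_neg h1, sub_zero]
      exact (htail k hk).isSmall hρσ fun n =>
        hX.aestronglyMeasurable n fun v => B.u k (1 ⊗ₜ[ℝ] v)
  refine ⟨fun k ω => Complex.Gamma D.tau1 / Complex.Gamma (D.tau1 + B.lam k) * Z k ω,
    fun k hk => (hZ k hk).1.const_mul _, hexp, fun W' _ hW' k hk => ?_, fun α hα => ?_⟩
  · exact Polya.JordanBasis.HasExpansion.ae_eq hexp hW' hk (hre k hk)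
  · refine Polya.integral_prod_eq_of_tendsto ha hα hz (fun k hk => (hZ k hk).2) ?_
    -- The weights are the growth exponents of the coordinates: exact for the first `r` forms, an
    -- upper bound for the tail. They lie in `[ρ, 1]`, as the filtration argument requires.
    have hw : ∀ k : Fin s, ∃ x : ℝ, (k = 0 → x = 1) ∧
        (k ∈ Polya.secondIndices s r → x = D.sigma2) ∧ (r ≤ (k : ℕ) → x = ρ) := fun k => by
      rcases hcases k with rfl | hk | hk
      · exact ⟨1, fun _ => rfl, fun h => absurd h hzero, fun h => by simp at h; omega⟩
      · refine ⟨D.sigma2, fun h => absurd (h ▸ hk) hzero, fun _ => rfl, fun h => ?_⟩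
        rw [Polya.mem_secondIndices] at hk
        omega
      · refine ⟨ρ, ?_, fun h => ?_, fun _ => rfl⟩
        · rintro rfl
          simp at hk
          omega
        · rw [Polya.mem_secondIndices] at h
          omega
    choose w hw0 hw1 hw2 using hw
    refine hX.tendsto_integral_monomial (w := w) hρ (fun k => ?_) (fun k => ?_) (fun k he => ?_)
      (fun k => ?_) α fun k hk => ?_
    · rcases hcases k with h | h | h
      · rw [hw0 k h]; linarith
      · rw [hw1 k h]; linarith
      · rw [hw2 k h]
    · rcases hcases k with h | h | h
      · rw [hw0 k h]
      · rw [hw1 k h]; linarith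
      · rw [hw2 k h]; linarith
    · have hk : r ≤ (k : ℕ) := by
        by_contra h
        exact he (heps k (not_le.1 h))
      rw [hw2 k hk, hw2 _ (Polya.JordanBasis.le_predIndex hss hr hB hk he)]
    · rcases hcases k with h | h | h
      · rw [hw0 k h, h]
        exact hX.hasLpGrowth_zero B
      · rw [hw1 k h]
        have h1 := (Polya.hasLpGrowth_growth (μ := μ) hτ (hz k h)).mul
          ((hZ k h).2.growth_left ha.le) (fun _ => aestronglyMeasurable_const) (hZ k h).2.aesm
        rw [hre k h, add_zero] at h1
        convert h1 using 3 with n ω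
        rw [mul_inv_cancel_left₀ (Polya.growth_ne_zero hτ (hz k h) n)]
      · rw [hw2 k h]
        exact htail k h
    · have h : k ∈ Polya.secondIndices s r := by
        by_contra h
        exact hk (hα k h)
      exact ⟨heps k (Polya.mem_secondIndices.1 h).2, by rw [hw1 k h, hre k h]⟩
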